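/- **Parallel hash bag.** Let $0<\alpha<1$ (load factor). A hash bag with upper bound $n\ge 2$ on the number of elements is an array of slots divided into chunks $0,\dots,M$ of sizes $\lambda,2\lambda,4\lambda,\dots,2^M\lambda$, of total size $\Theta(n/\alpha)$, namely between $2n/\alpha$ and $A\,n/\alpha$. It has a variable $r$ (the chunk in use, initially $0$), and a counter $\mathrm{sample}[t]$ for each chunk $t$ (initially $0$). $\mathrm{Insert}(v)$ reads $t\leftarrow r$; selects a uniformly random slot of chunk $t$; with probability $\frac{\sigma/\alpha}{2^t\lambda}$ it is sampled and atomically increments $\mathrm{sample}[t]$; if the counter is then at least $\sigma$ and $t<M$, it performs $\mathrm{CAS}(r,t,t+1)$ and starts again. Otherwise it tries to write $v$ by CAS into the selected slot, and probes the slots of the chunk linearly (cyclically) until a CAS succeeds; after more than $\kappa$ failed probes in a chunk $t<M$ it performs $\mathrm{CAS}(r,t,t+1)$ and starts again. $\mathrm{ForAll}$ is a parallel loop over all slots of the chunks $0,\dots,r$ that applies a unit-cost function to every element and skips empty slots; $\mathrm{ExtractAll}$ is a parallel pack of these slots (a bottom-up count and a top-down pass that writes the elements into an array and clears their slots), which also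 resets the counters and $r$. Starting from an empty bag, $1\le s\le n$ elements are inserted by a parallel loop of $s$ calls of $\mathrm{Insert}$, executed by $P$ processors (each runs one call at a time) whose atomic instructions are interleaved by an arbitrary, even adversarial, schedule. The threads are assumed to be loosely synchronized: there is a constant $D$ such that, while a processor is in the middle of an $\mathrm{Insert}$ and does not execute an instruction, every other processor executes at most $D$ instructions. Work is the total number of instructions; span is the longest chain of dependent instructions in the binary fork-join computation (a parallel loop forks by binary splitting). **Theorem.** For all $c>0$, $0<\alpha<1$ and $D$ there is a constant $K_0$ such that for every $A$ there is a constant $K$ with the following property. Let $\lambda\ge K_0(P+\log n)\log n$, $K_0\log n\le\sigma\le\alpha\lambda$ and $K_0\log n\le\kappa\le A\log n$. Then, for every loosely synchronized schedule: 1. Inserting $s$ elements takes expected work at most $K s$ and, with probability at least $1-n^{-c}$, span at most $K(1+\log s)\log n$ (that is, $O(\log s\log n)$ for $s\ge2$). 2. Listing the elements by $\mathrm{ForAll}$ takes, with probability at least $1-n^{-c}$, work at most $K(s+\lambda)$ and span at most $K\log(s+\lambda)$; the same event also gives span at most $K(a+1)\log s$ for every real $a$ with $\lambda\le s^a$ (so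 the span is $O(\log s)$ when $\lambda$ is polynomially bounded in $s$). 3. The same bounds hold, with probability at least $1-n^{-c}$, for packing the elements by $\mathrm{ExtractAll}$. Moreover, once all insertions have returned, $\mathrm{ForAll}$ visits each of the $s$ elements exactly once, and $\mathrm{ExtractAll}$ writes each of them exactly once into the positions $0,\dots,s-1$ of an array and leaves the bag empty. -/

import Mathlib

open MeasureTheory ProbabilityTheory
open scoped ENNReal

namespace HashBag

/-! ## Fork-join computations with work and span -/

/-- The result of a fork-join computation with its cost: `work` is the total number of
instructions, `span` the length of the longest chain of dependent instructions. -/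
structure Timed (β : Type) where
  val : β
  work : ℕ
  span : ℕ

/-- Run two computations in parallel (binary fork-join, one instruction) and combine the results. -/
def Timed.par {β γ δ : Type} (f : β → γ → δ) (a : Timed β) (b : Timed γ) : Timed δ where
  val := f a.val b.val
  work := a.work + b.work + 1
  span := max a.span b.span + 1

/-- Sequential composition. -/
def Timed.bind {β γ : Type} (a : Timed β) (f : β → Timed γ) : Timed γ where
  val := (f a.val).val
  work := a.work + (f a.val).work
  span := a.span + (f a.val).span

/-- The parallel loop over the indices `lo, …, lo + len - 1`, by binary splitting: `leaf i` is the
loop body for index `i`, and `node` combines the results of the two halves. -/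
def parLoop {β : Type} (empty : β) (node : β → β → β) (leaf : ℕ → Timed β) (lo len : ℕ) :
    Timed β :=
  if len = 0 then ⟨empty, 1, 1⟩
  else if len = 1 then leaf lo
  else Timed.par node (parLoop empty node leaf lo (len / 2))
    (parLoop empty node leaf (lo + len / 2) (len - len / 2))
termination_by len
decreasing_by all_goals omega

/-! ## The data structure -/

/-- The parameters of a hash bag: `lam` is the size of the first chunk, `sigma` the number of
samples that triggers a resize, `kappa` the number of failed probes beyond which a resize is
triggered, and `last` the index of the last chunk, so that the chunks are `0, …, last`. -/
structure Config where
  lam : ℕ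
  sigma : ℕ
  kappa : ℕ
  last : ℕ

/-- Chunk indices. -/
abbrev Config.Chunk (C : Config) : Type := Fin (C.last + 1)

/-- The chunks have sizes `lam, 2 * lam, 4 * lam, …`. -/
def Config.size (C : Config) (t : ℕ) : ℕ := C.lam * 2 ^ t

/-- The index in `bag` of the first slot of chunk `t`: `lam + 2 * lam + … + 2 ^ (t - 1) * lam`. -/
def Config.start (C : Config) (t : ℕ) : ℕ := C.lam * (2 ^ t - 1)

/-- The end index of chunk `t`, i.e. the total size of the chunks `0, …, t`. -/
def Config.tail (C : Config) (t : ℕ) : ℕ := C.start t + C.size t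

/-- The number of slots of the whole array. -/
def Config.capacity (C : Config) : ℕ := C.tail C.last

/-- The shared memory of a hash bag holding elements of `V`: the array of slots (`none` is an empty
slot), the sample counters of the chunks and the index `r` of the chunk in use. -/
structure Store (C : Config) (V : Type) where
  bag : ℕ → Option V
  sample : C.Chunk → ℕ
  r : C.Chunk

/-- The empty hash bag. -/
def Store.empty (C : Config) (V : Type) : Store C V where
  bag := fun _ => none
  sample := fun _ => 0
  r := 0

/-! ## Concurrent insertion -/

/-- The next instruction of a running call `Insert(v)`. -/
inductive PC (C : Config) where
  /-- read `r` -/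
  | read
  /-- decide at random whether to sample in chunk `t`, and select a random slot of chunk `t` -/
  | draw (t : C.Chunk)
  /-- the element was sampled: increment `sample[t]` atomically; the selected slot is `i` -/
  | count (t : C.Chunk) (i : Fin (C.size t))
  /-- `CAS(&r, t, t + 1)`, after which the insertion is started again -/
  | resize (t : C.Chunk)
  /-- `CAS` the element into slot `i` of chunk `t`, after `k` failed attempts in this chunk -/
  | cas (t : C.Chunk) (i : Fin (C.size t)) (k : ℕ)

/-- The outcome of all random choices. The `a`-th attempt (of any processor) to insert an element
into chunk `t` uses `ω t a`: whether the attempt is sampled, and its random slot. A call of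
`Insert` makes at most one attempt per chunk, so `s` entries per chunk are enough for `s` calls
and every entry is used at most once. -/
abbrev Tape (C : Config) (s : ℕ) : Type := (t : C.Chunk) → Fin s → Bool × Fin (C.size t)

/-- The law of the random choices: all are independent, an attempt in chunk `t` is sampled with
probability `(σ / α) / size t`, and its slot is uniform in the chunk. -/
noncomputable def tapeLaw (C : Config) (α : ℝ) (s : ℕ) : Measure (Tape C s) :=
  Measure.pi fun t => Measure.pi fun _ =>
    (bernoulliMeasure true false
      (Set.projIcc (0 : ℝ) 1 zero_le_one ((C.sigma / α) / (C.size t : ℝ)))).prod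
    (uniformOn Set.univ)

/-- A state of the machine that inserts the elements of `Fin s` with `P` processors. -/
structure State (C : Config) (P s : ℕ) where
  mem : Store C (Fin s)
  /-- the number of attempts made so far in each chunk, i.e. the position on the tape -/
  attempts : C.Chunk → ℕ
  /-- the number of calls of `Insert` started so far -/
  started : ℕ
  /-- the call that each processor is executing, if any -/
  proc : Fin P → Option (Fin s × PC C)
  /-- the number of instructions executed so far by each call -/
  instrs : Fin s → ℕ

/-- Before the insertions: an empty bag, all processors idle. -/
def State.init (C : Config) (P s : ℕ) : State C P s where
  mem := Store.empty C (Fin s)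
  attempts := fun _ => 0
  started := 0
  proc := fun _ => none
  instrs := fun _ => 0

/-- The cyclically next slot of a chunk. -/
def nextSlot {k : ℕ} (i : Fin k) : Fin k :=
  ⟨(i.val + 1) % k, Nat.mod_lt _ (Nat.lt_of_le_of_lt (Nat.zero_le _) i.isLt)⟩

/-- The chunk after `t` (`t` itself if it is the last one). -/
def nextChunk {C : Config} (t : C.Chunk) : C.Chunk :=
  if h : t.val < C.last then ⟨t.val + 1, Nat.succ_lt_succ h⟩ else t

/-- Processor `p` executes the instruction `pc` of its call `Insert(v)`. In the last chunk there
is nothing to resize to, and the insertion continues in that chunk. -/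
def exec {C : Config} {P s : ℕ} (ω : Tape C s) (p : Fin P) (v : Fin s) (st : State C P s) :
    PC C → State C P s
  | .read => { st with proc := Function.update st.proc p (some (v, .draw st.mem.r)) }
  | .draw t =>
    let x := ω t ⟨st.attempts t % s, Nat.mod_lt _ (Nat.lt_of_le_of_lt (Nat.zero_le _) v.isLt)⟩
    { st with
      attempts := Function.update st.attempts t (st.attempts t + 1)
      proc := Function.update st.proc p
        (some (v, if x.1 = true then .count t x.2 else .cas t x.2 0)) }
  | .count t i =>
    { st with
      mem := { st.mem with
        sample := Function.update st.mem.sample t (st.mem.sample t + 1) }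
      proc := Function.update st.proc p
        (some (v, if C.sigma ≤ st.mem.sample t + 1 ∧ t.val < C.last then .resize t
          else .cas t i 0)) }
  | .resize t =>
    { st with
      mem := { st.mem with r := if st.mem.r = t then nextChunk t else st.mem.r }
      proc := Function.update st.proc p (some (v, .read)) }
  | .cas t i k =>
    if st.mem.bag (C.start t + i) = none then
      { st with
        mem := { st.mem with bag := Function.update st.mem.bag (C.start t + i) (some v) }
        proc := Function.update st.proc p none }
    else
      { st with
        proc := Function.update st.proc p
          (some (v, if C.kappa < k + 1 ∧ t.val < C.last then .resize t
            else .cas t (nextSlot i) (k + 1))) }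

/-- Processor `p` is scheduled. If it is executing a call of `Insert`, it executes one instruction
of it. If it is idle, it starts the next call (one instruction), provided that one is left. -/
def step {C : Config} {P s : ℕ} (ω : Tape C s) (st : State C P s) (p : Fin P) : State C P s :=
  match st.proc p with
  | some (v, pc) =>
    exec ω p v { st with instrs := Function.update st.instrs v (st.instrs v + 1) } pc
  | none =>
    if h : st.started < s then
      { st with
        started := st.started + 1
        proc := Function.update st.proc p (some (⟨st.started, h⟩, .read))
        instrs := Function.update st.instrs ⟨st.started, h⟩ 1 }
    else st

/-- The state after the processors have executed instructions in the order given by a schedule. -/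
def run {C : Config} {P s : ℕ} (ω : Tape C s) (sched : List (Fin P)) : State C P s :=
  sched.foldl (step ω) (State.init C P s)

/-- All calls of `Insert` have been started and have returned. -/
def State.Complete {C : Config} {P s : ℕ} (st : State C P s) : Prop :=
  st.started = s ∧ ∀ p, st.proc p = none

/-- The threads are loosely synchronized: while a processor is in the middle of a call of `Insert`
and does not execute an instruction, every other processor executes at most `D` instructions. -/
def LooselySynchronized {C : Config} {P s : ℕ} (D : ℕ) (ω : Tape C s) (sched : List (Fin P)) :
    Prop :=
  ∀ l₁ l₂ l₃ : List (Fin P), sched = l₁ ++ l₂ ++ l₃ →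
    ∀ p, (run ω l₁).proc p ≠ none → p ∉ l₂ → ∀ q, l₂.count q ≤ D

/-- The `s` insertions as a fork-join computation: a parallel loop over the calls, whose cost is
the number of instructions that they executed. -/
def insertions {C : Config} {P s : ℕ} (st : State C P s) : Timed Unit :=
  parLoop () (fun _ _ => ())
    (fun e => if h : e < s then ⟨(), st.instrs ⟨e, h⟩, st.instrs ⟨e, h⟩⟩ else ⟨(), 0, 0⟩) 0 s

/-! ## Listing and packing -/

/-- `ForAll`: a parallel loop over the slots of the chunks `0, …, r` that skips the empty slots and
applies a (unit cost) function to the elements. The value lists the elements to which the function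
is applied. -/
def forAll {C : Config} {V : Type} (m : Store C V) : Timed (List V) :=
  parLoop [] (· ++ ·)
    (fun i => match m.bag i with
      | none => ⟨[], 1, 1⟩
      | some v => ⟨[v], 2, 2⟩)
    0 (C.tail m.r)

/-- A binary tree over an interval of slots, each node storing the number of elements below it. -/
inductive CountTree where
  | empty
  | leaf (slot cnt : ℕ)
  | node (cnt : ℕ) (left right : CountTree)

/-- The number stored at the root. -/
def CountTree.cnt : CountTree → ℕ
  | .empty => 0
  | .leaf _ c => c
  | .node c _ _ => c

/-- First pass of the parallel pack: count the elements bottom-up. -/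
def upSweep {C : Config} {V : Type} (m : Store C V) : Timed CountTree :=
  parLoop .empty (fun a b => .node (a.cnt + b.cnt) a b)
    (fun i => match m.bag i with
      | none => ⟨.leaf i 0, 1, 1⟩
      | some _ => ⟨.leaf i 1, 1, 1⟩)
    0 (C.tail m.r)

/-- Second pass of the parallel pack: pass down to each subtree the position `off` in the output
array of its first element; at a leaf, write the element to the output array and clear the slot.
The value lists the writes to the output array (position, element) and the cleared slots. -/
def downSweep {V : Type} (bag : ℕ → Option V) : CountTree → ℕ → Timed (List (ℕ × V) × List ℕ)
  | .empty, _ => ⟨([], []), 1, 1⟩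
  | .leaf i _, off => match bag i with
    | none => ⟨([], []), 1, 1⟩
    | some v => ⟨([(off, v)], [i]), 3, 3⟩
  | .node _ a b, off =>
    Timed.par (fun x y => (x.1 ++ y.1, x.2 ++ y.2)) (downSweep bag a off)
      (downSweep bag b (off + a.cnt))

/-- `ExtractAll`: a parallel pack of the slots of the chunks `0, …, r`, which also clears the slots,
followed by a parallel loop that resets the sample counters of these chunks, and `r := 0`. The
value consists of the writes to the output array and the resulting shared memory. -/
def extractAll {C : Config} {V : Type} (m : Store C V) : Timed (List (ℕ × V) × Store C V) :=
  (upSweep m).bind fun tree =>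
  (downSweep m.bag tree 0).bind fun out =>
  (parLoop [] (· ++ ·) (fun i => ⟨[i], 1, 1⟩) 0 (m.r.val + 1)).bind fun reset =>
    { val := (out.1,
        { bag := fun i => if i ∈ out.2 then none else m.bag i
          sample := fun t => if t.val ∈ reset then 0 else m.sample t
          r := 0 })
      work := 1
      span := 1 }

end HashBag

set_option linter.unusedSimpArgs false

namespace HashBag

/-! ### Cost and value of a parallel loop -/

/-! The schedule may depend on all random choices, so no probability is assigned to events of an
execution under a fixed schedule. Instead, executions are controlled through counts read off the
tape: `hits ω t B a` is the number of the first `a` attempts in chunk `t` with outcome in `B`. A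
call draws at most once per chunk, so the attempts in a chunk use its tape entries in order and
without reuse, and for fixed `a` the count is a sum of independent indicators. The predicate
`Typical` collects the bounds needed on these counts. It fails with polynomially small probability,
by Chernoff's bound and a union bound; where it holds, the span and slot bounds are deterministic
for all loosely synchronized schedules.

Load factor. Fix `α < α₁ < β < 1`. An attempt is sampled with probability `σ / (α * size)`, so
typically the first `α * size / 2` attempts contain fewer than `σ` samples and the first `α₁ * size`
at least `σ`. Once `σ` of the attempts made are sampled, loose synchronization forces the pending
increments within `P * D + 1` instructions and the CAS on `r` within `P * D + 1` more; after that,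
only the at most `P` calls that have already read the old `r` can still draw in the chunk
(`attempts_le_of_sampled`). As `λ` exceeds a multiple of `P`, a chunk receives at most `β * size`
attempts. Conversely, a chunk is left only after more than `α * size / 2` attempts
(`Typical.few_lt`), so the chunks in use have total size `O(s + λ)` and there are `O(1 + log s)` of
them. The costs of listing and packing follow.

Linear probing. Probes advance one slot at a time and only past full slots. If the slot before a
cyclic run of full slots is empty, no probe has entered the run from outside, so the attempts hashed
to the run account for all its elements and for all failures at its last slot (`State.Accounted`,
`State.Accounted.exists_run`). At load `β < 1` a run of length `len` is overloaded with probability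
at most `(β * exp (1 - β)) ^ len`; hence typically no run of `κ` or more slots is, and no call fails
more than `κ` times in a chunk (`probes_le`). Thus the probe limit never triggers a resize, and a
call executes `O((r + 1) * κ)` instructions, which bounds the span.

Expected work. The failures at a slot are at most the overload of some run ending there, so all
failures in a chunk are bounded by `excess`, the sum of the positive parts of hits minus length over
all runs. Exponential moments make its expectation linear in the number of attempts, and the
attempts sum geometrically over the chunks. On atypical choices a deterministic polynomial bound on
the cost of a call is outweighed by the small probability. -/

theorem parLoop_one {β : Type} (e : β) (node : β → β → β) (leaf : ℕ → Timed β) (lo : ℕ) :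
    parLoop e node leaf lo 1 = leaf lo := by
  rw [parLoop]; simp

theorem parLoop_split {β : Type} (e : β) (node : β → β → β) (leaf : ℕ → Timed β) (lo : ℕ)
    {len : ℕ} (h : 2 ≤ len) :
    parLoop e node leaf lo len = Timed.par node (parLoop e node leaf lo (len / 2))
      (parLoop e node leaf (lo + len / 2) (len - len / 2)) := by
  rw [parLoop, if_neg (by omega), if_neg (by omega)]

/-- Induction along the binary splitting of a nonempty interval. -/
theorem splitting_induction {motive : (len : ℕ) → 1 ≤ len → ℕ → Prop}
    (one : ∀ lo, motive 1 le_rfl lo)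
    (split : ∀ len (h : 2 ≤ len) lo, motive (len / 2) (by omega) lo →
      motive (len - len / 2) (by omega) (lo + len / 2) → motive len (by omega) lo)
    (len : ℕ) (h : 1 ≤ len) (lo : ℕ) : motive len h lo := by
  induction len using Nat.strong_induction_on generalizing lo with
  | _ len ih =>
    rcases Nat.lt_or_ge len 2 with h2 | h2
    · obtain rfl : len = 1 := by omega
      exact one lo
    · exact split len h2 lo (ih _ (by omega) (by omega) _) (ih _ (by omega) (by omega) _)

theorem parLoop_work {β : Type} (e : β) (node : β → β → β) (leaf : ℕ → Timed β) (len : ℕ)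
    (h : 1 ≤ len) (lo : ℕ) :
    (parLoop e node leaf lo len).work
      = ∑ i ∈ Finset.Ico lo (lo + len), (leaf i).work + (len - 1) := by
  induction len, h, lo using splitting_induction with
  | one lo => simp [parLoop_one]
  | split len h2 lo ih1 ih2 =>
    rw [parLoop_split _ _ _ _ h2]
    simp only [Timed.par]
    rw [ih1, ih2, ← Finset.sum_Ico_consecutive _ (Nat.le_add_right lo (len / 2))
      (show lo + len / 2 ≤ lo + len by omega),
      show lo + len / 2 + (len - len / 2) = lo + len by omega]
    omega

theorem parLoop_work_le {β : Type} (e : β) (node : β → β → β) (leaf : ℕ → Timed β) (len : ℕ)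
    (h : 1 ≤ len) (lo b : ℕ) (hb : ∀ i, (leaf i).work ≤ b) :
    (parLoop e node leaf lo len).work ≤ (b + 1) * len := by
  rw [parLoop_work _ _ _ _ h]
  have := Finset.sum_le_card_nsmul (Finset.Ico lo (lo + len)) (fun i => (leaf i).work) b
    (fun i _ => hb i)
  simp only [Nat.card_Ico, Nat.add_sub_cancel_left, smul_eq_mul] at this
  nlinarith [Nat.sub_le len 1]

theorem clog_halves {len : ℕ} (h : 2 ≤ len) :
    Nat.clog 2 (len / 2) + 1 ≤ Nat.clog 2 len ∧ Nat.clog 2 (len - len / 2) + 1 ≤ Nat.clog 2 len := by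
  rw [Nat.clog_of_two_le (n := len) (by norm_num) h]
  exact ⟨Nat.succ_le_succ (Nat.clog_mono_right _ (by omega)),
    Nat.succ_le_succ (Nat.clog_mono_right _ (by omega))⟩

theorem parLoop_span_le {β : Type} (e : β) (node : β → β → β) (leaf : ℕ → Timed β) (b : ℕ)
    (hb : ∀ i, (leaf i).span ≤ b) (len : ℕ) (h : 1 ≤ len) (lo : ℕ) :
    (parLoop e node leaf lo len).span ≤ b + Nat.clog 2 len := by
  induction len, h, lo using splitting_induction with
  | one lo => simpa [parLoop_one] using hb lo
  | split len h2 lo ih1 ih2 =>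
    rw [parLoop_split _ _ _ _ h2]
    simp only [Timed.par]
    have := clog_halves h2
    omega

theorem range'_halves (lo len : ℕ) :
    List.range' lo len = List.range' lo (len / 2) ++ List.range' (lo + len / 2) (len - len / 2) := by
  rw [List.range'_append_1]; congr 1; omega

theorem parLoop_append_val {γ : Type} (leaf : ℕ → Timed (List γ)) (len : ℕ) (h : 1 ≤ len)
    (lo : ℕ) :
    (parLoop [] (· ++ ·) leaf lo len).val = (List.range' lo len).flatMap fun i => (leaf i).val := by
  induction len, h, lo using splitting_induction with
  | one lo => simp [parLoop_one]
  | split len h2 lo ih1 ih2 =>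
    rw [parLoop_split _ _ _ _ h2, range'_halves lo len, List.flatMap_append, ← ih1, ← ih2]
    rfl

/-! ### Listing and packing -/

section

variable {C : Config} {V : Type}

theorem flatMap_toList {γ : Type} (f : ℕ → Option γ) (l : List ℕ) :
    (l.flatMap fun i => (f i).toList) = l.filterMap f := by
  induction l with
  | nil => rfl
  | cons a l ih =>
    rw [List.flatMap_cons, ih, List.filterMap_cons]
    cases f a <;> rfl

theorem forAll_val (m : Store C V) (h : 1 ≤ C.tail m.r) :
    (forAll m).val = (List.range (C.tail m.r)).filterMap m.bag := by
  unfold forAll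
  rw [parLoop_append_val _ _ h, ← flatMap_toList, List.range_eq_range']
  congr 1
  funext i
  cases m.bag i <;> rfl

theorem forAll_work_le (m : Store C V) (h : 1 ≤ C.tail m.r) :
    (forAll m).work ≤ 3 * C.tail m.r := by
  refine parLoop_work_le _ _ _ _ h _ 2 fun i => ?_
  cases m.bag i <;> simp

theorem forAll_span_le (m : Store C V) (h : 1 ≤ C.tail m.r) :
    (forAll m).span ≤ 2 + Nat.clog 2 (C.tail m.r) := by
  refine parLoop_span_le _ _ _ 2 (fun i => ?_) _ h _
  cases m.bag i <;> simp

/-- The tree that the first pass of the pack builds over the slots `lo, …, lo + len - 1`. -/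
def countLoop (bag : ℕ → Option V) (lo len : ℕ) : Timed CountTree :=
  parLoop .empty (fun a b => .node (a.cnt + b.cnt) a b)
    (fun i => match bag i with
      | none => ⟨.leaf i 0, 1, 1⟩
      | some _ => ⟨.leaf i 1, 1, 1⟩) lo len

theorem countLoop_split (bag : ℕ → Option V) (lo : ℕ) {len : ℕ} (h : 2 ≤ len) :
    (countLoop bag lo len).val = .node ((countLoop bag lo (len / 2)).val.cnt
        + (countLoop bag (lo + len / 2) (len - len / 2)).val.cnt)
      (countLoop bag lo (len / 2)).val (countLoop bag (lo + len / 2) (len - len / 2)).val := by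
  rw [countLoop, parLoop_split _ _ _ _ h]
  rfl

theorem countLoop_one (bag : ℕ → Option V) (lo : ℕ) :
    (countLoop bag lo 1).val = .leaf lo (if (bag lo).isSome then 1 else 0) := by
  rw [countLoop, parLoop_one]
  cases bag lo <;> rfl

theorem countLoop_cnt (bag : ℕ → Option V) (len : ℕ) (h : 1 ≤ len) (lo : ℕ) :
    (countLoop bag lo len).val.cnt = ((List.range' lo len).filterMap bag).length := by
  induction len, h, lo using splitting_induction with
  | one lo =>
    rw [countLoop_one]
    cases hb : bag lo <;> simp [CountTree.cnt, hb]
  | split len h2 lo ih1 ih2 =>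
    rw [countLoop_split _ _ h2, range'_halves lo len, List.filterMap_append, List.length_append,
      ← ih1, ← ih2]
    rfl

/-- The count stored at the left child is exactly the number of writes made there, so the right half
continues at the next free position. The `+ 1` in the work bound leaves room for the fork at each
node. -/
theorem downSweep_countLoop (bag : ℕ → Option V) (len : ℕ) (h : 1 ≤ len) (lo : ℕ) :
    ∀ off, (downSweep bag (countLoop bag lo len).val off).val.1.map Prod.fst
        = List.range' off ((List.range' lo len).filterMap bag).length ∧
      (downSweep bag (countLoop bag lo len).val off).val.1.map Prod.snd
        = (List.range' lo len).filterMap bag ∧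
      (downSweep bag (countLoop bag lo len).val off).val.2
        = (List.range' lo len).filter (fun i => (bag i).isSome) ∧
      (downSweep bag (countLoop bag lo len).val off).work + 1 ≤ 4 * len ∧
      (downSweep bag (countLoop bag lo len).val off).span ≤ 3 + Nat.clog 2 len := by
  induction len, h, lo using splitting_induction with
  | one lo =>
    intro off
    rw [countLoop_one]
    cases hb : bag lo <;> simp [downSweep, hb]
  | split len h2 lo ih1 ih2 =>
    intro off
    obtain ⟨a1, a2, a3, a4, a5⟩ := ih1 off
    obtain ⟨b1, b2, b3, b4, b5⟩ := ih2 (off + (countLoop bag lo (len / 2)).val.cnt)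
    have hc := clog_halves h2
    rw [countLoop_split _ _ h2, range'_halves lo len, List.filterMap_append, List.filter_append]
    simp only [downSweep, Timed.par, List.map_append]
    refine ⟨?_, ?_, ?_, ?_, ?_⟩
    · rw [a1, b1, countLoop_cnt _ _ (by omega), List.range'_append_1, List.length_append]
    · rw [a2, b2]
    · rw [a3, b3]
    · omega
    · omega

theorem upSweep_eq (m : Store C V) : upSweep m = countLoop m.bag 0 (C.tail m.r) := rfl

theorem upSweep_work_le (m : Store C V) (h : 1 ≤ C.tail m.r) :
    (upSweep m).work ≤ 2 * C.tail m.r := by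
  refine parLoop_work_le _ _ _ _ h _ 1 fun i => ?_
  cases m.bag i <;> simp

theorem upSweep_span_le (m : Store C V) (h : 1 ≤ C.tail m.r) :
    (upSweep m).span ≤ 1 + Nat.clog 2 (C.tail m.r) := by
  refine parLoop_span_le _ _ _ 1 (fun i => ?_) _ h _
  cases m.bag i <;> simp

theorem extractAll_work_le (m : Store C V) (h : m.r.val + 1 ≤ C.tail m.r) :
    (extractAll m).work ≤ 9 * C.tail m.r := by
  have h1 := upSweep_work_le m (by omega)
  have h2 := (downSweep_countLoop m.bag (C.tail m.r) (by omega) 0 0).2.2.2.1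
  have h3 := parLoop_work_le ([] : List ℕ) (· ++ ·) (fun i => ⟨[i], 1, 1⟩) (m.r.val + 1)
    (by omega) 0 1 (fun i => le_rfl)
  simp only [extractAll, Timed.bind]
  rw [← upSweep_eq] at h2
  omega

theorem extractAll_span_le (m : Store C V) (h : m.r.val + 1 ≤ C.tail m.r) :
    (extractAll m).span ≤ 6 + 3 * Nat.clog 2 (C.tail m.r) := by
  have h1 := upSweep_span_le m (by omega)
  have h2 := (downSweep_countLoop m.bag (C.tail m.r) (by omega) 0 0).2.2.2.2
  have h3 := parLoop_span_le ([] : List ℕ) (· ++ ·) (fun i => ⟨[i], 1, 1⟩) 1 (fun i => le_rfl)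
    (m.r.val + 1) (by omega) 0
  have h4 : Nat.clog 2 (m.r.val + 1) ≤ Nat.clog 2 (C.tail m.r) := Nat.clog_mono_right _ h
  simp only [extractAll, Timed.bind]
  rw [← upSweep_eq] at h2
  omega

theorem extractAll_positions (m : Store C V) (h : 1 ≤ C.tail m.r) :
    (extractAll m).val.1.map Prod.fst
      = List.range ((List.range (C.tail m.r)).filterMap m.bag).length := by
  have := (downSweep_countLoop m.bag (C.tail m.r) h 0 0).1
  rw [← upSweep_eq] at this
  simpa [extractAll, Timed.bind, List.range_eq_range'] using this

theorem extractAll_elements (m : Store C V) (h : 1 ≤ C.tail m.r) :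
    (extractAll m).val.1.map Prod.snd = (List.range (C.tail m.r)).filterMap m.bag := by
  have := (downSweep_countLoop m.bag (C.tail m.r) h 0 0).2.1
  rw [← upSweep_eq] at this
  simpa [extractAll, Timed.bind, List.range_eq_range'] using this

/-- Only the slots and counters of the chunks up to `r` are cleared; the two hypotheses, supplied
later by `State.Confined`, say that nothing else was touched. -/
theorem extractAll_store (m : Store C V) (h : 1 ≤ C.tail m.r)
    (hbag : ∀ i, m.bag i ≠ none → i < C.tail m.r) (hsample : ∀ t, m.sample t ≠ 0 → t ≤ m.r) :
    (extractAll m).val.2 = Store.empty C V := by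
  have hd := (downSweep_countLoop m.bag (C.tail m.r) h 0 0).2.2.1
  rw [← upSweep_eq] at hd
  simp only [extractAll, Timed.bind, Store.empty, hd]
  rw [parLoop_append_val _ _ (by omega)]
  congr 1
  · funext i
    split_ifs with hi
    · rfl
    · by_contra hne
      refine hi (List.mem_filter.2 ⟨?_, Option.isSome_iff_ne_none.2 hne⟩)
      simpa [List.mem_range'_1] using hbag i hne
  · funext t
    split_ifs with ht
    · rfl
    · by_contra hne
      refine ht (List.mem_flatMap.2 ⟨t.val, ?_, by simp⟩)
      have := Fin.le_def.1 (hsample t hne)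
      simp [List.mem_range'_1]; omega

/-! ### The cost of the insertions -/

theorem insertions_work {P s : ℕ} (st : State C P s) (hs : 1 ≤ s) :
    (insertions st).work = ∑ v, st.instrs v + (s - 1) := by
  rw [insertions, parLoop_work _ _ _ _ hs, zero_add, ← Finset.range_eq_Ico, Finset.sum_range]
  simp

theorem insertions_span_le {P s : ℕ} (st : State C P s) (hs : 1 ≤ s) (b : ℕ)
    (hb : ∀ v, st.instrs v ≤ b) : (insertions st).span ≤ b + Nat.clog 2 s := by
  refine parLoop_span_le _ _ _ b (fun i => ?_) _ hs _
  split_ifs with h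
  · exact hb _
  · exact Nat.zero_le _

end

/-! ### The steps of the machine -/

variable {C : Config} {P s : ℕ}

theorem run_nil (ω : Tape C s) : run (P := P) ω [] = State.init C P s := rfl

theorem run_snoc (ω : Tape C s) (l : List (Fin P)) (p : Fin P) :
    run ω (l ++ [p]) = step ω (run ω l) p := by
  simp [run]

/-- Count one more instruction of the call `v`. -/
def State.tick (st : State C P s) (v : Fin s) : Fin s → ℕ :=
  Function.update st.instrs v (st.instrs v + 1)

/-- The program counters of the processors after processor `p` moves on to `pc`. -/
def State.goto (st : State C P s) (p : Fin P) (v : Fin s) (pc : PC C) :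
    Fin P → Option (Fin s × PC C) :=
  Function.update st.proc p (some (v, pc))

/-- The index `r` after a `CAS(&r, t, t + 1)`. -/
def Store.bumped {V : Type} (m : Store C V) (t : C.Chunk) : C.Chunk :=
  if m.r = t then nextChunk t else m.r

/-- Case analysis on the instruction that processor `p` executes. -/
theorem step_cases {ω : Tape C s} {st : State C P s} {p : Fin P} {motive : State C P s → Prop}
    (skip : motive st)
    (start : st.proc p = none → ∀ h : st.started < s, motive
      { st with
        started := st.started + 1
        proc := st.goto p ⟨st.started, h⟩ .read
        instrs := Function.update st.instrs ⟨st.started, h⟩ 1 })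
    (read : ∀ v, st.proc p = some (v, .read) → motive
      { st with
        proc := st.goto p v (.draw st.mem.r)
        instrs := st.tick v })
    (drawSampled : ∀ v t, st.proc p = some (v, .draw t) → ∀ j : Fin s,
      j.val = st.attempts t % s → (ω t j).1 = true → motive
      { st with
        attempts := Function.update st.attempts t (st.attempts t + 1)
        proc := st.goto p v (.count t (ω t j).2)
        instrs := st.tick v })
    (drawUnsampled : ∀ v t, st.proc p = some (v, .draw t) → ∀ j : Fin s,
      j.val = st.attempts t % s → (ω t j).1 = false → motive
      { st with
        attempts := Function.update st.attempts t (st.attempts t + 1)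
        proc := st.goto p v (.cas t (ω t j).2 0)
        instrs := st.tick v })
    (countFull : ∀ v t i, st.proc p = some (v, .count t i) →
      C.sigma ≤ st.mem.sample t + 1 → t.val < C.last → motive
      { st with
        mem := { st.mem with
          sample := Function.update st.mem.sample t (st.mem.sample t + 1) }
        proc := st.goto p v (.resize t)
        instrs := st.tick v })
    (countCas : ∀ v t i, st.proc p = some (v, .count t i) →
      ¬ (C.sigma ≤ st.mem.sample t + 1 ∧ t.val < C.last) → motive
      { st with
        mem := { st.mem with
          sample := Function.update st.mem.sample t (st.mem.sample t + 1) }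
        proc := st.goto p v (.cas t i 0)
        instrs := st.tick v })
    (resize : ∀ v t, st.proc p = some (v, .resize t) → motive
      { st with
        mem := { st.mem with r := st.mem.bumped t }
        proc := st.goto p v .read
        instrs := st.tick v })
    (casSuccess : ∀ v t i k, st.proc p = some (v, .cas t i k) →
      st.mem.bag (C.start t + i) = none → motive
      { st with
        mem := { st.mem with bag := Function.update st.mem.bag (C.start t + i) (some v) }
        proc := Function.update st.proc p none
        instrs := st.tick v })
    (casQuit : ∀ v t i k, st.proc p = some (v, .cas t i k) →
      st.mem.bag (C.start t + i) ≠ none → C.kappa < k + 1 → t.val < C.last → motive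
      { st with
        proc := st.goto p v (.resize t)
        instrs := st.tick v })
    (casNext : ∀ v t i k, st.proc p = some (v, .cas t i k) →
      st.mem.bag (C.start t + i) ≠ none → ¬ (C.kappa < k + 1 ∧ t.val < C.last) → motive
      { st with
        proc := st.goto p v (.cas t (nextSlot i) (k + 1))
        instrs := st.tick v }) :
    motive (step ω st p) := by
  unfold step
  split
  · rename_i v pc hp
    cases pc with
    | read => exact read v hp
    | draw t =>
      simp only [exec]
      by_cases h : (ω t ⟨st.attempts t % s,
        Nat.mod_lt _ (Nat.lt_of_le_of_lt (Nat.zero_le _) v.isLt)⟩).1 = true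
      · rw [if_pos h]; exact drawSampled v t hp _ rfl h
      · rw [if_neg h]; exact drawUnsampled v t hp _ rfl (by simpa using h)
    | count t i =>
      simp only [exec]
      split_ifs with h
      · exact countFull v t i hp h.1 h.2
      · exact countCas v t i hp h
    | resize t => exact resize v t hp
    | cas t i k =>
      simp only [exec]
      split_ifs with h h'
      · exact casSuccess v t i k hp h
      · exact casQuit v t i k hp h h'.1 h'.2
      · exact casNext v t i k hp h h'
  · rename_i hp
    split_ifs with h
    · exact start hp h
    · exact skip

theorem run_induction {ω : Tape C s} {motive : State C P s → Prop}
    (init : motive (State.init C P s))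
    (step : ∀ st p, motive st → motive (step ω st p)) (l : List (Fin P)) : motive (run ω l) := by
  induction l using List.reverseRecOn with
  | nil => exact init
  | append_singleton l p ih => rw [run_snoc]; exact step _ _ ih

/-! ### Chunks and slots -/

theorem start_add_size (C : Config) (t : ℕ) : C.start t + C.size t = C.start (t + 1) := by
  simp only [Config.start, Config.size, ← Nat.mul_add, pow_succ]
  congr 1
  have := Nat.one_le_two_pow (n := t)
  omega

theorem start_mono (C : Config) {t t' : ℕ} (h : t ≤ t') : C.start t ≤ C.start t' :=
  Nat.mul_le_mul_left _ (Nat.sub_le_sub_right (Nat.pow_le_pow_right (by norm_num) h) 1)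

theorem tail_eq (C : Config) (t : ℕ) : C.tail t = C.start (t + 1) := start_add_size C t

theorem tail_mono (C : Config) {t t' : ℕ} (h : t ≤ t') : C.tail t ≤ C.tail t' := by
  rw [tail_eq, tail_eq]; exact start_mono C (by omega)

theorem tail_le (C : Config) (t : ℕ) : C.tail t ≤ 2 * C.size t := by
  rw [tail_eq, Config.start, Config.size, pow_succ]
  calc _ ≤ C.lam * (2 ^ t * 2) := Nat.mul_le_mul_left _ (Nat.sub_le _ _)
    _ = _ := by ring

theorem slot_lt_tail (C : Config) {t : ℕ} (i : Fin (C.size t)) : C.start t + i < C.tail t :=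
  Nat.add_lt_add_left i.isLt _

/-- The chunks occupy disjoint intervals of the array, so a write in one chunk does not affect
another. -/
theorem slot_chunk_inj {C : Config} {t t' : ℕ} {i : Fin (C.size t)} {i' : Fin (C.size t')}
    (h : C.start t + i = C.start t' + i') : t = t' := by
  have h1 := slot_lt_tail C i
  have h2 := slot_lt_tail C i'
  rw [tail_eq] at h1 h2
  by_contra hne
  rcases Nat.lt_or_gt_of_ne hne with hlt | hlt
  · have := start_mono C (show t + 1 ≤ t' from hlt); omega
  · have := start_mono C (show t' + 1 ≤ t from hlt); omega

theorem size_pos {C : Config} (h : 0 < C.lam) (t : ℕ) : 0 < C.size t := by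
  unfold Config.size; positivity

theorem lt_size {C : Config} (h : 0 < C.lam) (t : ℕ) : t < C.size t :=
  (Nat.lt_two_pow_self).trans_le (Nat.le_mul_of_pos_left _ h)

theorem size_mono (C : Config) {t t' : ℕ} (h : t ≤ t') : C.size t ≤ C.size t' :=
  Nat.mul_le_mul_left _ (Nat.pow_le_pow_right (by norm_num) h)

theorem succ_le_tail {C : Config} (h : 0 < C.lam) (t : ℕ) : t + 1 ≤ C.tail t :=
  (lt_size h t).trans_le (Nat.le_add_left _ _)

theorem le_bumped {V : Type} (m : Store C V) (t : C.Chunk) : m.r.val ≤ (m.bumped t).val := by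
  unfold Store.bumped nextChunk
  split_ifs with h h' <;> simp [h]

/-- Whether or not the CAS succeeds, `r` exceeds `t` afterwards: a failure means that `r` has
already moved on. This is why a call never returns to a chunk that it gave up. -/
theorem lt_bumped {V : Type} (m : Store C V) (t : C.Chunk) (h : t.val ≤ m.r.val)
    (h' : t.val < C.last) : t.val < (m.bumped t).val := by
  unfold Store.bumped nextChunk
  split_ifs with h1
  · simp
  · exact lt_of_le_of_ne h fun hh => h1 (Fin.ext hh.symm)

/-! ### Chunks in use, and the elements in the bag -/

/-- The chunk of the next instruction is at most `r`, and there is a chunk to resize to. -/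
def PC.Within (r : ℕ) : PC C → Prop
  | .read => True
  | .draw t => t.val ≤ r
  | .count t _ => t.val ≤ r
  | .resize t => t.val ≤ r ∧ t.val < C.last
  | .cas t _ _ => t.val ≤ r

theorem PC.Within.mono {r r' : ℕ} (h : r ≤ r') {pc : PC C} (hpc : pc.Within r) :
    pc.Within r' := by
  cases pc <;> simp only [PC.Within] at * <;> omega

/-- Chunks beyond `r` are untouched. -/
structure State.Confined (st : State C P s) : Prop where
  pc : ∀ p v pc, st.proc p = some (v, pc) → pc.Within st.mem.r
  sample : ∀ t, st.mem.sample t ≠ 0 → t.val ≤ st.mem.r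
  attempts : ∀ t, st.attempts t ≠ 0 → t.val ≤ st.mem.r
  bag : ∀ x, st.mem.bag x ≠ none → x < C.tail st.mem.r

theorem goto_within {st : State C P s} {r : ℕ} {p : Fin P} {v : Fin s} {pc : PC C}
    (hpc : pc.Within r) (h : ∀ q w pc', st.proc q = some (w, pc') → pc'.Within r) :
    ∀ q w pc', st.goto p v pc q = some (w, pc') → pc'.Within r := by
  intro q w pc' hq
  rcases eq_or_ne q p with rfl | hne
  · simp only [State.goto, Function.update_self, Option.some.injEq, Prod.mk.injEq] at hq
    exact hq.2 ▸ hpc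
  · rw [State.goto, Function.update_of_ne hne] at hq
    exact h q w pc' hq

theorem update_ne_zero_le {f : C.Chunk → ℕ} {t : C.Chunk} {r b : ℕ} (ht : t.val ≤ r)
    (h : ∀ u, f u ≠ 0 → u.val ≤ r) : ∀ u, Function.update f t b u ≠ 0 → u.val ≤ r := by
  intro u hu
  rcases eq_or_ne u t with rfl | hne
  · exact ht
  · rw [Function.update_of_ne hne] at hu; exact h u hu

theorem confined_run (ω : Tape C s) (l : List (Fin P)) : (run ω l).Confined := by
  refine run_induction ?_ (fun st p ih => ?_) l
  · constructor <;> simp [State.init, Store.empty]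
  have hw : ∀ v pc, st.proc p = some (v, pc) → pc.Within st.mem.r := ih.pc p
  refine step_cases ih ?_ ?_ ?_ ?_ ?_ ?_ ?_ ?_ ?_ ?_
  · intro _ h
    exact ⟨goto_within trivial ih.pc, ih.sample, ih.attempts, ih.bag⟩
  · intro v h
    exact ⟨goto_within le_rfl ih.pc, ih.sample, ih.attempts, ih.bag⟩
  · intro v t h j _ _
    have := hw _ _ h
    exact ⟨goto_within this ih.pc, ih.sample, update_ne_zero_le this ih.attempts, ih.bag⟩
  · intro v t h j _ _
    have := hw _ _ h
    exact ⟨goto_within this ih.pc, ih.sample, update_ne_zero_le this ih.attempts, ih.bag⟩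
  · intro v t i h _ h2
    have := hw _ _ h
    exact ⟨goto_within ⟨this, h2⟩ ih.pc, update_ne_zero_le this ih.sample, ih.attempts, ih.bag⟩
  · intro v t i h _
    have := hw _ _ h
    exact ⟨goto_within this ih.pc, update_ne_zero_le this ih.sample, ih.attempts, ih.bag⟩
  · intro v t h
    have hle := le_bumped st.mem t
    exact ⟨goto_within trivial fun q w pc hq => (ih.pc q w pc hq).mono hle,
      fun u hu => (ih.sample u hu).trans hle, fun u hu => (ih.attempts u hu).trans hle,
      fun x hx => (ih.bag x hx).trans_le (tail_mono C hle)⟩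
  · intro v t i k h _
    have ht := hw _ _ h
    refine ⟨fun q w pc hq => ?_, ih.sample, ih.attempts, fun x hx => ?_⟩
    · rcases eq_or_ne q p with rfl | hne
      · simp at hq
      · exact ih.pc q w pc (by simpa [Function.update_of_ne hne] using hq)
    · rcases eq_or_ne x (C.start t + i) with rfl | hne
      · exact (slot_lt_tail C i).trans_le (tail_mono C ht)
      · exact ih.bag x (by simpa [Function.update_of_ne hne] using hx)
  · intro v t i k h _ _ h2
    exact ⟨goto_within ⟨hw _ _ h, h2⟩ ih.pc, ih.sample, ih.attempts, ih.bag⟩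
  · intro v t i k h _ _
    have ht : t.val ≤ st.mem.r := hw _ _ h
    exact ⟨goto_within (show PC.Within _ (.cas t _ _) from ht) ih.pc, ih.sample, ih.attempts,
      ih.bag⟩

/-- Every call that has been started is either running on exactly one processor or its element is
in exactly one slot of the bag. -/
structure State.Consistent (st : State C P s) : Prop where
  started_le : st.started ≤ s
  proc_lt : ∀ p v pc, st.proc p = some (v, pc) → v.val < st.started
  proc_inj : ∀ p q v pc pc', st.proc p = some (v, pc) → st.proc q = some (v, pc') → p = q
  bag_lt : ∀ x v, st.mem.bag x = some v → v.val < st.started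
  bag_proc : ∀ x v, st.mem.bag x = some v → ∀ p pc, st.proc p ≠ some (v, pc)
  bag_inj : ∀ x y v, st.mem.bag x = some v → st.mem.bag y = some v → x = y
  exists_of_lt : ∀ v : Fin s, v.val < st.started →
    (∃ p pc, st.proc p = some (v, pc)) ∨ ∃ x, st.mem.bag x = some v

/-- Every instruction other than starting a call and a successful CAS into a slot keeps the same
calls on the same processors and leaves the bag alone, so it cannot affect who owns which element.
-/
theorem State.Consistent.goto {st st' : State C P s} (ih : st.Consistent) {p : Fin P} {v : Fin s}
    {pc pc' : PC C} (h : st.proc p = some (v, pc)) (hs : st'.started = st.started)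
    (hb : st'.mem.bag = st.mem.bag) (hp : st'.proc = st.goto p v pc') : st'.Consistent := by
  have key : ∀ q w pc₁, st'.proc q = some (w, pc₁) → ∃ pc₂, st.proc q = some (w, pc₂) := by
    intro q w pc₁ hq
    rw [hp] at hq
    rcases eq_or_ne q p with rfl | hne
    · simp only [State.goto, Function.update_self, Option.some.injEq, Prod.mk.injEq] at hq
      exact ⟨pc, hq.1 ▸ h⟩
    · rw [State.goto, Function.update_of_ne hne] at hq
      exact ⟨_, hq⟩
  constructor
  · rw [hs]; exact ih.started_le
  · intro q w pc₁ hq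
    obtain ⟨pc₂, h2⟩ := key _ _ _ hq
    rw [hs]; exact ih.proc_lt _ _ _ h2
  · intro q q' w pc₁ pc₂ hq hq'
    obtain ⟨_, h2⟩ := key _ _ _ hq
    obtain ⟨_, h3⟩ := key _ _ _ hq'
    exact ih.proc_inj _ _ _ _ _ h2 h3
  · rw [hs, hb]; exact ih.bag_lt
  · intro x w hx q pc₁ hq
    obtain ⟨_, h2⟩ := key _ _ _ hq
    rw [hb] at hx
    exact ih.bag_proc _ _ hx _ _ h2
  · rw [hb]; exact ih.bag_inj
  · intro w hw
    rw [hs] at hw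
    rw [hb]
    refine (ih.exists_of_lt w hw).imp_left ?_
    rintro ⟨q, pc₁, hq⟩
    rcases eq_or_ne q p with rfl | hne
    · rw [h] at hq
      simp only [Option.some.injEq, Prod.mk.injEq] at hq
      exact ⟨q, pc', by rw [hp, State.goto, Function.update_self, hq.1]⟩
    · exact ⟨q, pc₁, by rw [hp, State.goto, Function.update_of_ne hne, hq]⟩

theorem consistent_run (ω : Tape C s) (l : List (Fin P)) : (run ω l).Consistent := by
  refine run_induction ?_ (fun st p ih => ?_) l
  · constructor <;> simp [State.init, Store.empty]
  refine step_cases ih ?_ ?_ ?_ ?_ ?_ ?_ ?_ ?_ ?_ ?_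
  · intro hp h
    have key : ∀ q w pc, st.goto p ⟨st.started, h⟩ .read q = some (w, pc) →
        (q = p ∧ w.val = st.started) ∨ (st.proc q = some (w, pc) ∧ w.val < st.started) := by
      intro q w pc hq
      rcases eq_or_ne q p with rfl | hne
      · simp only [State.goto, Function.update_self, Option.some.injEq, Prod.mk.injEq] at hq
        exact .inl ⟨rfl, by rw [← hq.1]⟩
      · rw [State.goto, Function.update_of_ne hne] at hq
        exact .inr ⟨hq, ih.proc_lt _ _ _ hq⟩
    constructor
    · exact h
    · intro q w pc hq
      rcases key q w pc hq with ⟨_, h1⟩ | ⟨_, h1⟩ <;> simp only <;> omega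
    · intro q q' w pc pc' hq hq'
      rcases key q w pc hq with ⟨h1, h2⟩ | ⟨h1, h2⟩ <;>
        rcases key q' w pc' hq' with ⟨h3, h4⟩ | ⟨h3, h4⟩
      · rw [h1, h3]
      · omega
      · omega
      · exact ih.proc_inj _ _ _ _ _ h1 h3
    · intro x v hx
      exact (ih.bag_lt x v hx).trans (Nat.lt_succ_self _)
    · intro x v hx q pc hq
      rcases key q v pc hq with ⟨_, h1⟩ | ⟨h1, _⟩
      · exact absurd (ih.bag_lt x v hx) (by omega)
      · exact ih.bag_proc _ _ hx _ _ h1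
    · exact ih.bag_inj
    · intro v hv
      rcases Nat.lt_succ_iff_lt_or_eq.1 hv with h1 | h1
      · refine (ih.exists_of_lt v h1).imp_left ?_
        rintro ⟨q, pc, hq⟩
        have hne : q ≠ p := by rintro rfl; rw [hp] at hq; cases hq
        exact ⟨q, pc, by simpa only [State.goto, Function.update_of_ne hne] using hq⟩
      · refine .inl ⟨p, .read, ?_⟩
        simp only [State.goto, Function.update_self, Option.some.injEq, Prod.mk.injEq, and_true]
        exact Fin.ext h1.symm
  · exact fun v h => ih.goto h rfl rfl rfl
  · exact fun v t h j _ _ => ih.goto h rfl rfl rfl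
  · exact fun v t h j _ _ => ih.goto h rfl rfl rfl
  · exact fun v t i h _ _ => ih.goto h rfl rfl rfl
  · exact fun v t i h _ => ih.goto h rfl rfl rfl
  · exact fun v t h => ih.goto h rfl rfl rfl
  -- Ownership of `v` passes from the processor to the slot. `bag_proc` guarantees that `v` was in
  -- no slot before, and `proc_inj` that no other processor runs it.
  · intro v t i k h hb
    have key : ∀ q w pc, Function.update st.proc p none q = some (w, pc) →
        q ≠ p ∧ st.proc q = some (w, pc) := by
      intro q w pc hq
      rcases eq_or_ne q p with rfl | hne
      · simp at hq
      · rw [Function.update_of_ne hne] at hq; exact ⟨hne, hq⟩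
    have kb : ∀ x w, Function.update st.mem.bag (C.start t + i) (some v) x = some w →
        (x = C.start t + i ∧ w = v) ∨ (st.mem.bag x = some w ∧ w ≠ v) := by
      intro x w hx
      rcases eq_or_ne x (C.start t + i) with rfl | hne
      · rw [Function.update_self] at hx
        exact .inl ⟨rfl, (Option.some.inj hx).symm⟩
      · rw [Function.update_of_ne hne] at hx
        exact .inr ⟨hx, by rintro rfl; exact ih.bag_proc _ _ hx _ _ h⟩
    constructor
    · exact ih.started_le
    · exact fun q w pc hq => ih.proc_lt _ _ _ (key _ _ _ hq).2
    · exact fun q q' w pc pc' hq hq' =>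
        ih.proc_inj _ _ _ _ _ (key _ _ _ hq).2 (key _ _ _ hq').2
    · intro x w hx
      rcases kb x w hx with ⟨_, rfl⟩ | ⟨h1, _⟩
      · exact ih.proc_lt _ _ _ h
      · exact ih.bag_lt _ _ h1
    · intro x w hx q pc hq
      obtain ⟨hne, hq'⟩ := key _ _ _ hq
      rcases kb x w hx with ⟨_, rfl⟩ | ⟨h1, _⟩
      · exact hne (ih.proc_inj _ _ _ _ _ hq' h)
      · exact ih.bag_proc _ _ h1 _ _ hq'
    · intro x y w hx hy
      rcases kb x w hx with ⟨h1, h2⟩ | ⟨h1, h2⟩ <;> rcases kb y w hy with ⟨h3, h4⟩ | ⟨h3, h4⟩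
      · rw [h1, h3]
      · exact absurd h2 h4
      · exact absurd h4 h2
      · exact ih.bag_inj _ _ _ h1 h3
    · intro w hw
      rcases eq_or_ne w v with rfl | hne
      · exact .inr ⟨_, Function.update_self _ _ _⟩
      · refine (ih.exists_of_lt w hw).imp ?_ ?_
        · rintro ⟨q, pc, hq⟩
          have hqp : q ≠ p := by
            rintro rfl
            rw [h] at hq
            simp only [Option.some.injEq, Prod.mk.injEq] at hq
            exact hne hq.1.symm
          exact ⟨q, pc, by simpa only [Function.update_of_ne hqp] using hq⟩
        · rintro ⟨x, hx⟩
          have hxne : x ≠ C.start t + i := by rintro rfl; rw [hb] at hx; cases hx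
          exact ⟨x, by simpa only [Function.update_of_ne hxne] using hx⟩
  · exact fun v t i k h _ _ _ => ih.goto h rfl rfl rfl
  · exact fun v t i k h _ _ => ih.goto h rfl rfl rfl

/-- When all insertions have returned, every element is in exactly one slot. -/
theorem contents_perm_of_complete (ω : Tape C s) (l : List (Fin P))
    (h : (run ω l).Complete) :
    ((List.range (C.tail (run ω l).mem.r)).filterMap (run ω l).mem.bag).Perm (List.finRange s) := by
  have hc := consistent_run ω l
  refine (List.perm_ext_iff_of_nodup ?_ (List.nodup_finRange s)).2 fun v => ?_
  · exact List.nodup_range.filterMap fun x y v hx hy => hc.bag_inj x y v hx hy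
  · simp only [List.mem_filterMap, List.mem_range, List.mem_finRange, iff_true]
    rcases hc.exists_of_lt v (h.1.symm ▸ v.isLt) with ⟨p, pc, hp⟩ | ⟨x, hx⟩
    · rw [h.2 p] at hp; cases hp
    · exact ⟨x, (confined_run ω l).bag x (by rw [hx]; simp), hx⟩

/-! ### Counting processors -/

theorem sum_update_add {ι γ : Type*} [Fintype ι] [DecidableEq ι] (g : ι → γ) (a : ι) (b : γ)
    (f : γ → ℕ) : ∑ i, f (Function.update g a b i) + f (g a) = ∑ i, f (g i) + f b := by
  rw [← Finset.add_sum_erase _ _ (Finset.mem_univ a),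
    ← Finset.add_sum_erase _ (fun i => f (g i)) (Finset.mem_univ a), Function.update_self,
    Finset.sum_congr rfl fun i hi => by
      rw [Function.update_of_ne (Finset.ne_of_mem_erase hi)]]
  ring

/-- The bookkeeping identity behind all counting invariants: only the term of `p` changes. It is
stated without subtraction so that `omega` can use it. -/
theorem sum_goto {st : State C P s} {p : Fin P} {o : Option (Fin s × PC C)} (h : st.proc p = o)
    (v : Fin s) (pc : PC C) (f : Option (Fin s × PC C) → ℕ) :
    ∑ q, f (st.goto p v pc q) + f o = ∑ q, f (st.proc q) + f (some (v, pc)) :=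
  h ▸ sum_update_add st.proc p _ f

theorem sum_return {st : State C P s} {p : Fin P} {o : Option (Fin s × PC C)} (h : st.proc p = o)
    (f : Option (Fin s × PC C) → ℕ) :
    ∑ q, f (Function.update st.proc p none q) + f o = ∑ q, f (st.proc q) + f none :=
  h ▸ sum_update_add st.proc p _ f

/-! ### Every call makes at most one attempt per chunk -/

/-- Whether a processor may still make an attempt in chunk `t` with its current call. -/
def mayAttempt (t r : ℕ) : Option (Fin s × PC C) → ℕ
  | none => 0
  | some (_, .read) => if r ≤ t then 1 else 0
  | some (_, .draw u) => if u.val ≤ t then 1 else 0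
  | some (_, .count u _) => if u.val < t then 1 else 0
  | some (_, .resize u) => if u.val < t then 1 else 0
  | some (_, .cas u _ _) => if u.val < t then 1 else 0

theorem mayAttempt_anti (t : ℕ) {r r' : ℕ} (h : r ≤ r') (o : Option (Fin s × PC C)) :
    mayAttempt t r' o ≤ mayAttempt t r o := by
  rcases o with _ | ⟨v, pc⟩
  · rfl
  · cases pc <;> simp only [mayAttempt] <;> split_ifs <;> omega

theorem mayAttempt_none (t r : ℕ) :
    mayAttempt t r (none : Option (Fin s × PC C)) = 0 := rfl

theorem mayAttempt_read (t r : ℕ) (v : Fin s) :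
    mayAttempt t r (some (v, (.read : PC C))) = if r ≤ t then 1 else 0 := rfl

theorem mayAttempt_draw (t r : ℕ) (v : Fin s) (u : C.Chunk) :
    mayAttempt t r (some (v, .draw u)) = if u.val ≤ t then 1 else 0 := rfl

theorem mayAttempt_count (t r : ℕ) (v : Fin s) (u : C.Chunk) (i) :
    mayAttempt t r (some (v, .count u i)) = if u.val < t then 1 else 0 := rfl

theorem mayAttempt_resize (t r : ℕ) (v : Fin s) (u : C.Chunk) :
    mayAttempt t r (some (v, .resize u)) = if u.val < t then 1 else 0 := rfl

theorem mayAttempt_cas (t r : ℕ) (v : Fin s) (u : C.Chunk) (i k) :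
    mayAttempt t r (some (v, .cas u i k)) = if u.val < t then 1 else 0 := rfl

/-- Each started call contributes at most 1 to the left side: before its draw in chunk `t` through
`mayAttempt`, afterwards through `attempts t`. -/
theorem attempts_add_le_started (ω : Tape C s) (l : List (Fin P)) (t : C.Chunk) :
    (run ω l).attempts t + ∑ q, mayAttempt t (run ω l).mem.r ((run ω l).proc q)
      ≤ (run ω l).started := by
  induction l using List.reverseRecOn with
  | nil => simp [run_nil, State.init, mayAttempt]
  | append_singleton l p ih =>
    rw [run_snoc]
    have hconf := (confined_run ω l).pc p
    revert ih hconf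
    generalize run ω l = st
    intro ih hconf
    refine step_cases (motive := fun st' : State C P s =>
      st'.attempts t + ∑ q, mayAttempt t st'.mem.r (st'.proc q) ≤ st'.started) ih ?_ ?_ ?_ ?_ ?_ ?_ ?_ ?_ ?_ ?_
    · intro hp h
      have := sum_goto hp ⟨st.started, h⟩ .read (mayAttempt t st.mem.r)
      simp only [mayAttempt_none, mayAttempt_read, mayAttempt_draw, mayAttempt_count,
        mayAttempt_resize, mayAttempt_cas] at this ⊢
      split_ifs at this <;> omega
    · intro v hp
      have := sum_goto hp v (.draw st.mem.r) (mayAttempt t st.mem.r)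
      simp only [mayAttempt_none, mayAttempt_read, mayAttempt_draw, mayAttempt_count,
        mayAttempt_resize, mayAttempt_cas] at this ⊢
      omega
    · intro v u hp j _ _
      have := sum_goto hp v (.count u (ω u j).2) (mayAttempt t st.mem.r)
      rcases eq_or_ne t u with rfl | hne
      · simp only [mayAttempt_none, mayAttempt_read, mayAttempt_draw, mayAttempt_count,
        mayAttempt_resize, mayAttempt_cas, Function.update_self, le_refl, lt_irrefl, if_true, if_false] at this ⊢
        omega
      · have hv : t.val ≠ u.val := fun h => hne (Fin.ext h)
        simp only [mayAttempt_none, mayAttempt_read, mayAttempt_draw, mayAttempt_count,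
        mayAttempt_resize, mayAttempt_cas, Function.update_of_ne hne] at this ⊢
        split_ifs at this <;> omega
    · intro v u hp j _ _
      have := sum_goto hp v (.cas u (ω u j).2 0) (mayAttempt t st.mem.r)
      rcases eq_or_ne t u with rfl | hne
      · simp only [mayAttempt_none, mayAttempt_read, mayAttempt_draw, mayAttempt_count,
        mayAttempt_resize, mayAttempt_cas, Function.update_self, le_refl, lt_irrefl, if_true, if_false] at this ⊢
        omega
      · have hv : t.val ≠ u.val := fun h => hne (Fin.ext h)
        simp only [mayAttempt_none, mayAttempt_read, mayAttempt_draw, mayAttempt_count,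
        mayAttempt_resize, mayAttempt_cas, Function.update_of_ne hne] at this ⊢
        split_ifs at this <;> omega
    · intro v u i hp _ _
      have := sum_goto hp v (.resize u) (mayAttempt t st.mem.r)
      simp only [mayAttempt_none, mayAttempt_read, mayAttempt_draw, mayAttempt_count,
        mayAttempt_resize, mayAttempt_cas] at this ⊢
      omega
    · intro v u i hp _
      have := sum_goto hp v (.cas u i 0) (mayAttempt t st.mem.r)
      simp only [mayAttempt_none, mayAttempt_read, mayAttempt_draw, mayAttempt_count,
        mayAttempt_resize, mayAttempt_cas] at this ⊢
      omega
    -- After giving up `u` the new `r` exceeds `u`, so the call may still draw in `t` only if `u <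
    -- t`, in which case it was counted before.
    · intro v u hp
      have hu : u.val ≤ st.mem.r ∧ u.val < C.last := hconf _ _ hp
      have := sum_goto hp v .read (mayAttempt t (st.mem.bumped u))
      have hle : ∑ q, mayAttempt t (st.mem.bumped u) (st.proc q)
          ≤ ∑ q, mayAttempt t st.mem.r (st.proc q) :=
        Finset.sum_le_sum fun q _ => mayAttempt_anti _ (le_bumped _ _) _
      have hlt := lt_bumped st.mem u hu.1 hu.2
      simp only [mayAttempt_none, mayAttempt_read, mayAttempt_draw, mayAttempt_count,
        mayAttempt_resize, mayAttempt_cas] at this ⊢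
      split_ifs at this <;> omega
    · intro v u i k hp _
      have := sum_return hp (mayAttempt t st.mem.r)
      simp only [mayAttempt_none, mayAttempt_read, mayAttempt_draw, mayAttempt_count,
        mayAttempt_resize, mayAttempt_cas] at this ⊢
      omega
    · intro v u i k hp _ _ _
      have := sum_goto hp v (.resize u) (mayAttempt t st.mem.r)
      simp only [mayAttempt_none, mayAttempt_read, mayAttempt_draw, mayAttempt_count,
        mayAttempt_resize, mayAttempt_cas] at this ⊢
      omega
    · intro v u i k hp _ _
      have := sum_goto hp v (.cas u (nextSlot i) (k + 1)) (mayAttempt t st.mem.r)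
      simp only [mayAttempt_none, mayAttempt_read, mayAttempt_draw, mayAttempt_count,
        mayAttempt_resize, mayAttempt_cas] at this ⊢
      omega

theorem attempts_le (ω : Tape C s) (l : List (Fin P)) (t : C.Chunk) :
    (run ω l).attempts t ≤ s := by
  have h1 := attempts_add_le_started ω l t
  have h2 := (consistent_run ω l).started_le
  omega

/-- This makes the reduction modulo `s` in `exec` harmless: the next attempt reads the tape entry
whose index is the number of attempts so far. -/
theorem attempts_lt_of_draw (ω : Tape C s) (l : List (Fin P)) {t : C.Chunk} {p : Fin P}
    {v : Fin s} (h : (run ω l).proc p = some (v, .draw t)) : (run ω l).attempts t < s := by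
  have h1 := attempts_add_le_started ω l t
  have h2 := (consistent_run ω l).started_le
  have h3 := Finset.single_le_sum
    (f := fun q => mayAttempt t (run ω l).mem.r ((run ω l).proc q))
    (fun q _ => Nat.zero_le _) (Finset.mem_univ p)
  have h4 : mayAttempt t (run ω l).mem.r ((run ω l).proc p) = 1 := by
    simp only [h, mayAttempt_draw, le_refl, if_true]
  simp only [h4] at h3
  omega

/-! ### Attempts and the tape -/

/-- The number of the first `a` attempts in chunk `t` whose random choices belong to `B`. -/
def hits (ω : Tape C s) (t : C.Chunk) (B : Finset (Bool × Fin (C.size t))) (a : ℕ) : ℕ :=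
  (Finset.univ.filter fun j : Fin s => j.val < a ∧ ω t j ∈ B).card

theorem hits_mono (ω : Tape C s) (t : C.Chunk) (B : Finset (Bool × Fin (C.size t))) {a b : ℕ}
    (h : a ≤ b) : hits ω t B a ≤ hits ω t B b :=
  Finset.card_le_card fun j hj => by
    simp only [Finset.mem_filter] at hj ⊢
    exact ⟨hj.1, hj.2.1.trans_le h, hj.2.2⟩

theorem hits_succ (ω : Tape C s) (t : C.Chunk) (B : Finset (Bool × Fin (C.size t))) {a : ℕ}
    {j : Fin s} (hj : j.val = a) :
    hits ω t B (a + 1) = hits ω t B a + if ω t j ∈ B then 1 else 0 := by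
  have h : (Finset.univ.filter fun i : Fin s => i.val < a + 1 ∧ ω t i ∈ B)
      = (Finset.univ.filter fun i : Fin s => i.val < a ∧ ω t i ∈ B)
        ∪ (if ω t j ∈ B then {j} else ∅) := by
    ext i
    have hij : i = j ↔ i.val = a := ⟨fun h => h ▸ hj, fun h => Fin.ext (h.trans hj.symm)⟩
    have hi : i.val = a → ω t i = ω t j := fun h => congrArg _ (hij.2 h)
    split_ifs with hB <;>
      simp only [Finset.mem_union, Finset.mem_filter, Finset.mem_univ, true_and,
        Finset.mem_singleton, Finset.notMem_empty, or_false, hij]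
    · constructor
      · rintro ⟨h1, h2⟩
        exact (Nat.lt_succ_iff_lt_or_eq.1 h1).imp_left fun h => ⟨h, h2⟩
      · rintro (⟨h1, h2⟩ | h1)
        · exact ⟨h1.trans (Nat.lt_succ_self a), h2⟩
        · exact ⟨h1 ▸ Nat.lt_succ_self _, (hi h1).symm ▸ hB⟩
    · constructor
      · rintro ⟨h1, h2⟩
        rcases Nat.lt_succ_iff_lt_or_eq.1 h1 with h | h
        · exact ⟨h, h2⟩
        · exact absurd (hi h ▸ h2) hB
      · rintro ⟨h1, h2⟩
        exact ⟨h1.trans (Nat.lt_succ_self a), h2⟩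
  unfold hits
  rw [h, Finset.card_union_of_disjoint]
  · split_ifs <;> simp
  · split_ifs
    · simp [hj]
    · simp

theorem hits_le (ω : Tape C s) (t : C.Chunk) (B : Finset (Bool × Fin (C.size t))) (a : ℕ) :
    hits ω t B a ≤ a := by
  induction a with
  | zero => simp [hits]
  | succ a ih =>
    by_cases h : a < s
    · rw [hits_succ ω t B (a := a) (j := ⟨a, h⟩) rfl]
      split_ifs <;> omega
    · refine le_trans (le_of_eq ?_) (ih.trans (Nat.le_succ a))
      unfold hits
      congr 1
      refine Finset.filter_congr fun j _ => ?_
      have := j.isLt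
      constructor <;> rintro ⟨h1, h2⟩ <;> exact ⟨by omega, h2⟩

/-- The random choices in which the attempt is sampled. -/
def sampled (C : Config) (t : ℕ) : Finset (Bool × Fin (C.size t)) :=
  Finset.univ.filter fun x => x.1 = true

/-- The random choices in which the slot belongs to `I`. -/
def hashedTo {C : Config} {t : ℕ} (I : Finset (Fin (C.size t))) :
    Finset (Bool × Fin (C.size t)) :=
  Finset.univ.filter fun x => x.2 ∈ I

/-- Whether a processor is about to increment `sample[t]`. -/
def atCount (t : C.Chunk) : Option (Fin s × PC C) → ℕ
  | some (_, .count u _) => if u = t then 1 else 0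
  | _ => 0

theorem atCount_none (t : C.Chunk) :
    atCount t (none : Option (Fin s × PC C)) = 0 := rfl

theorem atCount_read (t : C.Chunk) (v : Fin s) :
    atCount t (some (v, (.read : PC C))) = 0 := rfl

theorem atCount_draw (t : C.Chunk) (v : Fin s) (u : C.Chunk) :
    atCount t (some (v, .draw u)) = 0 := rfl

theorem atCount_count (t : C.Chunk) (v : Fin s) (u : C.Chunk) (i) :
    atCount t (some (v, .count u i)) = if u = t then 1 else 0 := rfl

theorem atCount_resize (t : C.Chunk) (v : Fin s) (u : C.Chunk) :
    atCount t (some (v, .resize u)) = 0 := rfl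

theorem atCount_cas (t : C.Chunk) (v : Fin s) (u : C.Chunk) (i k) :
    atCount t (some (v, .cas u i k)) = 0 := rfl

/-- Conservation of samples: an attempt sampled by the tape is either already recorded in the
counter or held by a processor about to increment it. -/
theorem sample_add (ω : Tape C s) (l : List (Fin P)) (t : C.Chunk) :
    (run ω l).mem.sample t + ∑ q, atCount t ((run ω l).proc q)
      = hits ω t (sampled C t) ((run ω l).attempts t) := by
  induction l using List.reverseRecOn with
  | nil => simp [run_nil, State.init, atCount, Store.empty, hits]
  | append_singleton l p ih =>
    rw [run_snoc]
    have hdraw : ∀ v u, (run ω l).proc p = some (v, .draw u) → (run ω l).attempts u < s :=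
      fun v u => attempts_lt_of_draw ω l
    revert ih hdraw
    generalize run ω l = st
    intro ih hdraw
    refine step_cases (motive := fun st' : State C P s =>
      st'.mem.sample t + ∑ q, atCount t (st'.proc q) = hits ω t (sampled C t) (st'.attempts t))
      ih ?_ ?_ ?_ ?_ ?_ ?_ ?_ ?_ ?_ ?_
    · intro hp h
      have := sum_goto hp ⟨st.started, h⟩ .read (atCount t)
      simp only [atCount_none, atCount_read, atCount_draw, atCount_count,
        atCount_resize, atCount_cas] at this ⊢
      omega
    · intro v hp
      have := sum_goto hp v (.draw st.mem.r) (atCount t)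
      simp only [atCount_none, atCount_read, atCount_draw, atCount_count,
        atCount_resize, atCount_cas] at this ⊢
      omega
    · intro v u hp j hj hs
      rw [Nat.mod_eq_of_lt (hdraw v u hp)] at hj
      have := sum_goto hp v (.count u (ω u j).2) (atCount t)
      rcases eq_or_ne t u with rfl | hne
      · simp only [Function.update_self, hits_succ ω t _ hj, sampled, Finset.mem_filter,
          Finset.mem_univ, hs, true_and, if_true]
        simp only [atCount_none, atCount_read, atCount_draw, atCount_count,
        atCount_resize, atCount_cas, if_true, sampled] at this ih ⊢
        omega
      · simp only [atCount_none, atCount_read, atCount_draw, atCount_count,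
        atCount_resize, atCount_cas, Function.update_of_ne hne, if_neg hne.symm] at this ⊢
        omega
    · intro v u hp j hj hs
      rw [Nat.mod_eq_of_lt (hdraw v u hp)] at hj
      have := sum_goto hp v (.cas u (ω u j).2 0) (atCount t)
      rcases eq_or_ne t u with rfl | hne
      · simp only [Function.update_self, hits_succ ω t _ hj, sampled, Finset.mem_filter,
          Finset.mem_univ, hs, true_and, Bool.false_eq_true, if_false]
        simp only [atCount_none, atCount_read, atCount_draw, atCount_count,
        atCount_resize, atCount_cas, sampled] at this ih ⊢
        omega
      · simp only [atCount_none, atCount_read, atCount_draw, atCount_count,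
        atCount_resize, atCount_cas, Function.update_of_ne hne] at this ⊢
        omega
    · intro v u i hp _ _
      have := sum_goto hp v (.resize u) (atCount t)
      rcases eq_or_ne t u with rfl | hne
      · simp only [atCount_none, atCount_read, atCount_draw, atCount_count,
        atCount_resize, atCount_cas, Function.update_self, if_true] at this ⊢
        omega
      · simp only [atCount_none, atCount_read, atCount_draw, atCount_count,
        atCount_resize, atCount_cas, Function.update_of_ne hne, if_neg hne.symm] at this ⊢
        omega
    · intro v u i hp _
      have := sum_goto hp v (.cas u i 0) (atCount t)
      rcases eq_or_ne t u with rfl | hne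
      · simp only [atCount_none, atCount_read, atCount_draw, atCount_count,
        atCount_resize, atCount_cas, Function.update_self, if_true] at this ⊢
        omega
      · simp only [atCount_none, atCount_read, atCount_draw, atCount_count,
        atCount_resize, atCount_cas, Function.update_of_ne hne, if_neg hne.symm] at this ⊢
        omega
    · intro v u hp
      have := sum_goto hp v .read (atCount t)
      simp only [atCount_none, atCount_read, atCount_draw, atCount_count,
        atCount_resize, atCount_cas] at this ⊢
      omega
    · intro v u i k hp _
      have := sum_return hp (atCount t)
      simp only [atCount_none, atCount_read, atCount_draw, atCount_count,
        atCount_resize, atCount_cas] at this ⊢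
      omega
    · intro v u i k hp _ _ _
      have := sum_goto hp v (.resize u) (atCount t)
      simp only [atCount_none, atCount_read, atCount_draw, atCount_count,
        atCount_resize, atCount_cas] at this ⊢
      omega
    · intro v u i k hp _ _
      have := sum_goto hp v (.cas u (nextSlot i) (k + 1)) (atCount t)
      simp only [atCount_none, atCount_read, atCount_draw, atCount_count,
        atCount_resize, atCount_cas] at this ⊢
      omega

/-! ### When a chunk is given up -/

/-- Some processor is about to give up chunk `t`. -/
def State.Resizing (st : State C P s) (t : C.Chunk) : Prop :=
  ∃ p v, st.proc p = some (v, .resize t)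

theorem State.Resizing.of_update {st : State C P s} {p : Fin P} {o : Option (Fin s × PC C)}
    {t : C.Chunk} (hp : ∀ v, st.proc p ≠ some (v, .resize t)) (h : st.Resizing t) :
    ∃ q v, Function.update st.proc p o q = some (v, .resize t) := by
  obtain ⟨q, v, hq⟩ := h
  have hne : q ≠ p := by rintro rfl; exact hp v hq
  exact ⟨q, v, by rw [Function.update_of_ne hne, hq]⟩

/-- The increment that brings the counter to `sigma` sends its processor to the CAS on `r`, and that
processor stays there until it executes it, which moves `r` beyond `t`. -/
theorem lt_or_resizing (ω : Tape C s) (l : List (Fin P)) (hσ : 0 < C.sigma) (t : C.Chunk)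
    (ht : t.val < C.last) (h : C.sigma ≤ (run ω l).mem.sample t) :
    t.val < (run ω l).mem.r ∨ (run ω l).Resizing t := by
  induction l using List.reverseRecOn with
  | nil => simp [run_nil, State.init, Store.empty] at h; omega
  | append_singleton l p ih =>
    rw [run_snoc] at h ⊢
    have hconf := (confined_run ω l).pc p
    generalize run ω l = st at ih hconf h ⊢
    revert h
    refine step_cases (motive := fun st' : State C P s => C.sigma ≤ st'.mem.sample t →
      t.val < st'.mem.r ∨ st'.Resizing t) ih ?_ ?_ ?_ ?_ ?_ ?_ ?_ ?_ ?_ ?_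
    · intro hp _ h
      exact (ih h).imp_right (State.Resizing.of_update (by simp [hp]))
    · intro v hp h
      exact (ih h).imp_right (State.Resizing.of_update (by simp [hp]))
    · intro v u hp j _ _ h
      exact (ih h).imp_right (State.Resizing.of_update (by simp [hp]))
    · intro v u hp j _ _ h
      exact (ih h).imp_right (State.Resizing.of_update (by simp [hp]))
    · intro v u i hp _ _ h
      rcases eq_or_ne t u with rfl | hne
      · exact .inr ⟨p, v, Function.update_self _ _ _⟩
      · simp only [Function.update_of_ne hne] at h
        exact (ih h).imp_right (State.Resizing.of_update (by simp [hp]))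
    · intro v u i hp hn h
      rcases eq_or_ne t u with rfl | hne
      · simp only [Function.update_self] at h
        exact absurd ⟨h, ht⟩ hn
      · simp only [Function.update_of_ne hne] at h
        exact (ih h).imp_right (State.Resizing.of_update (by simp [hp]))
    · intro v u hp h
      have hu : u.val ≤ st.mem.r ∧ u.val < C.last := hconf _ _ hp
      rcases eq_or_ne t u with rfl | hne
      · exact .inl (lt_bumped _ _ hu.1 hu.2)
      · exact (ih h).imp (fun h => h.trans_le (le_bumped _ _))
          (State.Resizing.of_update (by simp [hp, hne.symm]))
    · intro v u i k hp _ h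
      exact (ih h).imp_right (State.Resizing.of_update (by simp [hp]))
    · intro v u i k hp _ _ _ h
      exact (ih h).imp_right (State.Resizing.of_update (by simp [hp]))
    · intro v u i k hp _ _ h
      exact (ih h).imp_right (State.Resizing.of_update (by simp [hp]))

/-- If no call ever exceeds the limit on the number of probes, then only chunks with at least
`sigma` samples are given up. -/
theorem sigma_le_sample (ω : Tape C s) (l : List (Fin P))
    (hprobe : ∀ l', l' <+: l → ∀ p v t i k, (run ω l').proc p = some (v, .cas t i k) →
      (run ω l').mem.bag (C.start t + i) ≠ none → k < C.kappa) (t : C.Chunk)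
    (h : t.val < (run ω l).mem.r ∨ (run ω l).Resizing t) :
    C.sigma ≤ (run ω l).mem.sample t := by
  induction l using List.reverseRecOn with
  | nil => simp [run_nil, State.init, Store.empty, State.Resizing] at h
  | append_singleton l p ih =>
    rw [run_snoc] at h ⊢
    have ih := ih fun l' hl' => hprobe l' (hl'.trans (List.prefix_append _ _))
    have hprobe := hprobe l (List.prefix_append _ _) p
    have back : ∀ v pc, pc ≠ PC.resize t →
        (∃ q w, (run ω l).goto p v pc q = some (w, .resize t)) → (run ω l).Resizing t := by
      rintro v pc hpc ⟨q, w, hq⟩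
      rcases eq_or_ne q p with rfl | hne
      · simp [State.goto, hpc] at hq
      · exact ⟨q, w, by simpa [State.goto, Function.update_of_ne hne] using hq⟩
    generalize run ω l = st at ih hprobe back h ⊢
    revert h
    refine step_cases (motive := fun st' : State C P s => (t.val < st'.mem.r ∨ st'.Resizing t) →
      C.sigma ≤ st'.mem.sample t) ih ?_ ?_ ?_ ?_ ?_ ?_ ?_ ?_ ?_ ?_
    · intro hp _ h
      exact ih (h.imp_right (back _ _ (by simp)))
    · intro v hp h
      exact ih (h.imp_right (back _ _ (by simp)))
    · intro v u hp j _ _ h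
      exact ih (h.imp_right (back _ _ (by simp)))
    · intro v u hp j _ _ h
      exact ih (h.imp_right (back _ _ (by simp)))
    · intro v u i hp hσ _ h
      rcases eq_or_ne t u with rfl | hne
      · simpa using hσ
      · simp only [Function.update_of_ne hne]
        exact ih (h.imp_right (back _ _ (by simp [hne.symm])))
    · intro v u i hp hn h
      have := ih (h.imp_right (back _ _ (by simp)))
      rcases eq_or_ne t u with rfl | hne
      · simp only [Function.update_self]; omega
      · simpa only [Function.update_of_ne hne] using this
    · intro v u hp h
      rcases eq_or_ne t u with rfl | hne
      · exact ih (.inr ⟨p, v, hp⟩)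
      · refine ih (h.imp (fun h => ?_) (back _ _ (by simp)))
        have hv : t.val ≠ u.val := fun h => hne (Fin.ext h)
        simp only [Store.bumped, nextChunk] at h
        split_ifs at h with h1 h2
        · simp only at h; rw [h1]; omega
        · rwa [h1]
        · exact h
    · intro v u i k hp _ h
      refine ih (h.imp_right ?_)
      rintro ⟨q, w, hq⟩
      rcases eq_or_ne q p with rfl | hne
      · simp at hq
      · exact ⟨q, w, by simpa [Function.update_of_ne hne] using hq⟩
    -- Quitting at a full slot requires `kappa ≤ k`, which `hprobe` rules out; so only the counter
    -- can trigger a resize.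
    · intro v u i k hp hb hk _ _
      have := hprobe _ _ _ _ hp hb
      omega
    · intro v u i k hp _ _ h
      exact ih (h.imp_right (back _ _ (by simp)))

/-! ### The number of instructions of a call -/

/-- A bound on the number of instructions that a call has executed when it is about to execute
`pc`, if it fails at most `b` times to write its element into a slot of the same chunk. -/
def PC.cost (b r : ℕ) : PC C → ℕ
  | .read => 1 + r * (b + 5)
  | .draw t => 2 + t * (b + 5)
  | .count t _ => 3 + t * (b + 5)
  | .cas t _ k => 4 + k + t * (b + 5)
  | .resize t => 5 + b + t * (b + 5)

theorem PC.cost_mono (b : ℕ) {r r' : ℕ} (h : r ≤ r') (pc : PC C) : pc.cost b r ≤ pc.cost b r' := by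
  cases pc <;> simp only [PC.cost, le_refl]
  exact Nat.add_le_add_left (Nat.mul_le_mul_right _ h) _

/-- Giving up a chunk costs at most `b + 5` instructions: read, draw, count, `b + 1` failing CAS,
resize. The next read then finds a strictly larger `r`, so the chunks passed are charged to distinct
indices up to `r`. -/
theorem instrs_le (ω : Tape C s) (l : List (Fin P)) (b : ℕ)
    (hb : ∀ l', l' <+: l → ∀ p v t i k, (run ω l').proc p = some (v, .cas t i k) → k ≤ b) :
    (∀ p v pc, (run ω l).proc p = some (v, pc) →
      (run ω l).instrs v ≤ pc.cost b (run ω l).mem.r) ∧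
    ∀ v, (run ω l).instrs v ≤ 1 + ((run ω l).mem.r + 1) * (b + 5) := by
  induction l using List.reverseRecOn with
  | nil => simp [run_nil, State.init]
  | append_singleton l p ih =>
    have ih := ih fun l' hl' => hb l' (hl'.trans (List.prefix_append _ _))
    have hk := hb l (List.prefix_append _ _) p
    have hconf := (confined_run ω l).pc p
    have hinj := (consistent_run ω l).proc_inj
    have hlt := (consistent_run ω l).proc_lt
    rw [run_snoc]
    revert ih hk hconf hinj hlt
    generalize run ω l = st
    rintro ⟨ih1, ih2⟩ hk hconf hinj hlt
    have key : ∀ v pc pc', st.proc p = some (v, pc) → ∀ r' : ℕ, st.mem.r ≤ r' →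
        st.instrs v + 1 ≤ pc'.cost b r' → st.instrs v + 1 ≤ 1 + (r' + 1) * (b + 5) →
        (∀ q w pc₁, st.goto p v pc' q = some (w, pc₁) → st.tick v w ≤ pc₁.cost b r') ∧
        ∀ w, st.tick v w ≤ 1 + (r' + 1) * (b + 5) := by
      intro v pc pc' hp r' hr hc hc'
      constructor
      · intro q w pc₁ hq
        rcases eq_or_ne q p with rfl | hne
        · simp only [State.goto, Function.update_self, Option.some.injEq, Prod.mk.injEq] at hq
          rw [← hq.1, ← hq.2, State.tick, Function.update_self]
          exact hc
        · rw [State.goto, Function.update_of_ne hne] at hq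
          have hwv : w ≠ v := by rintro rfl; exact hne (hinj _ _ _ _ _ hq hp)
          rw [State.tick, Function.update_of_ne hwv]
          exact (ih1 _ _ _ hq).trans (PC.cost_mono b hr pc₁)
      · intro w
        rcases eq_or_ne w v with rfl | hwv
        · rwa [State.tick, Function.update_self]
        · rw [State.tick, Function.update_of_ne hwv]
          exact (ih2 w).trans (Nat.add_le_add_left
            (Nat.mul_le_mul_right _ (Nat.add_le_add_right hr 1)) _)
    have hmul : ∀ t : ℕ, t ≤ st.mem.r → (t + 1) * (b + 5) ≤ (st.mem.r + 1) * (b + 5) :=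
      fun t ht => Nat.mul_le_mul_right _ (Nat.succ_le_succ ht)
    simp only [add_one_mul] at hmul
    refine step_cases (motive := fun st' : State C P s =>
      (∀ p v pc, st'.proc p = some (v, pc) → st'.instrs v ≤ pc.cost b st'.mem.r) ∧
      ∀ v, st'.instrs v ≤ 1 + (st'.mem.r + 1) * (b + 5)) ⟨ih1, ih2⟩ ?_ ?_ ?_ ?_ ?_ ?_ ?_ ?_ ?_ ?_
    · intro hp h
      constructor
      · intro q w pc₁ hq
        rcases eq_or_ne q p with rfl | hne
        · simp only [State.goto, Function.update_self, Option.some.injEq, Prod.mk.injEq] at hq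
          rw [← hq.1, ← hq.2]
          simp only [Function.update_self, PC.cost]
          omega
        · simp only [State.goto, Function.update_of_ne hne] at hq
          have hwv : w ≠ ⟨st.started, h⟩ := by
            rintro rfl; exact lt_irrefl _ (hlt _ _ _ hq)
          simp only [Function.update_of_ne hwv]
          exact ih1 _ _ _ hq
      · intro w
        rcases eq_or_ne w ⟨st.started, h⟩ with rfl | hwv
        · simp
        · simp only [Function.update_of_ne hwv]
          exact ih2 w
    · intro v hp
      have h1 := ih1 _ _ _ hp
      simp only [PC.cost] at h1
      refine key v _ _ hp _ le_rfl ?_ ?_ <;> simp only [PC.cost, add_one_mul] <;> omega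
    · intro v t hp j _ _
      have h1 := ih1 _ _ _ hp
      have h2 := hmul t (hconf _ _ hp)
      simp only [PC.cost] at h1
      refine key v _ _ hp _ le_rfl ?_ ?_ <;> simp only [PC.cost, add_one_mul] <;> omega
    · intro v t hp j _ _
      have h1 := ih1 _ _ _ hp
      have h2 := hmul t (hconf _ _ hp)
      simp only [PC.cost] at h1
      refine key v _ _ hp _ le_rfl ?_ ?_ <;> simp only [PC.cost, add_one_mul] <;> omega
    · intro v t i hp _ _
      have h1 := ih1 _ _ _ hp
      have h2 := hmul t (hconf _ _ hp)
      simp only [PC.cost] at h1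
      refine key v _ _ hp _ le_rfl ?_ ?_ <;> simp only [PC.cost, add_one_mul] <;> omega
    · intro v t i hp _
      have h1 := ih1 _ _ _ hp
      have h2 := hmul t (hconf _ _ hp)
      simp only [PC.cost] at h1
      refine key v _ _ hp _ le_rfl ?_ ?_ <;> simp only [PC.cost, add_one_mul] <;> omega
    · intro v t hp
      have h1 := ih1 _ _ _ hp
      have h2 : t.val ≤ st.mem.r ∧ t.val < C.last := hconf _ _ hp
      have h3 := le_bumped st.mem t
      have h4 := Nat.mul_le_mul_right (b + 5) (Nat.succ_le_of_lt (lt_bumped st.mem t h2.1 h2.2))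
      rw [Nat.succ_eq_add_one, add_one_mul] at h4
      simp only [PC.cost] at h1
      refine key v _ _ hp _ h3 ?_ ?_ <;> simp only [PC.cost, add_one_mul] <;> omega
    · intro v t i k hp _
      have h1 := ih1 _ _ _ hp
      have h2 := hmul t (hconf _ _ hp)
      have h3 := hk _ _ _ _ hp
      simp only [PC.cost] at h1
      have := key v _ (.resize t) hp _ le_rfl (by simp only [PC.cost]; omega)
        (by rw [add_one_mul]; omega)
      refine ⟨fun q w pc₁ hq => this.1 q w pc₁ ?_, this.2⟩
      rcases eq_or_ne q p with rfl | hne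
      · simp at hq
      · simpa [State.goto, Function.update_of_ne hne] using hq
    · intro v t i k hp _ _ _
      have h1 := ih1 _ _ _ hp
      have h2 := hmul t (hconf _ _ hp)
      have h3 := hk _ _ _ _ hp
      simp only [PC.cost] at h1
      refine key v _ _ hp _ le_rfl ?_ ?_ <;> simp only [PC.cost, add_one_mul] <;> omega
    · intro v t i k hp _ _
      have h1 := ih1 _ _ _ hp
      have h2 := hmul t (hconf _ _ hp)
      have h3 := hk _ _ _ _ hp
      simp only [PC.cost] at h1
      refine key v _ _ hp _ le_rfl ?_ ?_ <;> simp only [PC.cost, add_one_mul] <;> omega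

/-! ### Cyclic runs of slots -/

/-- The cyclically previous slot of a chunk. -/
def prevSlot {k : ℕ} (i : Fin k) : Fin k :=
  ⟨(i.val + (k - 1)) % k, Nat.mod_lt _ (Nat.lt_of_le_of_lt (Nat.zero_le _) i.isLt)⟩

theorem nextSlot_prevSlot {k : ℕ} (i : Fin k) : nextSlot (prevSlot i) = i := by
  have := i.isLt
  refine Fin.ext ?_
  simp only [nextSlot, prevSlot, Nat.mod_add_mod]
  rw [show i.val + (k - 1) + 1 = i.val + k by omega, Nat.add_mod_right, Nat.mod_eq_of_lt this]

theorem prevSlot_nextSlot {k : ℕ} (i : Fin k) : prevSlot (nextSlot i) = i := by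
  have := i.isLt
  refine Fin.ext ?_
  simp only [nextSlot, prevSlot, Nat.mod_add_mod]
  rw [show i.val + 1 + (k - 1) = i.val + k by omega, Nat.add_mod_right, Nat.mod_eq_of_lt this]

theorem nextSlot_iterate_val {k : ℕ} (i : Fin k) (j : ℕ) :
    (nextSlot^[j] i).val = (i.val + j) % k := by
  induction j with
  | zero => simp [Nat.mod_eq_of_lt i.isLt]
  | succ j ih =>
    rw [Function.iterate_succ_apply', nextSlot]
    simp only [ih, Nat.mod_add_mod, Nat.add_assoc]

theorem prevSlot_iterate_nextSlot {k : ℕ} (i : Fin k) (j : ℕ) :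
    prevSlot^[j + 1] (nextSlot i) = prevSlot^[j] i := by
  rw [Function.iterate_succ_apply, prevSlot_nextSlot]

theorem nextSlot_iterate_prevSlot {k : ℕ} (i : Fin k) (j : ℕ) :
    nextSlot^[j] (prevSlot^[j] i) = i :=
  Function.LeftInverse.iterate nextSlot_prevSlot j i

theorem prevSlot_injective {k : ℕ} : Function.Injective (prevSlot : Fin k → Fin k) :=
  Function.LeftInverse.injective nextSlot_prevSlot

theorem prevSlot_iterate_ne {k : ℕ} (i : Fin k) {j : ℕ} (h0 : 0 < j) (hj : j < k) :
    prevSlot^[j] i ≠ i := by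
  intro h
  have h1 := nextSlot_iterate_prevSlot i j
  rw [h] at h1
  have h2 := congrArg Fin.val h1
  rw [nextSlot_iterate_val] at h2
  have := i.isLt
  rcases Nat.lt_or_ge (i.val + j) k with h3 | h3
  · rw [Nat.mod_eq_of_lt h3] at h2; omega
  · rw [Nat.mod_eq_sub_mod h3, Nat.mod_eq_of_lt (by omega)] at h2; omega

theorem prevSlot_iterate_injOn {k : ℕ} (x : Fin k) :
    Set.InjOn (fun j => prevSlot^[j] x) (Finset.range k : Finset ℕ) := by
  have key : ∀ a b : ℕ, a < b → b < k → prevSlot^[a] x ≠ prevSlot^[b] x := by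
    intro a b hab hb h
    obtain ⟨d, rfl⟩ := Nat.exists_eq_add_of_lt hab
    rw [show a + d + 1 = a + (d + 1) by ring, Function.iterate_add_apply] at h
    exact prevSlot_iterate_ne x (Nat.succ_pos d) (by omega)
      (prevSlot_injective.iterate a h).symm
  intro a ha b hb h
  simp only [Finset.coe_range, Set.mem_Iio] at ha hb
  rcases lt_trichotomy a b with h1 | h1 | h1
  · exact absurd h (key _ _ h1 hb)
  · exact h1
  · exact absurd h.symm (key _ _ h1 ha)

/-- The `len` cyclically consecutive slots that end with slot `x`. -/
def slotRun {k : ℕ} (x : Fin k) (len : ℕ) : Finset (Fin k) :=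
  (Finset.range len).image fun j => prevSlot^[j] x

theorem mem_slotRun {k : ℕ} {x y : Fin k} {len : ℕ} :
    y ∈ slotRun x len ↔ ∃ j < len, prevSlot^[j] x = y := by
  simp [slotRun]

theorem card_slotRun_le {k : ℕ} (x : Fin k) (len : ℕ) : (slotRun x len).card ≤ len :=
  Finset.card_image_le.trans_eq (Finset.card_range len)

theorem card_slotRun {k : ℕ} (x : Fin k) {len : ℕ} (h : len ≤ k) : (slotRun x len).card = len := by
  rw [slotRun, Finset.card_image_of_injOn, Finset.card_range]
  exact (prevSlot_iterate_injOn x).mono fun a ha => by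
    simp only [Finset.coe_range, Set.mem_Iio] at ha ⊢; omega

theorem slotRun_full {k : ℕ} (x : Fin k) : slotRun x k = Finset.univ :=
  Finset.eq_univ_of_card _ (by rw [card_slotRun x le_rfl, Fintype.card_fin])

/-- A run has a single entrance, the slot just before its first one. If that slot is empty, no probe
can walk into the run. -/
theorem eq_of_nextSlot_mem_slotRun {k : ℕ} {x y : Fin k} {len : ℕ} (hy : y ∉ slotRun x len)
    (h : nextSlot y ∈ slotRun x len) : y = prevSlot^[len] x := by
  obtain ⟨j, hj, h⟩ := mem_slotRun.1 h
  have h' : prevSlot^[j + 1] x = y := by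
    rw [Function.iterate_succ_apply', h, prevSlot_nextSlot]
  rcases Nat.lt_or_ge (j + 1) len with h1 | h1
  · exact absurd (mem_slotRun.2 ⟨_, h1, h'⟩) hy
  · rw [← h', show j + 1 = len by omega]

theorem nextSlot_notMem_slotRun {k : ℕ} (x : Fin k) {len : ℕ} (h : len < k) :
    nextSlot x ∉ slotRun x len := by
  intro hx
  obtain ⟨j, hj, hx⟩ := mem_slotRun.1 hx
  refine prevSlot_iterate_ne x (Nat.succ_pos j) (by omega) ?_
  rw [Function.iterate_succ_apply', hx, prevSlot_nextSlot]

/-! ### Probing -/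

/-- Slot `i` of chunk `t` holds an element. -/
def State.Full (st : State C P s) (t : C.Chunk) (i : Fin (C.size t)) : Prop :=
  st.mem.bag (C.start t + i) ≠ none

instance (st : State C P s) (t : C.Chunk) : DecidablePred (st.Full t) := fun i =>
  inferInstanceAs (Decidable (st.mem.bag (C.start t + i) ≠ none))

/-- A call probes only slots after full ones. -/
theorem full_behind (ω : Tape C s) (l : List (Fin P)) {p : Fin P} {v : Fin s} {t : C.Chunk}
    {i : Fin (C.size t)} {k : ℕ} (h : (run ω l).proc p = some (v, .cas t i k)) (j : ℕ)
    (hj : j < k) : (run ω l).Full t (prevSlot^[j + 1] i) := by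
  induction l using List.reverseRecOn generalizing p v t i k j with
  | nil => cases h
  | append_singleton l q ih =>
    rw [run_snoc] at h ⊢
    generalize run ω l = st at ih h ⊢
    have goto : ∀ w pc, (∀ t i k, pc = PC.cas t i k → ∀ j < k, st.Full t (prevSlot^[j + 1] i)) →
        st.goto q w pc p = some (v, .cas t i k) → st.Full t (prevSlot^[j + 1] i) := by
      intro w pc hpc hp
      rcases eq_or_ne p q with rfl | hne
      · simp only [State.goto, Function.update_self, Option.some.injEq, Prod.mk.injEq] at hp
        exact hpc _ _ _ hp.2 _ hj
      · rw [State.goto, Function.update_of_ne hne] at hp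
        exact ih hp _ hj
    revert h
    refine step_cases (motive := fun st' : State C P s => st'.proc p = some (v, .cas t i k) →
      st'.Full t (prevSlot^[j + 1] i)) (fun h => ih h _ hj) ?_ ?_ ?_ ?_ ?_ ?_ ?_ ?_ ?_ ?_
    · exact fun _ _ => goto _ _ (by simp)
    · exact fun _ _ => goto _ _ (by simp)
    · exact fun _ _ _ _ _ _ => goto _ _ (by simp)
    · refine fun _ _ _ _ _ _ => goto _ _ ?_
      rintro t i k h
      cases h
      exact fun j hj => absurd hj (Nat.not_lt_zero _)
    · exact fun _ _ _ _ _ _ => goto _ _ (by simp)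
    · refine fun _ _ _ _ _ => goto _ _ ?_
      rintro t i k h
      cases h
      exact fun j hj => absurd hj (Nat.not_lt_zero _)
    · exact fun _ _ _ => goto _ _ (by simp)
    · intro w u x m _ _ hp
      have hne : p ≠ q := by rintro rfl; simp at hp
      simp only [Function.update_of_ne hne] at hp
      have := ih hp _ hj
      simp only [State.Full, Function.update_apply] at this ⊢
      split_ifs
      · simp
      · exact this
    · exact fun _ _ _ _ _ _ _ _ => goto _ _ (by simp)
    -- The slot just left is full because the CAS failed, and the earlier ones are full by
    -- induction; slots are never emptied during insertions.
    · refine fun w u x m hq hfull _ => goto _ _ ?_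
      rintro t i k h
      cases h
      rintro (_ | j) hj
      · rw [prevSlot_iterate_nextSlot]; exact hfull
      · rw [prevSlot_iterate_nextSlot]; exact ih hq _ (by omega)

open Classical in
/-- Whether a processor is making an attempt in chunk `t` and is at a slot in `I`. -/
noncomputable def attemptIn (t : C.Chunk) (I : Finset (Fin (C.size t)))
    (o : Option (Fin s × PC C)) : ℕ :=
  if ∃ v, ∃ i ∈ I, o = some (v, .count t i) ∨ ∃ k, o = some (v, .cas t i k) then 1 else 0

section
variable (t : C.Chunk) (I : Finset (Fin (C.size t))) (v : Fin s)

theorem attemptIn_none : attemptIn t I (none : Option (Fin s × PC C)) = 0 := by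
  simp [attemptIn]

theorem attemptIn_read : attemptIn t I (some (v, .read)) = 0 := by simp [attemptIn]

theorem attemptIn_draw (u : C.Chunk) : attemptIn t I (some (v, .draw u)) = 0 := by
  simp [attemptIn]

theorem attemptIn_resize (u : C.Chunk) : attemptIn t I (some (v, .resize u)) = 0 := by
  simp [attemptIn]

theorem attemptIn_count (i : Fin (C.size t)) :
    attemptIn t I (some (v, .count t i)) = if i ∈ I then 1 else 0 := by
  simp [attemptIn]

theorem attemptIn_cas (i : Fin (C.size t)) (k : ℕ) :
    attemptIn t I (some (v, .cas t i k)) = if i ∈ I then 1 else 0 := by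
  simp [attemptIn]

theorem attemptIn_count_of_ne {u : C.Chunk} (h : t ≠ u) (i : Fin (C.size u)) :
    attemptIn t I (some (v, .count u i)) = 0 := by
  simp [attemptIn, h.symm]

theorem attemptIn_cas_of_ne {u : C.Chunk} (h : t ≠ u) (i : Fin (C.size u)) (k : ℕ) :
    attemptIn t I (some (v, .cas u i k)) = 0 := by
  simp [attemptIn, h.symm]

end

/-- Work that is paid for in advance, for the instruction `pc`. -/
def credit : Option (Fin s × PC C) → ℕ
  | none => 0
  | some (_, .read) => 1
  | some (_, .draw _) => 0
  | some (_, .count _ _) => 4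
  | some (_, .resize _) => 2
  | some (_, .cas _ _ _) => 3

/-- `fails t x` counts the failed attempts to write into slot `x` of chunk `t`. If nobody can enter
the set `I` of slots from outside, then the attempts hashed to `I` are at least those that have
succeeded in `I`, are still probing `I`, or have left `I`. -/
structure State.Accounted (ω : Tape C s) (st : State C P s)
    (fails : (t : C.Chunk) → Fin (C.size t) → ℕ) : Prop where
  full : ∀ t x, fails t x ≠ 0 → st.Full t x
  flow : ∀ t I, (∀ y, y ∉ I → nextSlot y ∈ I → ¬ st.Full t y) →
    (I.filter (st.Full t)).card + ∑ q, attemptIn t I (st.proc q)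
      + ∑ x ∈ I.filter (fun x => nextSlot x ∉ I), fails t x
      ≤ hits ω t (hashedTo I) (st.attempts t)
  work : ∑ v, st.instrs v + ∑ q, credit (st.proc q)
    ≤ 2 * st.started + 5 * ∑ t, st.attempts t + ∑ t, ∑ x, fails t x

theorem sum_tick (st : State C P s) (v : Fin s) :
    ∑ w, st.tick v w = ∑ w, st.instrs w + 1 := by
  have := sum_update_add st.instrs v (st.instrs v + 1) id
  simp only [id] at this
  simp only [State.tick]
  omega

theorem sum_attempts_succ (st : State C P s) (t : C.Chunk) :
    ∑ u, Function.update st.attempts t (st.attempts t + 1) u = ∑ u, st.attempts u + 1 := by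
  have := sum_update_add st.attempts t (st.attempts t + 1) id
  simp only [id] at this
  omega

/-- One more failure at slot `i` of chunk `t`. -/
def addFail (fails : (t : C.Chunk) → Fin (C.size t) → ℕ) (t : C.Chunk) (i : Fin (C.size t)) :
    (t : C.Chunk) → Fin (C.size t) → ℕ :=
  Function.update fails t (Function.update (fails t) i (fails t i + 1))

theorem addFail_of_ne (fails : (t : C.Chunk) → Fin (C.size t) → ℕ) {t u : C.Chunk} (h : u ≠ t)
    (i : Fin (C.size t)) : addFail fails t i u = fails u :=
  Function.update_of_ne h _ _

theorem sum_addFail_self (fails : (t : C.Chunk) → Fin (C.size t) → ℕ) (t : C.Chunk)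
    (i : Fin (C.size t)) (I : Finset (Fin (C.size t))) :
    ∑ x ∈ I, addFail fails t i t x = ∑ x ∈ I, fails t x + if i ∈ I then 1 else 0 := by
  simp only [addFail, Function.update_self]
  split_ifs with h
  · rw [Finset.sum_update_of_mem h, ← Finset.add_sum_erase _ (fails t) h,
      Finset.sdiff_singleton_eq_erase]
    ring
  · exact Finset.sum_update_of_notMem h _ _

theorem sum_addFail (fails : (t : C.Chunk) → Fin (C.size t) → ℕ) (t : C.Chunk)
    (i : Fin (C.size t)) :
    ∑ u, ∑ x, addFail fails t i u x = ∑ u, ∑ x, fails u x + 1 := by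
  have h : ∑ u ∈ Finset.univ.erase t, ∑ x, addFail fails t i u x
      = ∑ u ∈ Finset.univ.erase t, ∑ x, fails u x :=
    Finset.sum_congr rfl fun u hu => by rw [addFail_of_ne fails (Finset.ne_of_mem_erase hu)]
  rw [← Finset.add_sum_erase _ _ (Finset.mem_univ t), sum_addFail_self, h,
    ← Finset.add_sum_erase _ (fun u => ∑ x, fails u x) (Finset.mem_univ t)]
  simp only [Finset.mem_univ, if_true]
  ring

/-- A failed probe at `i` stays in `I`, or leaves it and is then recorded in `fails` at an exit
slot, or gives up the chunk. It cannot enter `I`: the slot `i` is full, whereas the slots leading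
into `I` are not. -/
theorem accounted_of_fail {ω : Tape C s} {st st' : State C P s}
    {fails : (t : C.Chunk) → Fin (C.size t) → ℕ} (ih : st.Accounted ω fails) {p : Fin P}
    {v : Fin s} {t : C.Chunk} {i : Fin (C.size t)} {k : ℕ}
    (hp : st.proc p = some (v, .cas t i k)) (hfull : st.Full t i) {pc : PC C}
    (hpc : pc = .resize t ∨ pc = .cas t (nextSlot i) (k + 1))
    (hst' : st' = { st with proc := st.goto p v pc, instrs := st.tick v }) :
    st'.Accounted ω (addFail fails t i) := by
  subst hst'
  constructor
  · intro u x hx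
    rcases eq_or_ne u t with rfl | hne
    · rcases eq_or_ne x i with rfl | hne
      · exact hfull
      · refine ih.full u x ?_
        simpa [addFail, Function.update_of_ne hne] using hx
    · rw [addFail_of_ne _ hne] at hx
      exact ih.full u x hx
  · intro u I hI
    have h0 := ih.flow u I hI
    have h1 := sum_goto hp v pc (attemptIn u I)
    rcases eq_or_ne u t with rfl | hne
    · simp only [sum_addFail_self, Finset.mem_filter]
      rw [attemptIn_cas] at h1
      have h2 : (i ∉ I → nextSlot i ∉ I) := fun h h' => hI i h h' hfull
      rcases hpc with rfl | rfl
      · rw [attemptIn_resize] at h1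
        change (I.filter (st.Full u)).card + _ + _ ≤ _
        by_cases ha : i ∈ I <;> by_cases hb : nextSlot i ∈ I <;> simp [ha, hb] at h1 ⊢ <;> omega
      · rw [attemptIn_cas] at h1
        change (I.filter (st.Full u)).card + _ + _ ≤ _
        by_cases ha : i ∈ I <;> by_cases hb : nextSlot i ∈ I <;> simp [ha, hb] at h1 h2 ⊢ <;> omega
    · rw [addFail_of_ne _ hne]
      rw [attemptIn_cas_of_ne _ _ _ hne] at h1
      change (I.filter (st.Full u)).card + _ + _ ≤ _
      rcases hpc with rfl | rfl
      · rw [attemptIn_resize] at h1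
        simp only
        omega
      · rw [attemptIn_cas_of_ne _ _ _ hne] at h1
        simp only
        omega
  · have h0 := ih.work
    have h1 := sum_goto hp v pc credit
    have h2 : credit (some (v, pc)) ≤ credit (some (v, PC.cas t i k)) := by
      rcases hpc with rfl | rfl <;> simp [credit]
    simp only [sum_tick, sum_addFail]
    omega

/-- The failure counters are not part of the machine and are built along the run. For the work
bound, a start pays 2 (itself and the read), a draw pays 5 (itself and at most count, resize, next
read and a successful CAS, of which a call never needs more than its credit), and every failed CAS
pays for itself through `fails`. -/
theorem exists_accounted (ω : Tape C s) (l : List (Fin P)) :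
    ∃ fails, (run ω l).Accounted ω fails := by
  induction l using List.reverseRecOn with
  | nil =>
    refine ⟨fun _ _ => 0, ?_, ?_, ?_⟩
    · simp
    · intro t I _
      rw [Finset.filter_false_of_mem fun x _ => by
        simp [run_nil, State.init, Store.empty, State.Full]]
      simp [run_nil, State.init, attemptIn_none]
    · simp [run_nil, State.init, credit]
  | append_singleton l p ih =>
    rw [run_snoc]
    have hdraw : ∀ v u, (run ω l).proc p = some (v, .draw u) → (run ω l).attempts u < s :=
      fun v u => attempts_lt_of_draw ω l
    generalize run ω l = st at ih hdraw ⊢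
    obtain ⟨fails, ih⟩ := ih
    have keep : ∀ st' : State C P s, st'.mem.bag = st.mem.bag → st'.attempts = st.attempts →
        ∀ o v pc, st.proc p = o → st'.proc = st.goto p v pc →
        (∀ t I, attemptIn t I (some (v, pc)) ≤ attemptIn t I o) →
        ∑ w, st'.instrs w ≤ ∑ w, st.instrs w + 1 →
        credit (some (v, pc)) + 1 + 2 * st.started ≤ credit o + 2 * st'.started →
        st'.Accounted ω fails := by
      intro st' hb ha o v pc hp hp' hatt hin hcr
      have hF : ∀ t, st'.Full t = st.Full t := fun t => by
        funext x; simp only [State.Full, hb]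
      constructor
      · intro t x hx; rw [hF]; exact ih.full t x hx
      · intro t I hI
        rw [hF] at hI
        have h0 := ih.flow t I hI
        have h1 := sum_goto hp v pc (attemptIn t I)
        have h2 := hatt t I
        have h3 : I.filter (st'.Full t) = I.filter (st.Full t) :=
          Finset.filter_congr fun x _ => by rw [hF]
        rw [ha, hp', h3]
        omega
      · have h0 := ih.work
        have h1 := sum_goto hp v pc credit
        rw [hp', ha]
        omega
    have draw : ∀ v t pc (j : Fin s), st.proc p = some (v, .draw t) →
        j.val = st.attempts t % s → (pc = .count t (ω t j).2 ∨ pc = .cas t (ω t j).2 0) →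
        State.Accounted ω { st with
          attempts := Function.update st.attempts t (st.attempts t + 1)
          proc := st.goto p v pc
          instrs := st.tick v } fails := by
      intro v t pc j hp hj hpc
      rw [Nat.mod_eq_of_lt (hdraw v t hp)] at hj
      constructor
      · exact ih.full
      · intro u I hI
        have h0 := ih.flow u I hI
        have h1 := sum_goto hp v pc (attemptIn u I)
        rw [attemptIn_draw] at h1
        change (I.filter (st.Full u)).card + _ + _ ≤ _
        simp only
        rcases eq_or_ne u t with rfl | hne
        · have h2 : attemptIn u I (some (v, pc)) = if (ω u j).2 ∈ I then 1 else 0 := by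
            rcases hpc with rfl | rfl
            · exact attemptIn_count _ _ _ _
            · exact attemptIn_cas _ _ _ _ _
          have h3 : ω u j ∈ hashedTo I ↔ (ω u j).2 ∈ I := by simp [hashedTo]
          simp only [Function.update_self, hits_succ ω u _ hj, h3]
          omega
        · have h2 : attemptIn u I (some (v, pc)) = 0 := by
            rcases hpc with rfl | rfl
            · exact attemptIn_count_of_ne _ _ _ hne _
            · exact attemptIn_cas_of_ne _ _ _ hne _ _
          simp only [Function.update_of_ne hne]
          omega
      · have h0 := ih.work
        have h1 := sum_goto hp v pc credit
        have h2 : credit (some (v, pc)) ≤ 4 := by rcases hpc with rfl | rfl <;> simp [credit]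
        have h3 : credit (some (v, (PC.draw t))) = 0 := rfl
        simp only [sum_tick, sum_attempts_succ]
        omega
    refine step_cases (motive := fun st' : State C P s => ∃ fails, st'.Accounted ω fails)
      ⟨fails, ih⟩ ?_ ?_ ?_ ?_ ?_ ?_ ?_ ?_ ?_ ?_
    · intro hp h
      refine ⟨fails, keep _ rfl rfl _ _ _ hp rfl ?_ ?_ ?_⟩
      · simp [attemptIn_read]
      · have := sum_update_add st.instrs ⟨st.started, h⟩ 1 id
        simp only [id] at this
        simp only
        omega
      · simp only [credit]; omega
    · intro v hp
      refine ⟨fails, keep _ rfl rfl _ _ _ hp rfl ?_ (sum_tick st v).le ?_⟩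
      · simp [attemptIn_draw]
      · simp [credit]
    · exact fun v t hp j hj _ => ⟨fails, draw v t _ j hp hj (.inl rfl)⟩
    · exact fun v t hp j hj _ => ⟨fails, draw v t _ j hp hj (.inr rfl)⟩
    · intro v t i hp _ _
      refine ⟨fails, keep _ rfl rfl _ _ _ hp rfl ?_ (sum_tick st v).le ?_⟩
      · simp [attemptIn_resize]
      · simp [credit]
    · intro v t i hp _
      refine ⟨fails, keep _ rfl rfl _ _ _ hp rfl ?_ (sum_tick st v).le ?_⟩
      · intro u I
        rcases eq_or_ne u t with rfl | hne
        · rw [attemptIn_count, attemptIn_cas]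
        · rw [attemptIn_cas_of_ne _ _ _ hne]; exact Nat.zero_le _
      · simp [credit]
    · intro v t hp
      refine ⟨fails, keep _ rfl rfl _ _ _ hp rfl ?_ (sum_tick st v).le ?_⟩
      · simp [attemptIn_read]
      · simp [credit]
    · intro v t i k hp hb
      suffices ∀ st' : State C P s,
          st'.mem.bag = Function.update st.mem.bag (C.start t + i) (some v) →
          st'.attempts = st.attempts → st'.proc = Function.update st.proc p none →
          st'.instrs = st.tick v → st'.started = st.started → st'.Accounted ω fails from
        ⟨fails, this _ rfl rfl rfl rfl rfl⟩
      intro st' hb' ha' hp' hi' hs'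
      have full_iff : ∀ (u : C.Chunk) (x : Fin (C.size u)), C.start u + x ≠ C.start t + i →
          (st'.Full u x ↔ st.Full u x) := fun u x h => by
        simp only [State.Full, hb', Function.update_of_ne h]
      have mono : ∀ (u : C.Chunk) (x : Fin (C.size u)), st.Full u x → st'.Full u x := by
        intro u x hx
        by_cases h : C.start u + x = C.start t + i
        · simp [State.Full, hb', h]
        · exact (full_iff u x h).2 hx
      refine ⟨fun u x hx => mono u x (ih.full u x hx), ?_, ?_⟩
      · intro u I hI
        -- Slots only fill up, so the slots leading into `I` that are empty now were empty before.
        have h0 := ih.flow u I fun y hy hy' hF => hI y hy hy' (mono u y hF)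
        have h1 := sum_return hp (attemptIn u I)
        rw [attemptIn_none] at h1
        rw [ha', hp']
        rcases eq_or_ne u t with rfl | hne
        · rw [attemptIn_cas] at h1
          have h2 : (I.filter (st'.Full u)).card
              ≤ (I.filter (st.Full u)).card + if i ∈ I then 1 else 0 := by
            have hsub : I.filter (st'.Full u) ⊆ I.filter (st.Full u) ∪ if i ∈ I then {i} else ∅ := by
              intro x hx
              rw [Finset.mem_filter] at hx
              rw [Finset.mem_union, Finset.mem_filter]
              by_cases hxi : x = i
              · subst hxi
                right
                rw [if_pos hx.1]
                exact Finset.mem_singleton_self _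
              · exact .inl ⟨hx.1, (full_iff u x fun h => hxi (Fin.ext (by omega))).1 hx.2⟩
            refine (Finset.card_le_card hsub).trans ((Finset.card_union_le _ _).trans ?_)
            split_ifs <;> simp
          omega
        · rw [attemptIn_cas_of_ne _ _ _ hne] at h1
          have h2 : I.filter (st'.Full u) = I.filter (st.Full u) :=
            Finset.filter_congr fun x _ =>
              full_iff u x fun h => hne (Fin.ext (slot_chunk_inj h))
          rw [h2]
          omega
      · have h0 := ih.work
        have h1 := sum_return hp credit
        have h2 : credit (some (v, PC.cas t i k)) = 3 := rfl
        have h3 : credit (none : Option (Fin s × PC C)) = 0 := rfl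
        rw [hi', hs', ha', hp', sum_tick]
        omega
    · exact fun v t i k hp hb _ _ => ⟨_, accounted_of_fail ih hp hb (.inl rfl) rfl⟩
    · exact fun v t i k hp hb _ => ⟨_, accounted_of_fail ih hp hb (.inr rfl) rfl⟩

/-! ### Full runs of slots -/

/-- Apply `flow` to the whole chunk, which has no outside: its full slots are at most as many as the
attempts. -/
theorem State.Accounted.exists_not_full {ω : Tape C s} {st : State C P s}
    {fails : (t : C.Chunk) → Fin (C.size t) → ℕ} (h : st.Accounted ω fails) {t : C.Chunk}
    (ht : st.attempts t < C.size t) : ∃ y, ¬ st.Full t y := by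
  by_contra! hall
  have h1 := h.flow t Finset.univ (fun y hy => absurd (Finset.mem_univ y) hy)
  rw [Finset.filter_true_of_mem fun x _ => hall x, Finset.card_univ, Fintype.card_fin] at h1
  have h2 := hits_le ω t (hashedTo Finset.univ) (st.attempts t)
  omega

/-- A full slot is the end of a run of full slots into which at least as many attempts were hashed
as the run has slots and failures at its end. -/
theorem State.Accounted.exists_run {ω : Tape C s} {st : State C P s}
    {fails : (t : C.Chunk) → Fin (C.size t) → ℕ} (h : st.Accounted ω fails) {t : C.Chunk}
    (ht : st.attempts t < C.size t) {x : Fin (C.size t)} (hx : st.Full t x) :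
    ∃ len, 1 ≤ len ∧ len < C.size t ∧ ¬ st.Full t (prevSlot^[len] x) ∧
      len + fails t x ≤ hits ω t (hashedTo (slotRun x len)) (st.attempts t) := by
  classical
  obtain ⟨y, hy⟩ := h.exists_not_full ht
  have hex : ∃ j, j < C.size t ∧ ¬ st.Full t (prevSlot^[j] x) := by
    have hyx : y ∈ slotRun x (C.size t) := by rw [slotRun_full]; exact Finset.mem_univ y
    obtain ⟨j, hj, rfl⟩ := mem_slotRun.1 hyx
    exact ⟨j, hj, hy⟩
  -- The nearest empty slot going backwards from `x`; the run after it is the maximal full run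
  -- ending at `x`.
  obtain ⟨h1, h2⟩ := Nat.find_spec hex
  set len := Nat.find hex with hlen
  have hfull : ∀ z ∈ slotRun x len, st.Full t z := by
    intro z hz
    obtain ⟨j, hj, rfl⟩ := mem_slotRun.1 hz
    by_contra hc
    exact Nat.find_min hex hj ⟨hj.trans h1, hc⟩
  have hpos : 1 ≤ len := by
    by_contra h0
    have : len = 0 := by omega
    rw [this] at h2
    exact h2 hx
  refine ⟨len, hpos, h1, h2, ?_⟩
  -- The only entrance to the run is the empty slot just found, so `flow` applies; and `x` is an
  -- exit of the run, so its failures are counted.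
  have h3 := h.flow t (slotRun x len) fun z hz hz' => by
    rw [eq_of_nextSlot_mem_slotRun hz hz']; exact h2
  rw [Finset.filter_true_of_mem hfull, card_slotRun x h1.le] at h3
  have h4 : fails t x ≤ ∑ z ∈ (slotRun x len).filter (fun z => nextSlot z ∉ slotRun x len),
      fails t z :=
    Finset.single_le_sum (fun _ _ => Nat.zero_le _) (Finset.mem_filter.2
      ⟨mem_slotRun.2 ⟨0, hpos, rfl⟩, nextSlot_notMem_slotRun x h1⟩)
  omega

/-- The number of attempts hashed to a run in excess of its slots, added up over all runs. -/
def excess (ω : Tape C s) (t : C.Chunk) (a : ℕ) : ℕ :=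
  ∑ x : Fin (C.size t), ∑ len ∈ Finset.Ico 1 (C.size t), (hits ω t (hashedTo (slotRun x len)) a - len)

/-- The length of the full run ending at `x` depends on the execution. Summing the overload over all
possible lengths removes this dependence and leaves a function of the tape alone. -/
theorem State.Accounted.sum_fails_le {ω : Tape C s} {st : State C P s}
    {fails : (t : C.Chunk) → Fin (C.size t) → ℕ} (h : st.Accounted ω fails) {t : C.Chunk}
    (ht : st.attempts t < C.size t) {a : ℕ} (ha : st.attempts t ≤ a) :
    ∑ x, fails t x ≤ excess ω t a := by
  refine Finset.sum_le_sum fun x _ => ?_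
  rcases eq_or_ne (fails t x) 0 with h0 | h0
  · rw [h0]; exact Nat.zero_le _
  · obtain ⟨len, h1, h2, _, h3⟩ := h.exists_run ht (h.full t x h0)
    have h4 := hits_mono ω t (hashedTo (slotRun x len)) ha
    have h5 := Finset.single_le_sum
      (f := fun len => hits ω t (hashedTo (slotRun x len)) a - len)
      (fun _ _ => Nat.zero_le _) (Finset.mem_Ico.2 ⟨h1, h2⟩)
    omega

theorem sum_fails_eq_zero {ω : Tape C s} {st : State C P s}
    {fails : (t : C.Chunk) → Fin (C.size t) → ℕ} (h : st.Accounted ω fails) {t : C.Chunk}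
    (ht : st.attempts t = 0) : ∑ x, fails t x = 0 := by
  refine Finset.sum_eq_zero fun x _ => ?_
  by_contra h0
  have hx := h.full t x h0
  obtain ⟨len, h1, _, _, h3⟩ := h.exists_run (by rw [ht]; exact x.pos) hx
  have := hits_le ω t (hashedTo (slotRun x len)) (st.attempts t)
  omega

/-- In a chunk with an empty slot, fewer probes fail than there are slots. -/
theorem probes_lt_size (ω : Tape C s) (l : List (Fin P)) {p : Fin P} {v : Fin s} {t : C.Chunk}
    {i : Fin (C.size t)} {k : ℕ} (h : (run ω l).proc p = some (v, .cas t i k))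
    (ht : (run ω l).attempts t < C.size t) : k < C.size t := by
  obtain ⟨fails, hacc⟩ := exists_accounted ω l
  obtain ⟨y, hy⟩ := hacc.exists_not_full ht
  by_contra! hk
  have hyx : y ∈ slotRun (prevSlot i) (C.size t) := by rw [slotRun_full]; exact Finset.mem_univ y
  obtain ⟨j, hj, rfl⟩ := mem_slotRun.1 hyx
  refine hy ?_
  rw [← Function.iterate_succ_apply]
  exact full_behind ω l h j (by omega)

/-- The maximal full run ending at `x` has at least `k` slots and is filled by attempts hashed into
it. With `b` or more slots it would contradict `hrun`. -/
theorem lt_of_full_run {ω : Tape C s} {st : State C P s}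
    {fails : (t : C.Chunk) → Fin (C.size t) → ℕ} (h : st.Accounted ω fails) {t : C.Chunk}
    (ht : st.attempts t < C.size t) {a b k : ℕ} (ha : st.attempts t ≤ a)
    (hrun : ∀ x len, b ≤ len → len < C.size t → hits ω t (hashedTo (slotRun x len)) a < len)
    {x : Fin (C.size t)} (hk : 0 < k) (hfull : ∀ j < k, st.Full t (prevSlot^[j] x)) : k < b := by
  obtain ⟨len, _, h2, h3, h4⟩ := h.exists_run ht (show st.Full t x from hfull 0 hk)
  have h5 : k ≤ len := by
    by_contra hlt
    exact h3 (hfull len (by omega))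
  by_contra hb
  have h6 := hrun x len (by omega) h2
  have h7 := hits_mono ω t (hashedTo (slotRun x len)) ha
  omega

/-- If no run of `kappa` or more slots is overloaded, then no call fails more than `kappa` times
in a chunk. -/
theorem probes_le (ω : Tape C s) (l : List (Fin P)) {p : Fin P} {v : Fin s} {t : C.Chunk}
    {i : Fin (C.size t)} {k a : ℕ} (h : (run ω l).proc p = some (v, .cas t i k))
    (ht : (run ω l).attempts t < C.size t) (ha : (run ω l).attempts t ≤ a)
    (hrun : ∀ x len, C.kappa ≤ len → len < C.size t →
      hits ω t (hashedTo (slotRun x len)) a < len) :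
    k ≤ C.kappa ∧ ((run ω l).mem.bag (C.start t + i) ≠ none → k < C.kappa) := by
  obtain ⟨fails, hacc⟩ := exists_accounted ω l
  have hb := full_behind ω l h
  constructor
  · rcases Nat.eq_zero_or_pos k with rfl | hk
    · exact Nat.zero_le _
    · exact (lt_of_full_run hacc ht ha hrun hk fun j hj => by
        rw [← Function.iterate_succ_apply]; exact hb j hj).le
  · intro hfull
    have := lt_of_full_run hacc ht ha hrun (x := i) (Nat.succ_pos k) fun j hj => by
      rcases j with _ | j
      · exact hfull
      · exact hb j (by omega)
    omega

/-! ### Monotonicity -/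

theorem step_attempts (ω : Tape C s) (st : State C P s) (p : Fin P) (t : C.Chunk) :
    (step ω st p).attempts t ≤ st.attempts t + 1 := by
  refine step_cases (motive := fun st' : State C P s => st'.attempts t ≤ st.attempts t + 1)
    ?_ ?_ ?_ ?_ ?_ ?_ ?_ ?_ ?_ ?_ ?_ <;> intros <;>
  (try simp only [Function.update_apply]) <;> (try split_ifs with h) <;> (try subst h) <;> omega

theorem step_sample (ω : Tape C s) (st : State C P s) (p : Fin P) (t : C.Chunk) :
    st.mem.sample t ≤ (step ω st p).mem.sample t := by
  refine step_cases (motive := fun st' : State C P s => st.mem.sample t ≤ st'.mem.sample t)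
    ?_ ?_ ?_ ?_ ?_ ?_ ?_ ?_ ?_ ?_ ?_ <;> intros <;>
  (try simp only [Function.update_apply]) <;> (try split_ifs with h) <;> (try subst h) <;> omega

theorem step_r (ω : Tape C s) (st : State C P s) (p : Fin P) :
    st.mem.r.val ≤ (step ω st p).mem.r := by
  refine step_cases (motive := fun st' : State C P s => st.mem.r.val ≤ st'.mem.r)
    ?_ ?_ ?_ ?_ ?_ ?_ ?_ ?_ ?_ ?_ ?_ <;> intros <;>
  first | exact le_rfl | exact le_bumped _ _

theorem step_proc_of_ne (ω : Tape C s) (st : State C P s) {p q : Fin P} (h : p ≠ q) :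
    (step ω st q).proc p = st.proc p := by
  refine step_cases (motive := fun st' : State C P s => st'.proc p = st.proc p)
    ?_ ?_ ?_ ?_ ?_ ?_ ?_ ?_ ?_ ?_ ?_ <;> intros <;>
  first | rfl | exact Function.update_of_ne h _ _

theorem run_append_attempts (ω : Tape C s) (l l' : List (Fin P)) (t : C.Chunk) :
    (run ω (l ++ l')).attempts t ≤ (run ω l).attempts t + l'.length := by
  induction l' using List.reverseRecOn with
  | nil => simp
  | append_singleton l' p ih =>
    rw [← List.append_assoc, run_snoc, List.length_append, List.length_singleton]
    have := step_attempts ω (run ω (l ++ l')) p t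
    omega

theorem run_append_r (ω : Tape C s) (l l' : List (Fin P)) :
    (run ω l).mem.r.val ≤ (run ω (l ++ l')).mem.r := by
  induction l' using List.reverseRecOn with
  | nil => simp
  | append_singleton l' p ih =>
    rw [← List.append_assoc, run_snoc]
    exact ih.trans (step_r _ _ _)

theorem run_append_proc (ω : Tape C s) (l l' : List (Fin P)) {p : Fin P} (h : p ∉ l') :
    (run ω (l ++ l')).proc p = (run ω l).proc p := by
  induction l' using List.reverseRecOn with
  | nil => simp
  | append_singleton l' q ih =>
    simp only [List.mem_append, List.mem_singleton, not_or] at h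
    rw [← List.append_assoc, run_snoc, step_proc_of_ne _ _ h.2, ih h.1]

/-- Discrete intermediate values: an instruction raises the number of attempts by at most one. -/
theorem exists_attempts_eq (ω : Tape C s) (l : List (Fin P)) (t : C.Chunk) {a : ℕ}
    (h : a ≤ (run ω l).attempts t) : ∃ l₁ l₂, l = l₁ ++ l₂ ∧ (run ω l₁).attempts t = a := by
  induction l using List.reverseRecOn with
  | nil => exact ⟨[], [], rfl, (Nat.le_zero.1 h).symm⟩
  | append_singleton l p ih =>
    by_cases ha : a ≤ (run ω l).attempts t
    · obtain ⟨l₁, l₂, rfl, h₁⟩ := ih ha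
      exact ⟨l₁, l₂ ++ [p], by rw [List.append_assoc], h₁⟩
    · refine ⟨l ++ [p], [], by simp, ?_⟩
      rw [run_snoc] at h ⊢
      have := step_attempts ω (run ω l) p t
      omega

/-! ### Loosely synchronized schedules -/

theorem LooselySynchronized.of_prefix {D : ℕ} {ω : Tape C s} {l l' : List (Fin P)}
    (h : LooselySynchronized D ω l) (hl : l' <+: l) : LooselySynchronized D ω l' := by
  obtain ⟨l₀, rfl⟩ := hl
  intro l₁ l₂ l₃ heq
  exact h l₁ l₂ (l₃ ++ l₀) (by rw [heq, List.append_assoc])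

/-- Pigeonhole: if `p` were idle in mid-call throughout `l₂`, each of the `P` processors could
execute at most `D` instructions there. -/
theorem LooselySynchronized.mem_of_length {D : ℕ} {ω : Tape C s} {l₁ l₂ l₃ : List (Fin P)}
    (h : LooselySynchronized D ω (l₁ ++ l₂ ++ l₃)) {p : Fin P} (hp : (run ω l₁).proc p ≠ none)
    (hl : P * D < l₂.length) : p ∈ l₂ := by
  by_contra hmem
  have h1 := h l₁ l₂ l₃ rfl p hp hmem
  have h2 : l₂.length = ∑ q, l₂.count q := by
    rw [← Multiset.coe_card, ← Multiset.sum_count_eq_card (s := Finset.univ) (by simp)]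
    simp
  have h3 := Finset.sum_le_card_nsmul Finset.univ (fun q => l₂.count q) D (fun q _ => h1 q)
  simp only [Finset.card_univ, Fintype.card_fin, smul_eq_mul] at h3
  omega

theorem step_sample_add (ω : Tape C s) (st : State C P s) (p : Fin P) (t : C.Chunk) :
    st.mem.sample t + atCount t (st.proc p) ≤ (step ω st p).mem.sample t := by
  rcases hp : st.proc p with _ | ⟨v, pc⟩
  · exact step_sample ω st p t
  · cases pc with
    | count u i =>
      rcases eq_or_ne u t with rfl | hne
      · simp [step, hp, exec, atCount_count]
      · rw [atCount_count, if_neg hne]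
        exact step_sample ω st p t
    | _ => exact step_sample ω st p t

/-- A sample pending after `l` enters the counter as soon as its processor is scheduled, so only
processors absent from `l'` can still hold one back. -/
theorem hits_le_sample_add (ω : Tape C s) (l l' : List (Fin P)) (t : C.Chunk) :
    hits ω t (sampled C t) ((run ω l).attempts t)
      ≤ (run ω (l ++ l')).mem.sample t
        + ∑ q, if q ∈ l' then 0 else atCount t ((run ω l).proc q) := by
  induction l' using List.reverseRecOn with
  | nil => simp [sample_add]
  | append_singleton l' p ih =>
    refine ih.trans ?_
    rw [← List.append_assoc, run_snoc]
    have hsum : ∑ q, (if q ∈ l' then 0 else atCount t ((run ω l).proc q))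
        ≤ (∑ q, if q ∈ l' ++ [p] then 0 else atCount t ((run ω l).proc q))
          + if p ∈ l' then 0 else atCount t ((run ω l).proc p) := by
      rw [← Finset.add_sum_erase _ _ (Finset.mem_univ p), ← Finset.add_sum_erase _
        (fun q => if q ∈ l' ++ [p] then 0 else atCount t ((run ω l).proc q)) (Finset.mem_univ p)]
      have : ∑ q ∈ Finset.univ.erase p, (if q ∈ l' then 0 else atCount t ((run ω l).proc q))
          = ∑ q ∈ Finset.univ.erase p,
            if q ∈ l' ++ [p] then 0 else atCount t ((run ω l).proc q) :=
        Finset.sum_congr rfl fun q hq => by simp [Finset.ne_of_mem_erase hq]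
      rw [this]
      omega
    have hstep : (run ω (l ++ l')).mem.sample t
        + (if p ∈ l' then 0 else atCount t ((run ω l).proc p))
        ≤ (step ω (run ω (l ++ l')) p).mem.sample t := by
      split_ifs with hp
      · exact step_sample ω _ p t
      · rw [← run_append_proc ω l l' hp]
        exact step_sample_add ω _ p t
    omega

/-- The number of attempts in a chunk from which `r` has moved on, together with those that are
about to start. -/
def atDraw (t : C.Chunk) : Option (Fin s × PC C) → ℕ
  | some (_, .draw u) => if u = t then 1 else 0
  | _ => 0

theorem atDraw_le_one (t : C.Chunk) (o : Option (Fin s × PC C)) : atDraw t o ≤ 1 := by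
  unfold atDraw
  split
  · split_ifs <;> omega
  · omega

/-- Once `r` has passed `t`, no read can lead to a new draw in `t`; each remaining draw turns a
pending one into an attempt. -/
theorem step_attempts_add (ω : Tape C s) (st : State C P s) (p : Fin P) (t : C.Chunk)
    (h : t.val < st.mem.r) :
    (step ω st p).attempts t + ∑ q, atDraw t ((step ω st p).proc q)
      ≤ st.attempts t + ∑ q, atDraw t (st.proc q) := by
  have keep : ∀ v pc, atDraw t (some (v, pc)) = 0 →
      ∑ q, atDraw t (st.goto p v pc q) ≤ ∑ q, atDraw t (st.proc q) := by
    intro v pc hpc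
    have := sum_goto rfl v pc (atDraw t) (st := st) (p := p)
    omega
  have draw : ∀ v u pc, st.proc p = some (v, .draw u) → atDraw t (some (v, pc)) = 0 →
      Function.update st.attempts u (st.attempts u + 1) t + ∑ q, atDraw t (st.goto p v pc q)
        ≤ st.attempts t + ∑ q, atDraw t (st.proc q) := by
    intro v u pc hp hpc
    have := sum_goto hp v pc (atDraw t)
    have h1 : atDraw t (some (v, PC.draw u)) = if u = t then 1 else 0 := rfl
    rw [h1] at this
    rcases eq_or_ne u t with rfl | hne
    · rw [if_pos rfl] at this
      rw [Function.update_self]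
      omega
    · rw [if_neg hne] at this
      rw [Function.update_of_ne hne.symm]
      omega
  refine step_cases (motive := fun st' : State C P s =>
    st'.attempts t + ∑ q, atDraw t (st'.proc q) ≤ st.attempts t + ∑ q, atDraw t (st.proc q))
    le_rfl ?_ ?_ ?_ ?_ ?_ ?_ ?_ ?_ ?_ ?_
  · exact fun _ _ => Nat.add_le_add_left (keep _ _ rfl) _
  · refine fun _ _ => Nat.add_le_add_left (keep _ _ ?_) _
    exact if_neg fun h' => by rw [h'] at h; exact lt_irrefl _ h
  · exact fun v u hp j _ _ => draw v u _ hp rfl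
  · exact fun v u hp j _ _ => draw v u _ hp rfl
  · exact fun _ _ _ _ _ _ => Nat.add_le_add_left (keep _ _ rfl) _
  · exact fun _ _ _ _ _ => Nat.add_le_add_left (keep _ _ rfl) _
  · exact fun _ _ _ => Nat.add_le_add_left (keep _ _ rfl) _
  · intro v u i k hp _
    have := sum_return hp (atDraw t)
    have h1 : atDraw t (none : Option (Fin s × PC C)) = 0 := rfl
    simp only
    omega
  · exact fun _ _ _ _ _ _ _ _ => Nat.add_le_add_left (keep _ _ rfl) _
  · exact fun _ _ _ _ _ _ _ => Nat.add_le_add_left (keep _ _ rfl) _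

theorem run_append_attempts_of_lt (ω : Tape C s) (l l' : List (Fin P)) {t : C.Chunk}
    (h : t.val < (run ω l).mem.r) :
    (run ω (l ++ l')).attempts t ≤ (run ω l).attempts t + P := by
  have key : (run ω (l ++ l')).attempts t + ∑ q, atDraw t ((run ω (l ++ l')).proc q)
      ≤ (run ω l).attempts t + ∑ q, atDraw t ((run ω l).proc q) := by
    induction l' using List.reverseRecOn with
    | nil => simp
    | append_singleton l' p ih =>
      rw [← List.append_assoc, run_snoc]
      exact (step_attempts_add ω _ p t (h.trans_le (run_append_r ω l l'))).trans ih
  have := Finset.sum_le_card_nsmul Finset.univ (fun q => atDraw t ((run ω l).proc q)) 1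
    (fun q _ => atDraw_le_one _ _)
  simp only [Finset.card_univ, Fintype.card_fin, smul_eq_mul, mul_one] at this
  omega

theorem step_resize {ω : Tape C s} {st : State C P s} {p : Fin P} {v : Fin s} {t : C.Chunk}
    (h : st.proc p = some (v, .resize t)) (hc : st.Confined) : t.val < (step ω st p).mem.r := by
  have h1 : t.val ≤ st.mem.r ∧ t.val < C.last := hc.pc _ _ _ h
  have h2 : (step ω st p).mem.r = st.mem.bumped t := by simp [step, h, exec, Store.bumped]
  rw [h2]
  exact lt_bumped _ _ h1.1 h1.2

/-- Under a loosely synchronized schedule, `r` moves on soon after enough attempts are sampled. -/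
theorem attempts_le_of_sampled {D : ℕ} {ω : Tape C s} {l : List (Fin P)}
    (hl : LooselySynchronized D ω l) (hσ : 0 < C.sigma) {t : C.Chunk} (ht : t.val < C.last)
    {a : ℕ} (ha : C.sigma ≤ hits ω t (sampled C t) a) :
    (run ω l).attempts t ≤ a + 2 * (P * D + 1) + P := by
  by_contra! hlt
  -- Stop at the moment of exactly `a` attempts: by then `sigma` of them are sampled, though perhaps
  -- not yet counted. The rest of the schedule is cut into two windows of `P * D + 1` instructions
  -- and a remainder.
  obtain ⟨l₁, l₂, rfl, h₁⟩ := exists_attempts_eq ω l t (a := a) (by omega)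
  have hlen : 2 * (P * D + 1) < l₂.length := by
    have := run_append_attempts ω l₁ l₂ t
    omega
  obtain ⟨l₃, l₄, rfl, h₃⟩ : ∃ l₃ l₄, l₂ = l₃ ++ l₄ ∧ l₃.length = P * D + 1 :=
    ⟨l₂.take (P * D + 1), l₂.drop (P * D + 1), (List.take_append_drop _ _).symm,
      by rw [List.length_take]; omega⟩
  obtain ⟨l₅, l₆, rfl, h₅⟩ : ∃ l₅ l₆, l₄ = l₅ ++ l₆ ∧ l₅.length = P * D + 1 :=
    ⟨l₄.take (P * D + 1), l₄.drop (P * D + 1), (List.take_append_drop _ _).symm,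
      by rw [List.length_take]; rw [List.length_append] at hlen; omega⟩
  -- In the first window every processor holding a pending sample is scheduled, so the counter
  -- reaches `sigma`.
  have hsample : C.sigma ≤ (run ω (l₁ ++ l₃)).mem.sample t := by
    have h := hits_le_sample_add ω l₁ l₃ t
    rw [h₁, Finset.sum_eq_zero, add_zero] at h
    · exact ha.trans h
    · intro q _
      split_ifs with hq
      · rfl
      · by_contra hne
        refine hq (LooselySynchronized.mem_of_length (l₁ := l₁) (l₃ := l₅ ++ l₆)
          (by simpa using hl) (fun h0 => hne ?_) (by omega))
        rw [h0]; rfl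
  -- In the second window a processor waiting to give up `t` is scheduled, if `r` has not passed `t`
  -- already.
  have hr : t.val < (run ω (l₁ ++ l₃ ++ l₅)).mem.r := by
    rcases lt_or_resizing ω (l₁ ++ l₃) hσ t ht hsample with h | ⟨p, v, hp⟩
    · exact h.trans_le (run_append_r _ _ _)
    · have hmem : p ∈ l₅ := LooselySynchronized.mem_of_length (l₁ := l₁ ++ l₃) (l₃ := l₆)
        (by simpa using hl) (by rw [hp]; simp) (by omega)
      obtain ⟨l₇, l₈, rfl, hnot⟩ := List.eq_append_cons_of_mem hmem
      have hp' : (run ω (l₁ ++ l₃ ++ l₇)).proc p = some (v, .resize t) := by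
        rw [run_append_proc _ _ _ hnot, hp]
      have h := step_resize (ω := ω) hp' (confined_run _ _)
      rw [← run_snoc] at h
      have h' := run_append_r ω (l₁ ++ l₃ ++ l₇ ++ [p]) l₈
      simp only [List.append_assoc, List.singleton_append] at h h' ⊢
      exact h.trans_le h'
  -- After both windows at most `P` further attempts occur, and each window contributes at most its
  -- length.
  have h6 := run_append_attempts_of_lt ω (l₁ ++ l₃ ++ l₅) l₆ hr
  have h7 := run_append_attempts ω l₁ (l₃ ++ l₅) t
  simp only [List.append_assoc, List.length_append] at h6 h7 hlt
  omega

/-! ### Bounds for arbitrary random choices -/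

/-- Enforced by the algorithm for every tape and schedule, since outside the last chunk a call quits
at the limit. It feeds the deterministic bound used on atypical choices. -/
theorem probes_le_kappa (ω : Tape C s) (l : List (Fin P)) {p : Fin P} {v : Fin s} {t : C.Chunk}
    {i : Fin (C.size t)} {k : ℕ} (h : (run ω l).proc p = some (v, .cas t i k))
    (ht : t.val < C.last) : k ≤ C.kappa := by
  induction l using List.reverseRecOn generalizing p v t i k with
  | nil => cases h
  | append_singleton l q ih =>
    rw [run_snoc] at h
    generalize run ω l = st at ih h
    have goto : ∀ w pc, (∀ t i k, pc = PC.cas t i k → t.val < C.last → k ≤ C.kappa) →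
        st.goto q w pc p = some (v, .cas t i k) → k ≤ C.kappa := by
      intro w pc hpc hp
      rcases eq_or_ne p q with rfl | hne
      · simp only [State.goto, Function.update_self, Option.some.injEq, Prod.mk.injEq] at hp
        exact hpc _ _ _ hp.2 ht
      · rw [State.goto, Function.update_of_ne hne] at hp
        exact ih hp ht
    revert h
    refine step_cases (motive := fun st' : State C P s => st'.proc p = some (v, .cas t i k) →
      k ≤ C.kappa) (fun h => ih h ht) ?_ ?_ ?_ ?_ ?_ ?_ ?_ ?_ ?_ ?_
    · exact fun _ _ => goto _ _ (by simp)
    · exact fun _ _ => goto _ _ (by simp)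
    · exact fun _ _ _ _ _ _ => goto _ _ (by simp)
    · refine fun _ _ _ _ _ _ => goto _ _ ?_
      rintro t i k h _
      cases h
      exact Nat.zero_le _
    · exact fun _ _ _ _ _ _ => goto _ _ (by simp)
    · refine fun _ _ _ _ _ => goto _ _ ?_
      rintro t i k h _
      cases h
      exact Nat.zero_le _
    · exact fun _ _ _ => goto _ _ (by simp)
    · intro w u x m _ _ hp
      have hne : p ≠ q := by rintro rfl; simp at hp
      simp only [Function.update_of_ne hne] at hp
      exact ih hp ht
    · exact fun _ _ _ _ _ _ _ _ => goto _ _ (by simp)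
    · refine fun w u x m _ _ hn => goto _ _ ?_
      rintro t i k h ht
      cases h
      by_contra hk
      exact hn ⟨by omega, ht⟩

/-- If the last chunk has room for all elements, then the number of instructions of a call is
bounded, whatever the random choices and the schedule are. -/
theorem instrs_le_of_lt_size (ω : Tape C s) (l : List (Fin P)) (hs : s < C.size C.last)
    (v : Fin s) :
    (run ω l).instrs v ≤ 1 + (C.last + 1) * (C.kappa + C.size C.last + 5) := by
  refine ((instrs_le ω l (C.kappa + C.size C.last) ?_).2 v).trans ?_
  · intro l' _ p v t i k h
    rcases Nat.lt_or_ge t.val C.last with ht | ht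
    · exact (probes_le_kappa ω l' h ht).trans (Nat.le_add_right _ _)
    · have h1 : t.val = C.last := by have := t.isLt; omega
      have h2 := probes_lt_size ω l' h (by rw [h1]; exact (attempts_le ω l' t).trans_lt hs)
      rw [h1] at h2
      omega
  · have := (run ω l).mem.r.isLt
    exact Nat.add_le_add_left (Nat.mul_le_mul_right _ (by omega)) _

/-! ### Typical random choices -/

/-- Random choices for which the first `few t` attempts in chunk `t` have fewer than `sigma`
samples, the first `many t` have at least `sigma`, and the first `min s (most t)` overload no run
of `kappa` or more slots. -/
structure Typical (few many most : C.Chunk → ℕ) (ω : Tape C s) : Prop where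
  few : ∀ t, t.val < C.last → hits ω t (sampled C t) (few t) < C.sigma
  many : ∀ t, t.val < C.last → many t ≤ s → C.sigma ≤ hits ω t (sampled C t) (many t)
  spread : ∀ (t : C.Chunk) x len, C.kappa ≤ len → len < C.size t →
    hits ω t (hashedTo (slotRun x len)) (min s (most t)) < len

/-- The relation between the parameters that makes a parallel insertion efficient for typical random
choices. -/
structure Suitable (C : Config) (P s D : ℕ) (many most : C.Chunk → ℕ) : Prop where
  sigma_pos : 0 < C.sigma
  many_add_le : ∀ t, t.val < C.last → many t + 2 * (P * D + 1) + P ≤ most t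
  le_most_last : ∀ t : C.Chunk, t.val = C.last → s ≤ most t
  most_lt : ∀ t, most t < C.size t

section
variable {D : ℕ} {few many most : C.Chunk → ℕ} {ω : Tape C s} {l : List (Fin P)}

/-- If `many t ≤ s`, enough samples occur among the first `many t` attempts and synchronization
limits the rest; if `many t > s`, the trivial bound `s` is already below `most t`. The last chunk is
never given up, so there the capacity for all `s` elements is needed. -/
theorem Typical.attempts_le (hω : Typical few many most ω) (hS : Suitable C P s D many most)
    (hl : LooselySynchronized D ω l) (t : C.Chunk) : (run ω l).attempts t ≤ min s (most t) := by
  have hs := HashBag.attempts_le ω l t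
  refine le_min hs ?_
  rcases Nat.lt_or_ge t.val C.last with ht | ht
  · have h1 := hS.many_add_le t ht
    by_cases hm : many t ≤ s
    · exact (attempts_le_of_sampled hl hS.sigma_pos ht (hω.many t ht hm)).trans h1
    · omega
  · exact hs.trans (hS.le_most_last t (by have := t.isLt; omega))

theorem Typical.attempts_lt_size (hω : Typical few many most ω)
    (hS : Suitable C P s D many most) (hl : LooselySynchronized D ω l) (t : C.Chunk) :
    (run ω l).attempts t < C.size t :=
  ((hω.attempts_le hS hl t).trans (min_le_right _ _)).trans_lt (hS.most_lt t)

theorem Typical.probes_le (hω : Typical few many most ω) (hS : Suitable C P s D many most)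
    (hl : LooselySynchronized D ω l) {p : Fin P} {v : Fin s} {t : C.Chunk}
    {i : Fin (C.size t)} {k : ℕ} (h : (run ω l).proc p = some (v, .cas t i k)) :
    k ≤ C.kappa ∧ ((run ω l).mem.bag (C.start t + i) ≠ none → k < C.kappa) :=
  HashBag.probes_le ω l h (hω.attempts_lt_size hS hl t) (hω.attempts_le hS hl t)
    (hω.spread t)

theorem Typical.instrs_le (hω : Typical few many most ω) (hS : Suitable C P s D many most)
    (hl : LooselySynchronized D ω l) (v : Fin s) :
    (run ω l).instrs v ≤ 1 + ((run ω l).mem.r + 1) * (C.kappa + 5) :=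
  (HashBag.instrs_le ω l C.kappa fun _ hl' _ _ _ _ _ h =>
    (hω.probes_le hS (hl.of_prefix hl') h).1).2 v

/-- Chunks are given up only after many insertions. -/
theorem Typical.few_lt (hω : Typical few many most ω) (hS : Suitable C P s D many most)
    (hl : LooselySynchronized D ω l) {t : C.Chunk} (ht : t.val < (run ω l).mem.r) :
    few t < s := by
  -- The probe limit is never exceeded for typical choices, so a chunk that was left has a counter
  -- of at least `sigma`.
  have h1 := sigma_le_sample ω l (fun l' hl' p v t i k h =>
    (hω.probes_le hS (hl.of_prefix hl') h).2) t (.inl ht)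
  have h2 := sample_add ω l t
  have h3 := hω.few t (by have := (run ω l).mem.r.isLt; omega)
  have h4 := HashBag.attempts_le ω l t
  by_contra! hle
  have h5 := hits_mono ω t (sampled C t) (h4.trans hle)
  omega

/-- Replaces the attempts and failures of the execution in `State.Accounted.work` by bounds from the
tape; chunks beyond `r` contribute nothing. The schedule survives only in the range of chunks. -/
theorem Typical.sum_instrs_le (hω : Typical few many most ω) (hS : Suitable C P s D many most)
    (hl : LooselySynchronized D ω l) :
    ∑ v, (run ω l).instrs v ≤ 2 * s + ∑ t ∈ Finset.univ.filter (fun t => t ≤ (run ω l).mem.r),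
      (5 * min s (most t) + excess ω t (min s (most t))) := by
  obtain ⟨fails, hacc⟩ := exists_accounted ω l
  have h1 := hacc.work
  have h2 := (consistent_run ω l).started_le
  have h3 : ∀ t ∉ Finset.univ.filter (fun t => t ≤ (run ω l).mem.r), (run ω l).attempts t = 0 := by
    intro t ht
    by_contra h0
    exact ht (Finset.mem_filter.2 ⟨Finset.mem_univ t, (confined_run ω l).attempts t h0⟩)
  have h4 : ∑ t, (run ω l).attempts t
      = ∑ t ∈ Finset.univ.filter (fun t => t ≤ (run ω l).mem.r), (run ω l).attempts t :=
    (Finset.sum_subset (Finset.subset_univ _) fun t _ ht => h3 t ht).symm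
  have h5 : ∑ t, ∑ x, fails t x
      = ∑ t ∈ Finset.univ.filter (fun t => t ≤ (run ω l).mem.r), ∑ x, fails t x :=
    (Finset.sum_subset (Finset.subset_univ _) fun t _ ht =>
      sum_fails_eq_zero hacc (h3 t ht)).symm
  rw [h4, h5, Finset.mul_sum, add_assoc, ← Finset.sum_add_distrib] at h1
  have h6 := Finset.sum_le_sum fun t (_ : t ∈ Finset.univ.filter
    (fun t => t ≤ (run ω l).mem.r)) => Nat.add_le_add
      (Nat.mul_le_mul_left 5 (hω.attempts_le hS hl t))
      (hacc.sum_fails_le (hω.attempts_lt_size hS hl t) (hω.attempts_le hS hl t))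
  omega

end

/-! ### The law of the tape -/

/-- The law of the random choices of an attempt in chunk `t`. -/
noncomputable def attemptLaw (C : Config) (α : ℝ) (t : ℕ) : Measure (Bool × Fin (C.size t)) :=
  (bernoulliMeasure true false
    (Set.projIcc (0 : ℝ) 1 zero_le_one ((C.sigma / α) / (C.size t : ℝ)))).prod
  (uniformOn Set.univ)

theorem tapeLaw_eq (C : Config) (α : ℝ) (s : ℕ) :
    tapeLaw C α s = Measure.pi fun t : C.Chunk => Measure.pi fun _ : Fin s => attemptLaw C α t := rfl

theorem isProbabilityMeasure_attemptLaw (hlam : 0 < C.lam) (α : ℝ) (t : ℕ) :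
    IsProbabilityMeasure (attemptLaw C α t) := by
  have : Nonempty (Fin (C.size t)) := ⟨⟨0, size_pos hlam t⟩⟩
  unfold attemptLaw
  infer_instance

theorem isProbabilityMeasure_tapeLaw (hlam : 0 < C.lam) (α : ℝ) (s : ℕ) :
    IsProbabilityMeasure (tapeLaw C α s) := by
  have := isProbabilityMeasure_attemptLaw (C := C) hlam α
  rw [tapeLaw_eq]
  infer_instance

theorem attemptLaw_sampled (hlam : 0 < C.lam) {α : ℝ} (hα : 0 < α) {t : ℕ}
    (h : (C.sigma : ℝ) ≤ α * C.size t) :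
    (attemptLaw C α t).real (sampled C t) = C.sigma / (α * C.size t) := by
  have hne : Nonempty (Fin (C.size t)) := ⟨⟨0, size_pos hlam t⟩⟩
  have hsize : (0 : ℝ) < C.size t := by exact_mod_cast size_pos hlam t
  have hset : (sampled C t : Set (Bool × Fin (C.size t))) = {true} ×ˢ Set.univ := by
    ext x; simp [sampled]
  have hle : C.sigma / α / C.size t ≤ 1 := by
    rw [div_div, div_le_one (by positivity)]; exact h
  rw [hset, attemptLaw, measureReal_prod_prod, probReal_univ, mul_one,
    bernoulliMeasure_real_apply_of_mem_of_notMem _ (by simp) (by simp) (by simp),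
    Set.projIcc_of_mem zero_le_one ⟨by positivity, hle⟩]
  simp [div_div]

theorem attemptLaw_hashedTo (α : ℝ) {t : ℕ} (I : Finset (Fin (C.size t))) :
    (attemptLaw C α t).real (hashedTo I) = I.card / C.size t := by
  have hset : (hashedTo I : Set (Bool × Fin (C.size t))) = Set.univ ×ˢ (I : Set _) := by
    ext x; simp [hashedTo]
  rw [hset, attemptLaw, measureReal_prod_prod, probReal_univ, one_mul, measureReal_def,
    uniformOn_univ, Measure.count_apply_finset]
  simp

/-! ### Moments and tails of the number of hits -/

theorem pow_hits (ω : Tape C s) (t : C.Chunk) (B : Finset (Bool × Fin (C.size t))) (a : ℕ) (z : ℝ) :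
    z ^ hits ω t B a = ∏ j : Fin s, if j.val < a ∧ ω t j ∈ B then z else 1 := by
  rw [hits, Finset.prod_ite, Finset.prod_const_one, mul_one, Finset.prod_const]

theorem card_lt_min (s a : ℕ) :
    (Finset.univ.filter fun j : Fin s => j.val < a).card = min s a := by
  rw [Fin.card_filter_val_lt]

/-- The generating function of a binomial variable with `min s a` trials: `z ^ hits` is a product of
functions of the separate, independent tape entries of chunk `t`. -/
theorem integral_pow_hits (hlam : 0 < C.lam) (α : ℝ) (t : C.Chunk)
    (B : Finset (Bool × Fin (C.size t))) (a : ℕ) (z : ℝ) :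
    ∫ ω, z ^ hits ω t B a ∂(tapeLaw C α s)
      = (1 + (attemptLaw C α t).real B * (z - 1)) ^ min s a := by
  have := isProbabilityMeasure_attemptLaw (C := C) hlam α
  set f : Fin s → Bool × Fin (C.size t) → ℝ := fun j x => if j.val < a ∧ x ∈ B then z else 1
    with hf
  have h1 : ∫ ω, z ^ hits ω t B a ∂(tapeLaw C α s)
      = ∫ x, ∏ j : Fin s, f j (x j) ∂(Measure.pi fun _ : Fin s => attemptLaw C α t) := by
    rw [tapeLaw_eq, ← (measurePreserving_eval (fun t : C.Chunk => Measure.pi fun _ : Fin s =>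
      attemptLaw C α t) t).map_eq, integral_map (measurable_pi_apply t).aemeasurable
        (measurable_of_finite _).aestronglyMeasurable]
    simp only [pow_hits, hf, Function.eval]
  rw [h1, integral_fintype_prod_eq_prod]
  have h2 : ∀ j : Fin s, ∫ x, f j x ∂(attemptLaw C α t)
      = if j.val < a then 1 + (attemptLaw C α t).real B * (z - 1) else 1 := by
    intro j
    by_cases hj : j.val < a
    · have h3 : f j = fun x => 1 + (B : Set (Bool × Fin (C.size t))).indicator
          (fun _ => z - 1) x := by
        funext x
        simp only [hf, hj, true_and, Set.indicator_apply, Finset.mem_coe]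
        split_ifs <;> ring
      rw [h3, integral_add (integrable_const _) .of_finite,
        integral_indicator_const _ B.measurableSet]
      simp [hj]
    · simp [hf, hj]
  rw [Finset.prod_congr rfl fun j _ => h2 j, Finset.prod_ite, Finset.prod_const_one, mul_one,
    Finset.prod_const, card_lt_min]

theorem integral_pow_hits_le (hlam : 0 < C.lam) (α : ℝ) (t : C.Chunk)
    (B : Finset (Bool × Fin (C.size t))) (a : ℕ) {z : ℝ} (hz : 0 ≤ z) :
    ∫ ω, z ^ hits ω t B a ∂(tapeLaw C α s)
      ≤ Real.exp ((attemptLaw C α t).real B * min s a * (z - 1)) := by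
  have := isProbabilityMeasure_attemptLaw (C := C) hlam α t
  rw [integral_pow_hits hlam]
  have h0 : (attemptLaw C α t).real B ≤ 1 := measureReal_le_one
  have h1 : 0 ≤ (attemptLaw C α t).real B := measureReal_nonneg
  refine (pow_le_pow_left₀ (by nlinarith)
    ((add_comm _ _).trans_le (Real.add_one_le_exp _)) _).trans_eq ?_
  rw [← Real.exp_nat_mul]
  congr 1
  push_cast
  ring

/-- Chernoff's bound: `u` is the ratio between a bound on the mean and the threshold `b`. -/
theorem tail_hits_le (hlam : 0 < C.lam) (α : ℝ) (t : C.Chunk)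
    (B : Finset (Bool × Fin (C.size t))) (a b : ℕ) {u : ℝ} (hu : 0 < u)
    (h : (attemptLaw C α t).real B * min s a * (1 / u - 1) ≤ u * b * (1 / u - 1)) :
    (tapeLaw C α s).real {ω | (1 / u) ^ b ≤ (1 / u) ^ hits ω t B a}
      ≤ (u * Real.exp (1 - u)) ^ b := by
  have := isProbabilityMeasure_tapeLaw (C := C) hlam α s
  -- Markov's inequality for `z ^ hits` with `z = 1 / u`. Keeping the factor `1 / u - 1` in the
  -- hypothesis lets its sign decide which tail is obtained.
  have h1 := mul_meas_ge_le_integral_of_nonneg (μ := tapeLaw C α s)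
    (f := fun ω => (1 / u) ^ hits ω t B a)
    (ae_of_all _ fun ω => by positivity) .of_finite ((1 / u) ^ b)
  have h2 := h1.trans (integral_pow_hits_le hlam α t B a (z := 1 / u) (by positivity))
  have h3 : Real.exp ((attemptLaw C α t).real B * min s a * (1 / u - 1))
      ≤ Real.exp (1 - u) ^ b := by
    rw [← Real.exp_nat_mul]
    refine Real.exp_le_exp.2 (h.trans_eq ?_)
    field_simp
  have h4 := h2.trans h3
  have h5 : (1 / u) ^ b = (u ^ b)⁻¹ := by rw [one_div, inv_pow]
  rw [h5, inv_mul_le_iff₀ (by positivity), ← mul_pow] at h4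
  rwa [h5]

theorem upper_tail_hits_le (hlam : 0 < C.lam) (α : ℝ) (t : C.Chunk)
    (B : Finset (Bool × Fin (C.size t))) (a b : ℕ) {u : ℝ} (hu : 0 < u) (hu1 : u < 1)
    (h : (attemptLaw C α t).real B * min s a ≤ u * b) :
    (tapeLaw C α s).real {ω | b ≤ hits ω t B a} ≤ (u * Real.exp (1 - u)) ^ b := by
  have := isProbabilityMeasure_tapeLaw (C := C) hlam α s
  have h1 : 1 ≤ 1 / u := (one_le_div hu).2 hu1.le
  refine le_trans (measureReal_mono fun ω hω => ?_)
    (tail_hits_le hlam α t B a b hu (mul_le_mul_of_nonneg_right h (by linarith)))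
  exact pow_le_pow_right₀ h1 hω

theorem lower_tail_hits_le (hlam : 0 < C.lam) (α : ℝ) (t : C.Chunk)
    (B : Finset (Bool × Fin (C.size t))) (a b : ℕ) {u : ℝ} (hu1 : 1 < u)
    (h : u * b ≤ (attemptLaw C α t).real B * min s a) :
    (tapeLaw C α s).real {ω | hits ω t B a < b} ≤ (u * Real.exp (1 - u)) ^ b := by
  have := isProbabilityMeasure_tapeLaw (C := C) hlam α s
  have hu : 0 < u := by linarith
  have h1 : 1 / u ≤ 1 := (div_le_one hu).2 hu1.le
  refine le_trans (measureReal_mono fun ω hω => ?_)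
    (tail_hits_le hlam α t B a b hu (mul_le_mul_of_nonpos_right h (by linarith)))
  exact pow_le_pow_of_le_one (by positivity) h1 (le_of_lt hω)

theorem mul_exp_one_sub_lt_one {u : ℝ} (h : u ≠ 1) : u * Real.exp (1 - u) < 1 := by
  have h1 := Real.add_one_lt_exp (x := u - 1) (sub_ne_zero.2 h)
  rw [sub_add_cancel] at h1
  rw [show (1 : ℝ) - u = -(u - 1) by ring, Real.exp_neg]
  exact (mul_inv_lt_iff₀ (Real.exp_pos _)).2 (by linarith)

/-! ### The expected excess -/

/-- For `n ≥ b` this is Bernoulli's inequality for `(1 / u) ^ (n - b)`. The `- 1` makes the bound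
vanish at `n = 0`, so that its expectation will be proportional to the mean of `n`. -/
theorem natCast_sub_le_mul (n b : ℕ) {u : ℝ} (hu : 0 < u) (hu1 : u < 1) :
    ((n - b : ℕ) : ℝ) ≤ u ^ b * ((1 / u) ^ n - 1) / (1 / u - 1) := by
  have h1 : 1 < 1 / u := (one_lt_div hu).2 hu1
  rw [le_div_iff₀ (by linarith)]
  have h2 : u ^ b ≤ 1 := pow_le_one₀ hu.le hu1.le
  rcases le_total n b with h | h
  · rw [Nat.sub_eq_zero_of_le h]
    have := one_le_pow₀ (n := n) h1.le
    simp only [Nat.cast_zero, zero_mul]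
    exact mul_nonneg (by positivity) (by linarith)
  · obtain ⟨d, rfl⟩ := Nat.exists_eq_add_of_le h
    have h3 : u ^ b * ((1 / u) ^ (b + d) - 1) = (1 / u) ^ d - u ^ b := by
      rw [pow_add, mul_sub, ← mul_assoc, ← mul_pow, mul_one_div_cancel hu.ne', one_pow, one_mul,
        mul_one]
    rw [Nat.add_sub_cancel_left, h3]
    have := one_add_mul_le_pow (a := 1 / u - 1) (by linarith) d
    rw [add_sub_cancel] at this
    linarith

/-- The estimate `exp v - 1 ≤ v * exp v` keeps the mean as a factor. Without this factor the sum
over all runs would be linear in the chunk size and not in the number of attempts. -/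
theorem integral_hits_sub_le (hlam : 0 < C.lam) (α : ℝ) (t : C.Chunk)
    (B : Finset (Bool × Fin (C.size t))) (a b : ℕ) {u : ℝ} (hu : 0 < u) (hu1 : u < 1)
    (h : (attemptLaw C α t).real B * min s a ≤ u * b) :
    ∫ ω, ((hits ω t B a - b : ℕ) : ℝ) ∂(tapeLaw C α s)
      ≤ (attemptLaw C α t).real B * min s a * (u * Real.exp (1 - u)) ^ b := by
  have := isProbabilityMeasure_tapeLaw (C := C) hlam α s
  set y := (attemptLaw C α t).real B * min s a with hy
  have hy0 : 0 ≤ y := by positivity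
  have h1 : 0 < 1 / u - 1 := by rw [sub_pos]; exact (one_lt_div hu).2 hu1
  have h2 : ∫ ω, ((hits ω t B a - b : ℕ) : ℝ) ∂(tapeLaw C α s)
      ≤ ∫ ω, u ^ b * ((1 / u) ^ hits ω t B a - 1) / (1 / u - 1) ∂(tapeLaw C α s) :=
    integral_mono .of_finite .of_finite fun ω => natCast_sub_le_mul _ _ hu hu1
  refine h2.trans ?_
  rw [integral_div, integral_const_mul, integral_sub .of_finite .of_finite, integral_const,
    probReal_univ, one_smul]
  have h3 := integral_pow_hits_le (s := s) hlam α t B a (z := 1 / u) (by positivity)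
  rw [← hy] at h3
  have h4 : Real.exp (y * (1 / u - 1)) - 1 ≤ y * (1 / u - 1) * Real.exp (1 - u) ^ b := by
    have h5 := Real.add_one_le_exp (-(y * (1 / u - 1)))
    have h6 : Real.exp (y * (1 / u - 1)) ≤ Real.exp (1 - u) ^ b := by
      rw [← Real.exp_nat_mul]
      refine Real.exp_le_exp.2 ((mul_le_mul_of_nonneg_right h h1.le).trans_eq ?_)
      field_simp
    have h7 : Real.exp (y * (1 / u - 1)) - 1
        ≤ y * (1 / u - 1) * Real.exp (y * (1 / u - 1)) := by
      have h8 := mul_le_mul_of_nonneg_right h5 (Real.exp_pos (y * (1 / u - 1))).le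
      rw [← Real.exp_add, neg_add_cancel, Real.exp_zero] at h8
      linarith
    exact h7.trans (mul_le_mul_of_nonneg_left h6 (by positivity))
  rw [div_le_iff₀ h1, mul_pow]
  calc u ^ b * (∫ ω, (1 / u) ^ hits ω t B a ∂(tapeLaw C α s) - 1)
      ≤ u ^ b * (y * (1 / u - 1) * Real.exp (1 - u) ^ b) :=
        mul_le_mul_of_nonneg_left (by linarith) (by positivity)
    _ = _ := by ring

theorem sum_mul_geometric_le {r : ℝ} (h0 : 0 ≤ r) (h1 : r < 1) (S : Finset ℕ) :
    ∑ n ∈ S, (n : ℝ) * r ^ n ≤ r / (1 - r) ^ 2 := by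
  have h := hasSum_coe_mul_geometric_of_norm_lt_one (r := r)
    (by rwa [Real.norm_of_nonneg h0])
  exact sum_le_hasSum S (fun n _ => by positivity) h

/-- The expected excess is linear in the number of attempts, at load factor `u < 1`. -/
theorem integral_excess_le (hlam : 0 < C.lam) (α : ℝ) (t : C.Chunk) (a : ℕ) {u : ℝ}
    (hu : 0 < u) (hu1 : u < 1) (h : ((min s a : ℕ) : ℝ) ≤ u * C.size t) :
    ∫ ω, (excess ω t a : ℝ) ∂(tapeLaw C α s)
      ≤ (u * Real.exp (1 - u) / (1 - u * Real.exp (1 - u)) ^ 2) * (min s a : ℕ) := by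
  have := isProbabilityMeasure_tapeLaw (C := C) hlam α s
  have hsize : (0 : ℝ) < C.size t := by exact_mod_cast size_pos hlam t
  set r := u * Real.exp (1 - u) with hr
  have hr0 : 0 ≤ r := by positivity
  have hr1 : r < 1 := mul_exp_one_sub_lt_one hu1.ne
  -- The mean number of hits in a run of length `len` is at most `len * min s a / size`, hence at
  -- most `u * len`. Summing over `len` gives a convergent series, and the sum over the starting
  -- slots cancels `1 / size`.
  have hterm : ∀ x : Fin (C.size t), ∀ len : ℕ,
      ∫ ω, ((hits ω t (hashedTo (slotRun x len)) a - len : ℕ) : ℝ) ∂(tapeLaw C α s)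
        ≤ (min s a : ℕ) / C.size t * (len * r ^ len) := by
    intro x len
    have hq : (attemptLaw C α t).real (hashedTo (slotRun x len)) ≤ len / C.size t := by
      rw [attemptLaw_hashedTo]
      gcongr
      exact card_slotRun_le x len
    have hqm : (attemptLaw C α t).real (hashedTo (slotRun x len)) * min s a
        ≤ len / C.size t * (min s a : ℕ) := by
      push_cast
      gcongr
    refine (integral_hits_sub_le hlam α t _ a len hu hu1 (hqm.trans ?_)).trans ?_
    · calc (len : ℝ) / C.size t * (min s a : ℕ) ≤ len / C.size t * (u * C.size t) := by gcongr
        _ = u * len := by field_simp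
    · calc _ ≤ len / C.size t * (min s a : ℕ) * r ^ len :=
          mul_le_mul_of_nonneg_right hqm (by positivity)
        _ = _ := by ring
  simp only [excess, Nat.cast_sum]
  rw [integral_finsetSum _ fun _ _ => .of_finite]
  have hx : ∀ x : Fin (C.size t), ∫ ω, ∑ len ∈ Finset.Ico 1 (C.size t),
      ((hits ω t (hashedTo (slotRun x len)) a - len : ℕ) : ℝ) ∂(tapeLaw C α s)
        ≤ (min s a : ℕ) / C.size t * (r / (1 - r) ^ 2) := by
    intro x
    rw [integral_finsetSum _ fun _ _ => .of_finite]
    refine (Finset.sum_le_sum fun len _ => hterm x len).trans ?_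
    rw [← Finset.mul_sum]
    exact mul_le_mul_of_nonneg_left (sum_mul_geometric_le hr0 hr1 _) (by positivity)
  refine (Finset.sum_le_sum fun x _ => hx x).trans_eq ?_
  rw [Finset.sum_const, Finset.card_univ, Fintype.card_fin, nsmul_eq_mul]
  field_simp

/-! ### Typical random choices are likely -/

/-- The numbers of attempts in a chunk at load factors `a / 2`, `b` and `d`. -/
noncomputable def fewAttempts (C : Config) (a : ℝ) (t : C.Chunk) : ℕ := ⌊a * C.size t / 2⌋₊

noncomputable def manyAttempts (C : Config) (b : ℝ) (t : C.Chunk) : ℕ := ⌈b * C.size t⌉₊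

noncomputable def mostAttempts (C : Config) (d : ℝ) (t : C.Chunk) : ℕ := ⌊d * C.size t⌋₊

/-- The mean number of samples is at most half the threshold, so Chernoff's bound applies with `u =
1 / 2`. -/
theorem prob_not_few_le (hlam : 0 < C.lam) {α : ℝ} (hα : 0 < α) (t : C.Chunk)
    (hσ : (C.sigma : ℝ) ≤ α * C.size t) :
    (tapeLaw C α s).real {ω | C.sigma ≤ hits ω t (sampled C t) (fewAttempts C α t)}
      ≤ (1 / 2 * Real.exp (1 - 1 / 2)) ^ C.sigma := by
  have hsize : (0 : ℝ) < C.size t := by exact_mod_cast size_pos hlam t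
  refine upper_tail_hits_le hlam α t _ _ _ (by norm_num) (by norm_num) ?_
  rw [attemptLaw_sampled hlam hα hσ]
  have h1 : ((fewAttempts C α t : ℕ) : ℝ) ≤ α * C.size t / 2 := Nat.floor_le (by positivity)
  push_cast
  calc (C.sigma : ℝ) / (α * C.size t) * min (s : ℝ) (fewAttempts C α t : ℕ)
      ≤ C.sigma / (α * C.size t) * (α * C.size t / 2) := by
        gcongr
        exact (min_le_right _ _).trans h1
    _ = 1 / 2 * C.sigma := by field_simp

/-- The mean number of samples is at least `α₁ / α > 1` times the threshold. With fewer than `many`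
attempts on the tape there is nothing to require. -/
theorem prob_not_many_le (hlam : 0 < C.lam) {α α₁ : ℝ} (hα : 0 < α) (hα₁ : α < α₁)
    (t : C.Chunk) (hσ : (C.sigma : ℝ) ≤ α * C.size t) :
    (tapeLaw C α s).real {ω | manyAttempts C α₁ t ≤ s ∧
        hits ω t (sampled C t) (manyAttempts C α₁ t) < C.sigma}
      ≤ (α₁ / α * Real.exp (1 - α₁ / α)) ^ C.sigma := by
  have := isProbabilityMeasure_tapeLaw (C := C) hlam α s
  have hsize : (0 : ℝ) < C.size t := by exact_mod_cast size_pos hlam t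
  have hα₁0 : 0 < α₁ := hα.trans hα₁
  by_cases hm : manyAttempts C α₁ t ≤ s
  · simp only [hm, true_and]
    refine lower_tail_hits_le hlam α t _ _ _ ((one_lt_div hα).2 hα₁) ?_
    rw [attemptLaw_sampled hlam hα hσ]
    have h1 : α₁ * C.size t ≤ ((manyAttempts C α₁ t : ℕ) : ℝ) := Nat.le_ceil _
    rw [min_eq_right hm]
    calc α₁ / α * C.sigma = C.sigma / (α * C.size t) * (α₁ * C.size t) := by field_simp
      _ ≤ _ := by gcongr
  · simp only [hm, false_and, Set.ofPred_false, measureReal_empty]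
    positivity

theorem prob_overload_le (hlam : 0 < C.lam) (α : ℝ) {β : ℝ} (hβ : 0 < β) (hβ1 : β < 1)
    (t : C.Chunk) (x : Fin (C.size t)) (len : ℕ) :
    (tapeLaw C α s).real
        {ω | len ≤ hits ω t (hashedTo (slotRun x len)) (min s (mostAttempts C β t))}
      ≤ (β * Real.exp (1 - β)) ^ len := by
  have hsize : (0 : ℝ) < C.size t := by exact_mod_cast size_pos hlam t
  refine upper_tail_hits_le hlam α t _ _ _ hβ hβ1 ?_
  rw [attemptLaw_hashedTo]
  have h1 : ((mostAttempts C β t : ℕ) : ℝ) ≤ β * C.size t := Nat.floor_le (by positivity)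
  have h2 : ((slotRun x len).card : ℝ) ≤ len := by exact_mod_cast card_slotRun_le x len
  push_cast
  calc ((slotRun x len).card : ℝ) / C.size t * min (s : ℝ) (min (s : ℝ) (mostAttempts C β t : ℕ))
      ≤ len / C.size t * (β * C.size t) := by
        gcongr
        exact (min_le_right _ _).trans ((min_le_right _ _).trans h1)
    _ = β * len := by field_simp

/-- A union bound over chunks, end slots and run lengths, each at most `capacity` in number. The
common base `ρ` dominates the three Chernoff bases. -/
theorem prob_not_typical_le (hlam : 0 < C.lam) {α α₁ β ρ q : ℝ} (hα : 0 < α) (hα₁ : α < α₁)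
    (hβ : 0 < β) (hβ1 : β < 1) (hσ : (C.sigma : ℝ) ≤ α * C.lam)
    (h0 : 1 / 2 * Real.exp (1 - 1 / 2) ≤ ρ) (h1 : α₁ / α * Real.exp (1 - α₁ / α) ≤ ρ)
    (h2 : β * Real.exp (1 - β) ≤ ρ) (hρ : ρ ≤ 1) (hqσ : ρ ^ C.sigma ≤ q)
    (hqκ : ρ ^ C.kappa ≤ q) :
    (tapeLaw C α s).real {ω | ¬ Typical (fewAttempts C α) (manyAttempts C α₁)
        (mostAttempts C β) ω} ≤ 3 * (C.capacity : ℝ) ^ 3 * q := by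
  have := isProbabilityMeasure_tapeLaw (C := C) hlam α s
  have hα₁0 : 0 < α₁ := hα.trans hα₁
  have hρ0 : 0 ≤ ρ := le_trans (by positivity) h0
  have hq0 : 0 ≤ q := le_trans (by positivity) hqσ
  have hsσ : ∀ t : C.Chunk, (C.sigma : ℝ) ≤ α * C.size t := fun t => hσ.trans (by
    gcongr
    exact_mod_cast Nat.le_mul_of_pos_right _ (by positivity))
  have hcap1 : C.last + 1 ≤ C.capacity := succ_le_tail hlam _
  have hcap : (1 : ℝ) ≤ C.capacity := by exact_mod_cast (by omega : 1 ≤ C.capacity)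
  have hsize : ∀ t : C.Chunk, C.size t ≤ C.capacity := fun t =>
    (size_mono C (Nat.lt_succ_iff.1 t.isLt)).trans (Nat.le_add_left _ _)
  have hsub : {ω : Tape C s | ¬ Typical (fewAttempts C α) (manyAttempts C α₁)
      (mostAttempts C β) ω} ⊆ ⋃ t : C.Chunk,
        ({ω | C.sigma ≤ hits ω t (sampled C t) (fewAttempts C α t)} ∪
          {ω | manyAttempts C α₁ t ≤ s ∧
            hits ω t (sampled C t) (manyAttempts C α₁ t) < C.sigma}) ∪
        ⋃ x : Fin (C.size t), ⋃ len ∈ Finset.Ico C.kappa (C.size t),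
          {ω | len ≤ hits ω t (hashedTo (slotRun x len)) (min s (mostAttempts C β t))} := by
    intro ω hω
    by_contra hn
    simp only [Set.mem_iUnion, Set.mem_union, Set.mem_ofPred_eq, not_exists, not_or, not_and,
      not_le, not_lt, Finset.mem_Ico] at hn
    exact hω ⟨fun t _ => (hn t).1.1, fun t _ hm => (hn t).1.2 hm,
      fun t x len hl hl' => (hn t).2 x len ⟨hl, hl'⟩⟩
  refine (measureReal_mono hsub).trans ((measureReal_iUnion_fintype_le _).trans ?_)
  have hterm : ∀ t : C.Chunk, (tapeLaw C α s).real
        (({ω | C.sigma ≤ hits ω t (sampled C t) (fewAttempts C α t)} ∪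
          {ω | manyAttempts C α₁ t ≤ s ∧
            hits ω t (sampled C t) (manyAttempts C α₁ t) < C.sigma}) ∪
        ⋃ x : Fin (C.size t), ⋃ len ∈ Finset.Ico C.kappa (C.size t),
          {ω | len ≤ hits ω t (hashedTo (slotRun x len)) (min s (mostAttempts C β t))})
      ≤ 3 * (C.capacity : ℝ) ^ 2 * q := by
    intro t
    have e1 := (prob_not_few_le (s := s) hlam hα t (hsσ t)).trans
      ((pow_le_pow_left₀ (by positivity) h0 _).trans hqσ)
    have e2 := (prob_not_many_le (s := s) hlam hα hα₁ t (hsσ t)).trans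
      ((pow_le_pow_left₀ (by positivity) h1 _).trans hqσ)
    have e3 : (tapeLaw C α s).real (⋃ x : Fin (C.size t), ⋃ len ∈ Finset.Ico C.kappa (C.size t),
          {ω | len ≤ hits ω t (hashedTo (slotRun x len)) (min s (mostAttempts C β t))})
        ≤ (C.capacity : ℝ) ^ 2 * q := by
      have e4 : ∀ x : Fin (C.size t), (tapeLaw C α s).real
          (⋃ len ∈ Finset.Ico C.kappa (C.size t),
            {ω | len ≤ hits ω t (hashedTo (slotRun x len)) (min s (mostAttempts C β t))})
          ≤ C.capacity * q := by
        intro x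
        refine (measureReal_biUnion_finset_le _ _).trans
          ((Finset.sum_le_card_nsmul _ _ q fun len hlen => ?_).trans ?_)
        · refine (prob_overload_le hlam α hβ hβ1 t x len).trans
            ((pow_le_pow_left₀ (by positivity) h2 _).trans ?_)
          exact (pow_le_pow_of_le_one hρ0 hρ (Finset.mem_Ico.1 hlen).1).trans hqκ
        · rw [nsmul_eq_mul, Nat.card_Ico]
          gcongr
          exact (Nat.sub_le _ _).trans (hsize t)
      refine (measureReal_iUnion_fintype_le _).trans
        ((Finset.sum_le_card_nsmul _ _ _ fun x _ => e4 x).trans ?_)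
      rw [nsmul_eq_mul, Finset.card_univ, Fintype.card_fin, pow_two, mul_assoc]
      gcongr
      exact hsize t
    have e5 : q ≤ (C.capacity : ℝ) ^ 2 * q := le_mul_of_one_le_left hq0 (one_le_pow₀ hcap)
    have e6 := measureReal_union_le (μ := tapeLaw C α s)
      ({ω | C.sigma ≤ hits ω t (sampled C t) (fewAttempts C α t)} ∪
          {ω | manyAttempts C α₁ t ≤ s ∧
            hits ω t (sampled C t) (manyAttempts C α₁ t) < C.sigma})
      (⋃ x : Fin (C.size t), ⋃ len ∈ Finset.Ico C.kappa (C.size t),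
          {ω | len ≤ hits ω t (hashedTo (slotRun x len)) (min s (mostAttempts C β t))})
    have e7 := measureReal_union_le (μ := tapeLaw C α s)
      {ω | C.sigma ≤ hits ω t (sampled C t) (fewAttempts C α t)}
      {ω | manyAttempts C α₁ t ≤ s ∧
            hits ω t (sampled C t) (manyAttempts C α₁ t) < C.sigma}
    linarith
  refine (Finset.sum_le_card_nsmul _ _ _ fun t _ => hterm t).trans ?_
  rw [nsmul_eq_mul, Finset.card_univ, Fintype.card_fin]
  have hcap2 : ((C.last + 1 : ℕ) : ℝ) ≤ C.capacity := by exact_mod_cast hcap1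
  calc ((C.last + 1 : ℕ) : ℝ) * (3 * (C.capacity : ℝ) ^ 2 * q)
      ≤ C.capacity * (3 * (C.capacity : ℝ) ^ 2 * q) := by gcongr
    _ = _ := by ring

/-! ### Sums over the chunks in use -/

theorem sum_range_size (C : Config) (t : ℕ) :
    ∑ u ∈ Finset.range (t + 1), C.size u = C.tail t := by
  induction t with
  | zero => simp [Config.tail, Config.start]
  | succ t ih => rw [Finset.sum_range_succ, ih, tail_eq]; rfl

/-- The sizes double, so their sum is less than twice the largest one below `X`. -/
theorem sum_size_le (C : Config) {X : ℝ} (hX : 0 ≤ X) :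
    ∑ t ∈ Finset.univ.filter (fun t : C.Chunk => (C.size t : ℝ) < X), (C.size t : ℝ) ≤ 2 * X := by
  rcases (Finset.univ.filter (fun t : C.Chunk => (C.size t : ℝ) < X)).eq_empty_or_nonempty
    with h | h
  · rw [h, Finset.sum_empty]; positivity
  · obtain ⟨u, hu, hmax⟩ := Finset.exists_max_image _ (fun t : C.Chunk => t.val) h
    have h1 : ∑ t ∈ Finset.univ.filter (fun t : C.Chunk => (C.size t : ℝ) < X), C.size t
        ≤ ∑ t ∈ Finset.range (u + 1), C.size t := by
      rw [← Finset.sum_image (f := C.size) (g := fun t : C.Chunk => t.val)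
        fun a _ b _ hab => Fin.ext hab]
      refine Finset.sum_le_sum_of_subset fun t ht => ?_
      obtain ⟨t', ht', rfl⟩ := Finset.mem_image.1 ht
      exact Finset.mem_range.2 (Nat.lt_succ_of_le (hmax t' ht'))
    rw [sum_range_size] at h1
    have h2 := h1.trans (tail_le C u)
    have h3 := (Finset.mem_filter.1 hu).2
    have h4 : ((∑ t ∈ Finset.univ.filter (fun t : C.Chunk => (C.size t : ℝ) < X),
        C.size t : ℕ) : ℝ) ≤ ((2 * C.size u : ℕ) : ℝ) := by exact_mod_cast h2
    push_cast at h4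
    linarith

/-! ### Consequences for the costs -/

theorem half_le_log_two : (1 / 2 : ℝ) ≤ Real.log 2 := by
  have := Real.log_two_gt_d9
  linarith

theorem clog_two_le {n : ℕ} (h : 1 ≤ n) : (Nat.clog 2 n : ℝ) ≤ 2 * Real.log n + 1 := by
  have hlog : 0 ≤ Real.log n := Real.log_natCast_nonneg n
  rcases Nat.lt_or_ge n 2 with h2 | h2
  · rw [Nat.clog_of_right_le_one (by omega)]
    push_cast
    linarith
  · have h1 : 2 ^ (Nat.clog 2 n - 1) < n := Nat.pow_pred_clog_lt_self (by norm_num) (by omega)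
    have h3 : ((Nat.clog 2 n - 1 : ℕ) : ℝ) * Real.log 2 ≤ Real.log n := by
      rw [← Real.log_pow]
      exact Real.log_le_log (by positivity) (by exact_mod_cast h1.le)
    have h4 : (Nat.clog 2 n : ℝ) ≤ ((Nat.clog 2 n - 1 : ℕ) : ℝ) + 1 := by
      exact_mod_cast (by omega : Nat.clog 2 n ≤ Nat.clog 2 n - 1 + 1)
    have h5 := mul_le_mul_of_nonneg_left half_le_log_two
      (Nat.cast_nonneg (α := ℝ) (Nat.clog 2 n - 1))
    linarith

/-- The cost of a parallel loop over `m ≤ B * (s + lam)` slots, up to constant factors. -/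
theorem slot_loop_cost_le {work span m s lam : ℕ} {B K : ℝ} (hB : 1 ≤ B) (hs : 1 ≤ s)
    (hlam : 2 ≤ lam) (hm1 : 1 ≤ m) (hm : (m : ℝ) ≤ B * (s + lam)) (hwork : work ≤ 9 * m)
    (hspan : span ≤ 6 + 3 * Nat.clog 2 m) (hK : 100 * B ≤ K) :
    (work : ℝ) ≤ K * (s + lam) ∧ (span : ℝ) ≤ K * Real.log (s + lam) ∧
      ∀ a : ℝ, (lam : ℝ) ≤ (s : ℝ) ^ a → (span : ℝ) ≤ K * (a + 1) * Real.log s := by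
  have hs' : (1 : ℝ) ≤ s := by exact_mod_cast hs
  have hlam' : (2 : ℝ) ≤ lam := by exact_mod_cast hlam
  have hL : 1 / 2 ≤ Real.log (s + lam) :=
    half_le_log_two.trans (Real.log_le_log (by norm_num) (by linarith))
  have hlogm : Real.log m ≤ Real.log B + Real.log (s + lam) := by
    rw [← Real.log_mul (by positivity) (by positivity)]
    exact Real.log_le_log (by exact_mod_cast hm1) hm
  have hlogB : Real.log B ≤ B := (Real.log_le_sub_one_of_pos (by linarith)).trans (by linarith)
  have hsp : (span : ℝ) ≤ 36 * B * Real.log (s + lam) := by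
    have h1 : (span : ℝ) ≤ 6 + 3 * Nat.clog 2 m := by exact_mod_cast hspan
    have h2 := clog_two_le hm1
    have h3 := mul_le_mul_of_nonneg_left hL (show 0 ≤ B by linarith)
    have h4 := mul_le_mul_of_nonneg_right hB (show 0 ≤ Real.log (s + lam) by linarith)
    linarith
  refine ⟨?_, ?_, fun a ha => ?_⟩
  · have h1 : (work : ℝ) ≤ 9 * m := by exact_mod_cast hwork
    nlinarith
  · refine hsp.trans (mul_le_mul_of_nonneg_right (by linarith) (by linarith))
  -- For `s = 1` no exponent `a` qualifies, as `lam ≥ 2`.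
  · have hs2 : 2 ≤ s := by
      by_contra hlt
      obtain rfl : s = 1 := by omega
      rw [Nat.cast_one, Real.one_rpow] at ha
      linarith
    have hs2' : (2 : ℝ) ≤ s := by exact_mod_cast hs2
    have hlogs : 0 < Real.log s := Real.log_pos (by linarith)
    have ha0 : 0 < a := by
      by_contra hneg
      have := Real.rpow_le_one_of_one_le_of_nonpos hs' (not_lt.1 hneg)
      linarith
    -- Both summands are at most `s ^ (a + 1)`, which is at least 2, so their sum is at most its
    -- square.
    have h1 : Real.log (s + lam) ≤ 2 * (a + 1) * Real.log s := by
      have h2 : (s : ℝ) + lam ≤ s ^ (2 * (a + 1)) := by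
        have h3 : (s : ℝ) ≤ s ^ (a + 1) := by
          conv_lhs => rw [← Real.rpow_one (s : ℝ)]
          exact Real.rpow_le_rpow_of_exponent_le hs' (by linarith)
        have h4 : (s : ℝ) ^ a ≤ s ^ (a + 1) :=
          Real.rpow_le_rpow_of_exponent_le hs' (by linarith)
        have h5 : (s : ℝ) ^ (2 * (a + 1)) = s ^ (a + 1) * s ^ (a + 1) := by
          rw [← Real.rpow_add (by linarith)]; ring_nf
        rw [h5]
        nlinarith
      calc Real.log (s + lam) ≤ Real.log (s ^ (2 * (a + 1))) :=
            Real.log_le_log (by linarith) h2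
        _ = _ := Real.log_rpow (by linarith) _
    calc (span : ℝ) ≤ 36 * B * Real.log (s + lam) := hsp
      _ ≤ 36 * B * (2 * (a + 1) * Real.log s) := by gcongr
      _ ≤ K * (a + 1) * Real.log s := by
        have : 0 ≤ (a + 1) * Real.log s := by positivity
        nlinarith

section
variable {D : ℕ} {α : ℝ} {many most : C.Chunk → ℕ} {ω : Tape C s} {l : List (Fin P)}

/-- Chunks other than the first are used only if they are not too large for the number of elements. -/
theorem Typical.size_lt (hω : Typical (fewAttempts C α) many most ω)
    (hS : Suitable C P s D many most) (hl : LooselySynchronized D ω l)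
    {t : C.Chunk} (ht : t ≤ (run ω l).mem.r) (h0 : t.val ≠ 0) :
    α * C.size t < 4 * s := by
  have h1 : t.val - 1 < C.last + 1 := by have := t.isLt; omega
  -- Chunk `t` is in use only if chunk `t - 1`, half its size, was given up.
  have h2 := hω.few_lt hS hl (t := ⟨t.val - 1, h1⟩) (show t.val - 1 < (run ω l).mem.r by
    have := Fin.le_def.1 ht; omega)
  unfold fewAttempts at h2
  have h3 : α * C.size (t.val - 1) / 2 < s := Nat.lt_of_floor_lt h2
  have h4 : C.size t = 2 * C.size (t.val - 1) := by
    obtain ⟨u, hu⟩ := Nat.exists_eq_succ_of_ne_zero h0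
    rw [hu, Nat.succ_sub_one, Config.size, Config.size, pow_succ]
    ring
  rw [h4]
  push_cast
  linarith

theorem Typical.tail_le (hω : Typical (fewAttempts C α) many most ω) (hα : 0 < α) (hα1 : α < 1)
    (hS : Suitable C P s D many most) (hl : LooselySynchronized D ω l) :
    (C.tail (run ω l).mem.r : ℝ) ≤ 8 / α * (s + C.lam) := by
  have h1 : (C.tail (run ω l).mem.r : ℝ) ≤ 2 * C.size (run ω l).mem.r := by
    exact_mod_cast HashBag.tail_le C _
  have h2 : α * C.size (run ω l).mem.r ≤ 4 * (s + C.lam) := by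
    by_cases h0 : (run ω l).mem.r.val = 0
    · rw [h0]
      simp only [Config.size, pow_zero, mul_one]
      nlinarith [Nat.cast_nonneg (α := ℝ) s, Nat.cast_nonneg (α := ℝ) C.lam]
    · have := hω.size_lt hS hl le_rfl h0
      nlinarith [Nat.cast_nonneg (α := ℝ) C.lam]
  rw [div_mul_eq_mul_div, le_div_iff₀ hα]
  nlinarith

theorem Typical.r_le (hω : Typical (fewAttempts C α) many most ω) (hα : 0 < α) (hα1 : α < 1)
    (hS : Suitable C P s D many most) (hl : LooselySynchronized D ω l) (hlam : 0 < C.lam)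
    (hs : 1 ≤ s) : ((run ω l).mem.r : ℝ) ≤ 2 * (Real.log (4 / α) + Real.log s) := by
  have hs' : (1 : ℝ) ≤ s := by exact_mod_cast hs
  have h4 : 0 ≤ Real.log (4 / α) := Real.log_nonneg ((one_le_div hα).2 (by linarith))
  have h5 : 0 ≤ Real.log s := Real.log_nonneg hs'
  by_cases h0 : (run ω l).mem.r.val = 0
  · rw [h0]
    push_cast
    linarith
  · have h1 := hω.size_lt hS hl le_rfl h0
    have h2 : (2 : ℝ) ^ (run ω l).mem.r.val ≤ C.size (run ω l).mem.r := by
      exact_mod_cast Nat.le_mul_of_pos_left _ hlam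
    have h3 : (2 : ℝ) ^ (run ω l).mem.r.val ≤ 4 / α * s := by
      rw [div_mul_eq_mul_div, le_div_iff₀ hα]
      nlinarith
    have h6 := Real.log_le_log (by positivity) h3
    rw [Real.log_pow, Real.log_mul (by positivity) (by positivity)] at h6
    have h7 := mul_le_mul_of_nonneg_left half_le_log_two
      (Nat.cast_nonneg (α := ℝ) (run ω l).mem.r.val)
    linarith

end

/-- The expected work of the insertions is linear. -/
theorem lintegral_work_le (hlam : 0 < C.lam) {D : ℕ} {α β : ℝ} (hα : 0 < α)
    (hβ : 0 < β) (hβ1 : β < 1) {many : C.Chunk → ℕ}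
    (hS : Suitable C P s D many (mostAttempts C β)) (hs : 1 ≤ s)
    (hprob : (tapeLaw C α s).real
        {ω | ¬ Typical (fewAttempts C α) many (mostAttempts C β) ω}
      * (1 + (C.last + 1) * (C.kappa + C.size C.last + 5) : ℕ) ≤ 1)
    {sched : Tape C s → List (Fin P)} (hsched : ∀ ω, LooselySynchronized D ω (sched ω)) :
    ∫⁻ ω, ((insertions (run ω (sched ω))).work : ℝ≥0∞) ∂(tapeLaw C α s)
      ≤ ENNReal.ofReal ((4 + (5 + β * Real.exp (1 - β) / (1 - β * Real.exp (1 - β)) ^ 2)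
        * (1 + 8 / α)) * s) := by
  classical
  have := isProbabilityMeasure_tapeLaw (C := C) hlam α s
  set H : ℕ := 1 + (C.last + 1) * (C.kappa + C.size C.last + 5) with hH
  set E := β * Real.exp (1 - β) / (1 - β * Real.exp (1 - β)) ^ 2 with hE
  have hE0 : 0 ≤ E := by positivity
  set bad := {ω : Tape C s | ¬ Typical (fewAttempts C α) many (mostAttempts C β) ω} with hbad
  -- A set of chunks independent of the tape that contains all chunks in use for typical choices;
  -- this allows the expectation to be taken chunk by chunk.
  set T := Finset.univ.filter fun t : C.Chunk => t.val = 0 ∨ α * C.size t < 4 * s with hT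
  have hslast : s < C.size C.last :=
    (hS.le_most_last (Fin.last _) rfl).trans_lt (hS.most_lt (Fin.last _))
  have hpoint : ∀ ω, ((insertions (run ω (sched ω))).work : ℝ)
      ≤ 3 * s + ∑ t ∈ T, (5 * (min s (mostAttempts C β t) : ℕ)
          + (excess ω t (min s (mostAttempts C β t)) : ℝ)) + bad.indicator (fun _ => (s : ℝ) * H) ω := by
    intro ω
    rw [insertions_work _ hs]
    by_cases hω : Typical (fewAttempts C α) many (mostAttempts C β) ω
    · rw [Set.indicator_of_notMem (by simpa [hbad] using hω), add_zero]
      have h1 := hω.sum_instrs_le hS (hsched ω)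
      have h2 : Finset.univ.filter (fun t => t ≤ (run ω (sched ω)).mem.r) ⊆ T := by
        intro t ht
        rw [Finset.mem_filter] at ht ⊢
        refine ⟨ht.1, ?_⟩
        by_cases h0 : t.val = 0
        · exact .inl h0
        · exact .inr (hω.size_lt hS (hsched ω) ht.2 h0)
      have h3 := Finset.sum_le_sum_of_subset h2 (f := fun t => 5 * min s (mostAttempts C β t)
        + excess ω t (min s (mostAttempts C β t)))
      have h4 : ∑ v, (run ω (sched ω)).instrs v + (s - 1)
          ≤ 3 * s + ∑ t ∈ T, (5 * min s (mostAttempts C β t)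
            + excess ω t (min s (mostAttempts C β t))) := by omega
      exact_mod_cast h4
    · rw [Set.indicator_of_mem (by simpa [hbad] using hω)]
      have h1 : ∑ v, (run ω (sched ω)).instrs v ≤ s * H := by
        refine (Finset.sum_le_card_nsmul _ _ H fun v _ =>
          instrs_le_of_lt_size ω (sched ω) hslast v).trans ?_
        simp
      have h2 : ((∑ v, (run ω (sched ω)).instrs v + (s - 1) : ℕ) : ℝ) ≤ s * H + s := by
        exact_mod_cast Nat.add_le_add h1 (Nat.sub_le s 1)
      have h3 : (0 : ℝ) ≤ ∑ t ∈ T, (5 * (min s (mostAttempts C β t) : ℕ)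
          + (excess ω t (min s (mostAttempts C β t)) : ℝ)) :=
        Finset.sum_nonneg fun t _ => by positivity
      have h4 : (0 : ℝ) ≤ s := Nat.cast_nonneg s
      linarith
  -- The tape space is finite, so integrability is automatic although the schedule is an arbitrary
  -- function of the tape.
  have hcast : ∫⁻ ω, ((insertions (run ω (sched ω))).work : ℝ≥0∞) ∂(tapeLaw C α s)
      = ENNReal.ofReal (∫ ω, ((insertions (run ω (sched ω))).work : ℝ) ∂(tapeLaw C α s)) := by
    rw [ofReal_integral_eq_lintegral_ofReal .of_finite (ae_of_all _ fun ω => Nat.cast_nonneg _)]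
    simp only [ENNReal.ofReal_natCast]
  rw [hcast]
  refine ENNReal.ofReal_le_ofReal ((integral_mono .of_finite .of_finite hpoint).trans ?_)
  rw [integral_add .of_finite .of_finite, integral_add .of_finite .of_finite, integral_const,
    probReal_univ, one_smul, integral_finsetSum _ fun _ _ => .of_finite,
    integral_indicator_const _ bad.toFinite.measurableSet, smul_eq_mul]
  have hm : ∀ t : C.Chunk, ((min s (mostAttempts C β t) : ℕ) : ℝ) ≤ C.size t := fun t => by
    exact_mod_cast (min_le_right _ _).trans (hS.most_lt t).le
  have hterm : ∀ t ∈ T, ∫ ω, (5 * ((min s (mostAttempts C β t) : ℕ) : ℝ)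
      + (excess ω t (min s (mostAttempts C β t)) : ℝ)) ∂(tapeLaw C α s)
        ≤ (5 + E) * (min s (mostAttempts C β t) : ℕ) := by
    intro t _
    rw [integral_add .of_finite .of_finite, integral_const, probReal_univ, one_smul, add_mul]
    have h1 := integral_excess_le (s := s) hlam α t (min s (mostAttempts C β t)) hβ hβ1 (by
      have h2 : ((mostAttempts C β t : ℕ) : ℝ) ≤ β * C.size t := Nat.floor_le (by positivity)
      refine le_trans ?_ h2
      exact_mod_cast (min_le_right _ _).trans (min_le_right _ _))
    rw [← hE, ← min_assoc, min_self] at h1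
    exact add_le_add_right h1 _
  -- Chunk 0 may be far larger than `s`, so it is bounded by `s`; the other chunks of `T` have size
  -- below `4 * s / α` and sum geometrically.
  have hsum : ∑ t ∈ T, ((min s (mostAttempts C β t) : ℕ) : ℝ) ≤ (1 + 8 / α) * s := by
    have h1 : T ⊆ insert 0 (Finset.univ.filter
        fun t : C.Chunk => (C.size t : ℝ) < 4 * s / α) := by
      intro t ht
      rw [Finset.mem_insert, Finset.mem_filter, lt_div_iff₀ hα, mul_comm]
      exact (Finset.mem_filter.1 ht).2.imp (fun h => Fin.ext h) fun h => ⟨Finset.mem_univ t, h⟩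
    have h2 := sum_size_le C (X := 4 * s / α) (by positivity)
    have h3 : ∑ t ∈ Finset.univ.filter (fun t : C.Chunk => (C.size t : ℝ) < 4 * s / α),
        ((min s (mostAttempts C β t) : ℕ) : ℝ) ≤ 2 * (4 * s / α) :=
      (Finset.sum_le_sum fun t _ => hm t).trans h2
    have h4 : ((min s (mostAttempts C β 0) : ℕ) : ℝ) ≤ s := by exact_mod_cast min_le_left _ _
    calc ∑ t ∈ T, ((min s (mostAttempts C β t) : ℕ) : ℝ)
        ≤ ∑ t ∈ insert 0 (Finset.univ.filter fun t : C.Chunk => (C.size t : ℝ) < 4 * s / α),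
            ((min s (mostAttempts C β t) : ℕ) : ℝ) :=
          Finset.sum_le_sum_of_subset_of_nonneg h1 fun _ _ _ => Nat.cast_nonneg _
      _ ≤ ((min s (mostAttempts C β 0) : ℕ) : ℝ)
            + ∑ t ∈ Finset.univ.filter (fun t : C.Chunk => (C.size t : ℝ) < 4 * s / α),
              ((min s (mostAttempts C β t) : ℕ) : ℝ) := by
          by_cases h0 : (0 : C.Chunk) ∈ Finset.univ.filter
            fun t : C.Chunk => (C.size t : ℝ) < 4 * s / α
          · rw [Finset.insert_eq_of_mem h0]
            exact le_add_of_nonneg_left (Nat.cast_nonneg _)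
          · rw [Finset.sum_insert h0]
      _ ≤ s + 2 * (4 * s / α) := add_le_add h4 h3
      _ = _ := by ring
  have h5 : ∑ t ∈ T, ∫ ω, (5 * ((min s (mostAttempts C β t) : ℕ) : ℝ)
      + (excess ω t (min s (mostAttempts C β t)) : ℝ)) ∂(tapeLaw C α s)
        ≤ (5 + E) * ((1 + 8 / α) * s) := by
    refine (Finset.sum_le_sum hterm).trans ?_
    rw [← Finset.mul_sum]
    exact mul_le_mul_of_nonneg_left hsum (by positivity)
  have h6 : (tapeLaw C α s).real bad * (s * H) ≤ s := by
    calc (tapeLaw C α s).real bad * (s * H) = s * ((tapeLaw C α s).real bad * H) := by ring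
      _ ≤ s * 1 := mul_le_mul_of_nonneg_left hprob (Nat.cast_nonneg _)
      _ = s := mul_one _
  linarith


/-! ### Admissible parameters and polynomial estimates -/

theorem suitable_of_le {D : ℕ} {α α₁ β : ℝ} (hα : 0 < α) (hα₁ : α < α₁) (h₁β : α₁ < β)
    (hβ1 : β < 1) (hlam : 0 < C.lam) (hσ : 0 < C.sigma)
    (hslack : 4 + (2 * D + 1) * (P : ℝ) ≤ (β - α₁) * C.lam)
    (hlast : (s : ℝ) ≤ β * C.size C.last) :
    Suitable C P s D (manyAttempts C α₁) (mostAttempts C β) where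
  sigma_pos := hσ
  many_add_le t _ := by
    have hle : (C.lam : ℝ) ≤ C.size t := by
      exact_mod_cast Nat.le_mul_of_pos_right _ (by positivity)
    refine Nat.le_floor ?_
    -- Rounding up costs 1 and the two synchronization windows cost `2 * (P * D + 1)`; the gap `(β -
    -- α₁) * λ` absorbs these and the last `P` attempts.
    have h1 : ((manyAttempts C α₁ t : ℕ) : ℝ) < α₁ * C.size t + 1 :=
      Nat.ceil_lt_add_one (mul_nonneg (hα.trans hα₁).le (Nat.cast_nonneg _))
    have h2 := mul_le_mul_of_nonneg_left hle (sub_pos.2 h₁β).le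
    push_cast
    nlinarith
  le_most_last t ht := by
    refine Nat.le_floor ?_
    rw [ht]
    exact hlast
  most_lt t := by
    have hsize : (0 : ℝ) < C.size t := by exact_mod_cast size_pos hlam t
    have hβ : 0 < β := (hα.trans hα₁).trans h₁β
    refine (Nat.floor_lt (by positivity)).2 ?_
    exact mul_lt_of_lt_one_left hsize hβ1

/-- The bound on the number of instructions of a call is polynomial. -/
theorem instrs_bound_le {α A N : ℝ} (hα : 0 < α) (hα1 : α < 1) (hN : 2 ≤ N) (hA : 1 ≤ A)
    (hlam : 0 < C.lam) (hcap : (C.capacity : ℝ) ≤ A * (N / α)) (hκ : (C.kappa : ℝ) ≤ A * N) :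
    ((1 + (C.last + 1) * (C.kappa + C.size C.last + 5) : ℕ) : ℝ) ≤ 6 * (A * N) ^ 2 / α ^ 2 := by
  have h1 : ((C.last + 1 : ℕ) : ℝ) ≤ C.capacity := by exact_mod_cast succ_le_tail hlam C.last
  have h2 : (C.size C.last : ℝ) ≤ C.capacity := by
    exact_mod_cast Nat.le_add_left (C.size C.last) (C.start C.last)
  set X := A * N / α with hX
  have hAN : 2 ≤ A * N := by nlinarith
  have hXAN : A * N ≤ X := by
    rw [hX, le_div_iff₀ hα]
    nlinarith
  have hcap' : (C.capacity : ℝ) ≤ X := by rw [hX, ← mul_div_assoc] at *; exact hcap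
  have h3 : ((1 + (C.last + 1) * (C.kappa + C.size C.last + 5) : ℕ) : ℝ)
      ≤ 1 + X * (X + X + 5) := by
    push_cast at h1 ⊢
    have h4 : (C.last : ℝ) + 1 ≤ X := h1.trans hcap'
    gcongr
    · exact hκ.trans hXAN
    · exact h2.trans hcap'
  refine h3.trans ?_
  rw [mul_div_assoc, ← div_pow, ← hX]
  nlinarith

/-- The failure probability is polynomially small. -/
theorem three_mul_pow_mul_exp_le {c α κ₀ N M : ℝ} (hα : 0 < α) (hα1 : α < 1) (hN : 2 ≤ N)
    (hM0 : 0 ≤ M) (hM : M ≤ N ^ 2 / α)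
    (hκ₀ : c + 10 + 2 * Real.log (18 / α ^ 5) ≤ κ₀) :
    3 * M ^ 3 * Real.exp (-(κ₀ * Real.log N)) * (6 * (N * N) ^ 2 / α ^ 2) ≤ N ^ (-c) := by
  have hN0 : 0 < N := by linarith
  have hlog : 1 / 2 ≤ Real.log N :=
    half_le_log_two.trans (Real.log_le_log (by norm_num) hN)
  have h1 : (1 : ℝ) ≤ 18 / α ^ 5 := by
    rw [one_le_div (by positivity)]
    exact (pow_le_one₀ hα.le hα1.le).trans (by norm_num)
  calc 3 * M ^ 3 * Real.exp (-(κ₀ * Real.log N)) * (6 * (N * N) ^ 2 / α ^ 2)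
      ≤ 3 * (N ^ 2 / α) ^ 3 * Real.exp (-(κ₀ * Real.log N)) * (6 * (N * N) ^ 2 / α ^ 2) := by
        gcongr
    -- Six powers of `N` come from the cube of the capacity and four from the bound on the
    -- instructions of a call.
    _ = 18 / α ^ 5 * N ^ 10 * Real.exp (-(κ₀ * Real.log N)) := by
        field_simp
        ring
    _ = Real.exp (Real.log (18 / α ^ 5) + 10 * Real.log N + -(κ₀ * Real.log N)) := by
        rw [Real.exp_add, Real.exp_add, Real.exp_log (by positivity),
          show (10 : ℝ) * Real.log N = ((10 : ℕ) : ℝ) * Real.log N by norm_num,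
          Real.exp_nat_mul, Real.exp_log hN0]
    _ ≤ Real.exp (Real.log N * -c) := by
        refine Real.exp_le_exp.2 ?_
        have h2 := mul_le_mul_of_nonneg_right hκ₀ (show 0 ≤ Real.log N by linarith)
        have h3 := mul_le_mul_of_nonneg_left hlog (Real.log_nonneg h1)
        nlinarith
    _ = N ^ (-c) := (Real.rpow_def_of_pos hN0 _).symm

theorem pow_le_exp_neg_mul {ρ κ₀ x : ℝ} {m : ℕ} (hρ : 0 < ρ) (h : κ₀ * x ≤ -Real.log ρ * m) :
    ρ ^ m ≤ Real.exp (-(κ₀ * x)) := by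
  rw [← Real.exp_log (pow_pos hρ m), Real.log_pow]
  exact Real.exp_le_exp.2 (by linarith)

theorem measure_le_of_subset {Ω : Type*} [MeasurableSpace Ω] {μ : Measure Ω} [IsFiniteMeasure μ]
    {S T : Set Ω} {b : ℝ} (h : S ⊆ T) (hT : μ.real T ≤ b) : μ S ≤ ENNReal.ofReal b := by
  rw [← ofReal_measureReal (measure_ne_top μ S)]
  exact ENNReal.ofReal_le_ofReal ((measureReal_mono h).trans hT)

/-- After complete insertions, listing and packing are correct. -/
theorem listing_and_packing_correct (hlam : 0 < C.lam) (ω : Tape C s) (l : List (Fin P))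
    (h : (run ω l).Complete) :
    (forAll (run ω l).mem).val.Perm (List.finRange s) ∧
      ((extractAll (run ω l).mem).val.1.map Prod.fst = List.range s) ∧
      ((extractAll (run ω l).mem).val.1.map Prod.snd).Perm (List.finRange s) ∧
      (extractAll (run ω l).mem).val.2 = Store.empty C (Fin s) := by
  have htail : 1 ≤ C.tail (run ω l).mem.r := (Nat.le_add_left 1 _).trans (succ_le_tail hlam _)
  have hperm := contents_perm_of_complete ω l h
  refine ⟨?_, ?_, ?_, ?_⟩
  · rw [forAll_val _ htail]; exact hperm
  · rw [extractAll_positions _ htail, hperm.length_eq, List.length_finRange]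
  · rw [extractAll_elements _ htail]; exact hperm
  · exact extractAll_store _ htail (confined_run ω l).bag (confined_run ω l).sample

/-- The costs of listing and packing, if not too many slots are in use. -/
theorem listing_and_packing_cost_le (hs : 1 ≤ s) (hlam : 2 ≤ C.lam) {B K : ℝ} (hB : 1 ≤ B)
    (hK : 100 * B ≤ K) (m : Store C (Fin s)) (hm : (C.tail m.r : ℝ) ≤ B * (s + C.lam)) :
    (((forAll m).work : ℝ) ≤ K * (s + C.lam) ∧
      ((forAll m).span : ℝ) ≤ K * Real.log (s + C.lam) ∧
      ∀ a : ℝ, (C.lam : ℝ) ≤ (s : ℝ) ^ a → ((forAll m).span : ℝ) ≤ K * (a + 1) * Real.log s) ∧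
    (((extractAll m).work : ℝ) ≤ K * (s + C.lam) ∧
      ((extractAll m).span : ℝ) ≤ K * Real.log (s + C.lam) ∧
      ∀ a : ℝ, (C.lam : ℝ) ≤ (s : ℝ) ^ a →
        ((extractAll m).span : ℝ) ≤ K * (a + 1) * Real.log s) := by
  have htail := succ_le_tail (C := C) (by omega) m.r
  have h1 := forAll_work_le m (by omega)
  have h2 := forAll_span_le m (by omega)
  exact ⟨slot_loop_cost_le hB hs hlam (by omega) hm (by omega) (by omega) hK,
    slot_loop_cost_le hB hs hlam (by omega) hm (extractAll_work_le m htail)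
      (extractAll_span_le m htail) hK⟩

/-- The span of the insertions for typical random choices. -/
theorem Typical.span_le {D n : ℕ} {α A K : ℝ} {many most : C.Chunk → ℕ} {ω : Tape C s}
    {l : List (Fin P)} (hω : Typical (fewAttempts C α) many most ω) (hα : 0 < α) (hα1 : α < 1)
    (hS : Suitable C P s D many most) (hl : LooselySynchronized D ω l) (hlam : 0 < C.lam)
    (hn : 2 ≤ n) (hs : 1 ≤ s) (hκ : (C.kappa : ℝ) ≤ A * Real.log n)
    (hK : 6 + (2 + 2 * Real.log (4 / α)) * (A + 10) ≤ K) :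
    ((insertions (run ω l)).span : ℝ) ≤ K * ((1 + Real.log s) * Real.log n) := by
  have hlogn : 1 / 2 ≤ Real.log n :=
    half_le_log_two.trans (Real.log_le_log (by norm_num) (by exact_mod_cast hn))
  have hlogs : 0 ≤ Real.log s := Real.log_natCast_nonneg s
  have hg : 0 ≤ Real.log (4 / α) := Real.log_nonneg ((one_le_div hα).2 (by linarith))
  have h1 := insertions_span_le (run ω l) hs _ fun v => hω.instrs_le hS hl v
  have h2 : ((insertions (run ω l)).span : ℝ)
      ≤ 1 + (((run ω l).mem.r : ℝ) + 1) * (C.kappa + 5) + Nat.clog 2 s := by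
    exact_mod_cast h1
  have h3 := clog_two_le hs
  have h4 := hω.r_le hα hα1 hS hl hlam hs
  set X := (1 + Real.log s) * Real.log n with hX
  have h5 : (((run ω l).mem.r : ℝ) + 1) * (C.kappa + 5)
      ≤ ((2 + 2 * Real.log (4 / α)) * (1 + Real.log s)) * ((A + 10) * Real.log n) := by
    gcongr
    · nlinarith
    · nlinarith
  have h6 : 1 / 2 * (1 + Real.log s) ≤ X := by
    rw [hX, mul_comm]; exact mul_le_mul_of_nonneg_left hlogn (by linarith)
  calc ((insertions (run ω l)).span : ℝ)
      ≤ 1 + ((2 + 2 * Real.log (4 / α)) * (1 + Real.log s)) * ((A + 10) * Real.log n)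
        + (2 * Real.log s + 1) := by linarith
    _ ≤ (6 + (2 + 2 * Real.log (4 / α)) * (A + 10)) * X := by
        have : ((2 + 2 * Real.log (4 / α)) * (1 + Real.log s)) * ((A + 10) * Real.log n)
          = ((2 + 2 * Real.log (4 / α)) * (A + 10)) * X := by rw [hX]; ring
        rw [this]
        nlinarith
    _ ≤ K * X := mul_le_mul_of_nonneg_right hK (by linarith)

/-- If the number of instructions of every call is at most `b`, then the insertions have work `O(b s)`
and span `O(b + log s)`. -/
theorem insertions_cost_le {n : ℕ} {b K : ℝ} (hn : 2 ≤ n) (hs : 1 ≤ s) (st : State C P s)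
    (hb : ∀ v, (st.instrs v : ℝ) ≤ b) (hb0 : 0 ≤ b) (hK : 2 * b + 4 ≤ K) :
    ((insertions st).work : ℝ) ≤ K * s ∧
      ((insertions st).span : ℝ) ≤ K * ((1 + Real.log s) * Real.log n) := by
  have hlogn : 1 / 2 ≤ Real.log n :=
    half_le_log_two.trans (Real.log_le_log (by norm_num) (by exact_mod_cast hn))
  have hlogs : 0 ≤ Real.log s := Real.log_natCast_nonneg s
  have hs0 : (0 : ℝ) ≤ s := Nat.cast_nonneg s
  constructor
  · have h1 : (insertions st).work ≤ ∑ v, st.instrs v + s := by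
      rw [insertions_work st hs]; omega
    have h2 : ((insertions st).work : ℝ) ≤ ∑ v, (st.instrs v : ℝ) + s := by exact_mod_cast h1
    have h3 := Finset.sum_le_card_nsmul Finset.univ (fun v => (st.instrs v : ℝ)) b fun v _ => hb v
    simp only [Finset.card_univ, Fintype.card_fin, nsmul_eq_mul] at h3
    nlinarith
  · have h1 := insertions_span_le st hs ⌊b⌋₊ fun v => Nat.le_floor (hb v)
    have h2 : ((insertions st).span : ℝ) ≤ (⌊b⌋₊ : ℝ) + Nat.clog 2 s := by exact_mod_cast h1
    have h3 := clog_two_le hs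
    have h4 := Nat.floor_le hb0
    have h6 : 1 / 2 * (1 + Real.log s) ≤ (1 + Real.log s) * Real.log n := by
      rw [mul_comm]; exact mul_le_mul_of_nonneg_left hlogn (by linarith)
    calc ((insertions st).span : ℝ) ≤ (2 * b + 4) * (1 / 2 * (1 + Real.log s)) := by nlinarith
      _ ≤ K * ((1 + Real.log s) * Real.log n) :=
        mul_le_mul hK h6 (by linarith) (by linarith)

end HashBag

/-! ### Choice of the constants and the main theorem -/

set_option maxHeartbeats 1000000 in
theorem mainTheorem1 (c : ℝ) (hc : 0 < c) (α : ℝ) (hα0 : 0 < α) (hα1 : α < 1) (D : ℕ) :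
    ∃ K₀ : ℝ, 0 < K₀ ∧ ∀ A : ℝ, ∃ K : ℝ, 0 < K ∧
      ∀ (n P s : ℕ) (C : HashBag.Config), 2 ≤ n → 1 ≤ s → s ≤ n →
        -- the array has size `Θ(n / α)`
        2 * (n / α) ≤ C.capacity → C.capacity ≤ A * (n / α) →
        -- `λ = Ω((P + log n) log n)`
        K₀ * ((P + Real.log n) * Real.log n) ≤ C.lam →
        -- `σ = Ω(log n)`, and the sampling rate `σ / (α λ)` of the first chunk is at most `1`
        K₀ * Real.log n ≤ C.sigma → C.sigma ≤ α * C.lam →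
        -- the limit on the number of probes is `Θ(log n)`
        K₀ * Real.log n ≤ C.kappa → C.kappa ≤ A * Real.log n →
        -- the schedule is adversarial and may depend on the random choices in any way
        ∀ sched : HashBag.Tape C s → List (Fin P),
          (∀ ω, HashBag.LooselySynchronized D ω (sched ω)) →
          -- insertion: expected work, and span with high probability
          (∫⁻ ω, ((HashBag.insertions (HashBag.run ω (sched ω))).work : ℝ≥0∞)
              ∂(HashBag.tapeLaw C α s) ≤ ENNReal.ofReal (K * s)) ∧
          (HashBag.tapeLaw C α s
              {ω | ¬ ((HashBag.insertions (HashBag.run ω (sched ω))).span : ℝ)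
                ≤ K * ((1 + Real.log s) * Real.log n)}
            ≤ ENNReal.ofReal ((n : ℝ) ^ (-c))) ∧
          -- listing
          (HashBag.tapeLaw C α s
              {ω | ¬ (((HashBag.forAll (HashBag.run ω (sched ω)).mem).work : ℝ)
                    ≤ K * (s + C.lam) ∧
                  ((HashBag.forAll (HashBag.run ω (sched ω)).mem).span : ℝ)
                    ≤ K * Real.log (s + C.lam) ∧
                  ∀ a : ℝ, (C.lam : ℝ) ≤ (s : ℝ) ^ a →
                    ((HashBag.forAll (HashBag.run ω (sched ω)).mem).span : ℝ)
                      ≤ K * (a + 1) * Real.log s)}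
            ≤ ENNReal.ofReal ((n : ℝ) ^ (-c))) ∧
          -- packing
          (HashBag.tapeLaw C α s
              {ω | ¬ (((HashBag.extractAll (HashBag.run ω (sched ω)).mem).work : ℝ)
                    ≤ K * (s + C.lam) ∧
                  ((HashBag.extractAll (HashBag.run ω (sched ω)).mem).span : ℝ)
                    ≤ K * Real.log (s + C.lam) ∧
                  ∀ a : ℝ, (C.lam : ℝ) ≤ (s : ℝ) ^ a →
                    ((HashBag.extractAll (HashBag.run ω (sched ω)).mem).span : ℝ)
                      ≤ K * (a + 1) * Real.log s)}
            ≤ ENNReal.ofReal ((n : ℝ) ^ (-c))) ∧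
          -- once all insertions have returned, exactly the `s` elements are listed and packed,
          -- the latter into the positions `0, …, s - 1` of an array, and the bag becomes empty
          (∀ ω, (HashBag.run ω (sched ω)).Complete →
            (HashBag.forAll (HashBag.run ω (sched ω)).mem).val.Perm (List.finRange s) ∧
            ((HashBag.extractAll (HashBag.run ω (sched ω)).mem).val.1.map Prod.fst
              = List.range s) ∧
            ((HashBag.extractAll (HashBag.run ω (sched ω)).mem).val.1.map Prod.snd).Perm
              (List.finRange s) ∧
            (HashBag.extractAll (HashBag.run ω (sched ω)).mem).val.2
              = HashBag.Store.empty C (Fin s)) := by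
  -- Equally spaced load factors `α < α₁ < β < 1`: the first gap makes enough samples likely, the
  -- second absorbs the delay of the processors, the third keeps linear probing efficient.
  obtain ⟨d, hd⟩ : ∃ d, d = (1 - α) / 3 := ⟨_, rfl⟩
  have hd0 : 0 < d := by rw [hd]; linarith
  obtain ⟨α₁, hα₁⟩ : ∃ α₁, α₁ = α + d := ⟨_, rfl⟩
  obtain ⟨β, hβ⟩ : ∃ β, β = α + 2 * d := ⟨_, rfl⟩
  have hβ0 : 0 < β := by linarith
  have hβ1 : β < 1 := by linarith
  have hαα₁ : α < α₁ := by linarith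
  obtain ⟨ρ, hρ⟩ : ∃ ρ, ρ = max (1 / 2 * Real.exp (1 - 1 / 2))
      (max (α₁ / α * Real.exp (1 - α₁ / α)) (β * Real.exp (1 - β))) := ⟨_, rfl⟩
  have hρ0 : 0 < ρ := by rw [hρ]; exact lt_max_of_lt_left (by positivity)
  have hρ1 : ρ < 1 := by
    rw [hρ]
    refine max_lt (HashBag.mul_exp_one_sub_lt_one (by norm_num))
      (max_lt (HashBag.mul_exp_one_sub_lt_one ?_) (HashBag.mul_exp_one_sub_lt_one hβ1.ne))
    exact ((one_lt_div hα0).2 hαα₁).ne'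
  obtain ⟨L, hL⟩ : ∃ L, L = -Real.log ρ := ⟨_, rfl⟩
  have hL0 : 0 < L := by rw [hL]; exact neg_pos.2 (Real.log_neg hρ0 hρ1)
  -- The exponent 10 pays for the union bound and for the worst-case cost of a call. The factor 2
  -- turns the constant into a multiple of `log n`, as `log n ≥ 1 / 2`.
  obtain ⟨w, hw⟩ : ∃ w, w = c + 10 + 2 * Real.log (18 / α ^ 5) := ⟨_, rfl⟩
  have hw0 : 0 < w := by
    have h1 : (1 : ℝ) ≤ 18 / α ^ 5 := by
      rw [one_le_div (by positivity)]
      exact (pow_le_one₀ hα0.le hα1.le).trans (by norm_num)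
    have := Real.log_nonneg h1
    linarith
  -- The three summands serve, in order, `ρ ^ σ` and `ρ ^ κ` being at most `n ^ (-w)`, the slack for
  -- `P` processors in the first chunk, and `λ ≥ 2`.
  obtain ⟨K₀, hK₀⟩ : ∃ K₀, K₀ = w / L + (16 + 2 * (2 * D + 1)) / d + 16 := ⟨_, rfl⟩
  have hwL : 0 < w / L := by positivity
  have hDd : 0 < (16 + 2 * (2 * (D : ℝ) + 1)) / d := by positivity
  have hK₀0 : 0 < K₀ := by linarith
  refine ⟨K₀, hK₀0, fun A => ?_⟩
  obtain ⟨A', hA'⟩ : ∃ A', A' = max A 1 := ⟨_, rfl⟩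
  have hAA' : A ≤ A' := hA' ▸ le_max_left _ _
  have hA'1 : 1 ≤ A' := hA' ▸ le_max_right _ _
  obtain ⟨B, hB⟩ : ∃ B, B = 8 / α + A' ^ 2 / α := ⟨_, rfl⟩
  have h8α : 1 ≤ 8 / α := (one_le_div hα0).2 (by linarith)
  have hA'α : 0 < A' ^ 2 / α := by positivity
  obtain ⟨H, hH⟩ : ∃ H, H = 6 * (A' * A') ^ 2 / α ^ 2 := ⟨_, rfl⟩
  have hH0 : 0 ≤ H := by rw [hH]; positivity
  obtain ⟨E, hE⟩ : ∃ E, E = 4 + (5 + β * Real.exp (1 - β) / (1 - β * Real.exp (1 - β)) ^ 2)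
    * (1 + 8 / α) := ⟨_, rfl⟩
  have hE0 : 0 ≤ E := by rw [hE]; positivity
  obtain ⟨S, hS⟩ : ∃ S, S = 6 + (2 + 2 * Real.log (4 / α)) * (A' + 10) := ⟨_, rfl⟩
  have hS0 : 0 ≤ S := by
    have := Real.log_nonneg ((one_le_div hα0).2 (by linarith : α ≤ 4))
    rw [hS]; positivity
  obtain ⟨K, hK⟩ : ∃ K, K = 100 * B + S + (2 * H + 4) + E := ⟨_, rfl⟩
  refine ⟨K, by linarith, ?_⟩
  intro n P s C hn hs hsn hcap₁ hcap₂ hlam hσ hσα hκ₁ hκ₂ sched hsched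
  have hn0 : (2 : ℝ) ≤ n := by exact_mod_cast hn
  have hlogn : 1 / 2 ≤ Real.log n :=
    HashBag.half_le_log_two.trans (Real.log_le_log (by norm_num) hn0)
  have hsR : (1 : ℝ) ≤ s := by exact_mod_cast hs
  have hsnR : (s : ℝ) ≤ n := by exact_mod_cast hsn
  have hcapA : (C.capacity : ℝ) ≤ A' * (n / α) :=
    hcap₂.trans (mul_le_mul_of_nonneg_right hAA' (by positivity))
  have hκA : (C.kappa : ℝ) ≤ A' * Real.log n :=
    hκ₂.trans (mul_le_mul_of_nonneg_right hAA' (by linarith))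
  have hκN : (C.kappa : ℝ) ≤ A' * n :=
    hκA.trans (mul_le_mul_of_nonneg_left (Real.log_le_self (by linarith)) (by linarith))
  have hlamK : K₀ * (P / 2 + 1 / 4) ≤ C.lam := by
    refine (mul_le_mul_of_nonneg_left ?_ hK₀0.le).trans hlam
    calc (P : ℝ) / 2 + 1 / 4 = (P + 1 / 2) * (1 / 2) := by ring
      _ ≤ (P + Real.log n) * Real.log n := by gcongr
  have hP : (0 : ℝ) ≤ P := Nat.cast_nonneg P
  have hlam4 : (2 : ℝ) ≤ C.lam :=
    calc (2 : ℝ) ≤ 16 * (0 + 1 / 4) := by norm_num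
      _ ≤ K₀ * (P / 2 + 1 / 4) := by
        gcongr
        · linarith only [hK₀, hwL, hDd]
        · positivity
      _ ≤ C.lam := hlamK
  have hlam2 : 2 ≤ C.lam := by exact_mod_cast hlam4
  have hlam0 : 0 < C.lam := by omega
  have hslack : 4 + (2 * D + 1) * (P : ℝ) ≤ (β - α₁) * C.lam := by
    have h1 : (16 + 2 * (2 * (D : ℝ) + 1)) / d * (P / 2 + 1 / 4) ≤ C.lam :=
      (mul_le_mul_of_nonneg_right (by linarith) (by positivity)).trans hlamK
    have h2 : β - α₁ = d := by rw [hβ, hα₁]; ring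
    rw [div_mul_eq_mul_div, div_le_iff₀ hd0] at h1
    have hD : (0 : ℝ) ≤ D := Nat.cast_nonneg D
    rw [h2]
    linarith only [h1, hP, hD, mul_nonneg hD hP]
  have hσ0 : 0 < C.sigma := by
    have : (0 : ℝ) < C.sigma := (mul_pos hK₀0 (by linarith only [hlogn])).trans_le hσ
    exact_mod_cast this
  have hlast : (s : ℝ) ≤ α * C.size C.last := by
    have h1 : (C.capacity : ℝ) ≤ 2 * C.size C.last := by exact_mod_cast HashBag.tail_le C C.last
    have h2 : n / α ≤ C.size C.last := by linarith
    rw [div_le_iff₀' hα0] at h2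
    exact hsnR.trans h2
  have hsize : (0 : ℝ) < C.size C.last := by exact_mod_cast HashBag.size_pos hlam0 C.last
  have hSuit := HashBag.suitable_of_le (C := C) (P := P) (s := s) (D := D) hα0 hαα₁
    (by linarith : α₁ < β) hβ1 hlam0 hσ0 hslack
    (hlast.trans (mul_le_mul_of_nonneg_right (by linarith) hsize.le))
  have hssize : s < C.size C.last := by
    have : (s : ℝ) < C.size C.last := hlast.trans_lt (mul_lt_of_lt_one_left hsize hα1)
    exact_mod_cast this
  have hprob := HashBag.isProbabilityMeasure_tapeLaw (C := C) hlam0 α s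
  -- it suffices to control the insertions outside of an unlikely event
  suffices hmain : (∫⁻ ω, ((HashBag.insertions (HashBag.run ω (sched ω))).work : ℝ≥0∞)
        ∂(HashBag.tapeLaw C α s) ≤ ENNReal.ofReal (K * s)) ∧
      ∃ T, (HashBag.tapeLaw C α s).real T ≤ (n : ℝ) ^ (-c) ∧ ∀ ω, ω ∉ T →
        ((HashBag.insertions (HashBag.run ω (sched ω))).span : ℝ)
          ≤ K * ((1 + Real.log s) * Real.log n) ∧
        (C.tail (HashBag.run ω (sched ω)).mem.r : ℝ) ≤ B * (s + C.lam) by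
    obtain ⟨hwork, T, hT, hgood⟩ := hmain
    have hcost := fun ω hω => HashBag.listing_and_packing_cost_le hs hlam2
      (by linarith : 1 ≤ B) (by linarith : 100 * B ≤ K) _ (hgood ω hω).2
    refine ⟨hwork, HashBag.measure_le_of_subset (fun ω hω => ?_) hT,
      HashBag.measure_le_of_subset (fun ω hω => ?_) hT,
      HashBag.measure_le_of_subset (fun ω hω => ?_) hT,
      fun ω => HashBag.listing_and_packing_correct hlam0 ω _⟩
    · by_contra h; exact hω (hgood ω h).1
    · by_contra h; exact hω (hcost ω h).1
    · by_contra h; exact hω (hcost ω h).2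
  -- `K₀` must not depend on `A`, so the failure estimate can absorb a factor `A'` only when `A' ≤
  -- n`. For the finitely many smaller `n`, the deterministic bound on the instructions of a call is
  -- a constant, and no exceptional event is needed.
  rcases lt_or_ge (n : ℝ) A' with hnA | hnA
  · -- finitely many `n`
    have hcost := fun ω => HashBag.insertions_cost_le (n := n) (b := H) (K := K) hn hs
      (HashBag.run ω (sched ω)) (fun v => by
        have h1 : ((HashBag.run ω (sched ω)).instrs v : ℝ) ≤ _ :=
          Nat.cast_le.2 (HashBag.instrs_le_of_lt_size ω (sched ω) hssize v)
        refine h1.trans ((HashBag.instrs_bound_le hα0 hα1 hn0 hA'1 hlam0 hcapA hκN).trans ?_)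
        rw [hH]
        gcongr) hH0 (by linarith)
    refine ⟨?_, ∅, ?_, fun ω _ => ⟨(hcost ω).2, ?_⟩⟩
    · calc _ ≤ ∫⁻ _, ENNReal.ofReal (K * s) ∂(HashBag.tapeLaw C α s) := by
            refine lintegral_mono fun ω => ?_
            rw [← ENNReal.ofReal_natCast]
            exact ENNReal.ofReal_le_ofReal (hcost ω).1
        _ = _ := by simp
    · rw [measureReal_empty]; positivity
    · have h1 : (C.tail (HashBag.run ω (sched ω)).mem.r : ℝ) ≤ C.capacity := by
        exact_mod_cast HashBag.tail_mono C (Nat.le_of_lt_succ (Fin.isLt _))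
      have h2 : A' * (n / α) ≤ A' ^ 2 / α := by
        rw [← mul_div_assoc, sq]; gcongr
      have h3 : B * 1 ≤ B * (s + C.lam) :=
        mul_le_mul_of_nonneg_left (by linarith) (by linarith)
      linarith
  · -- typical random choices
    have hcapN : (C.capacity : ℝ) ≤ (n : ℝ) ^ 2 / α := by
      refine hcapA.trans ?_
      rw [← mul_div_assoc, sq]
      gcongr
    have hpow : ∀ m : ℕ, K₀ * Real.log n ≤ m → ρ ^ m ≤ Real.exp (-(w * Real.log n)) := by
      intro m hm
      refine HashBag.pow_le_exp_neg_mul hρ0 ?_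
      have h1 : w / L * Real.log n ≤ m :=
        (mul_le_mul_of_nonneg_right (by linarith) (by linarith)).trans hm
      rw [div_mul_eq_mul_div, div_le_iff₀' hL0] at h1
      rw [← hL]; exact h1
    have hbad := HashBag.prob_not_typical_le (s := s) hlam0 hα0 hαα₁ hβ0 hβ1 hσα
      (hρ ▸ le_max_left _ _) (hρ ▸ (le_max_left _ _).trans (le_max_right _ _))
      (hρ ▸ (le_max_right _ _).trans (le_max_right _ _)) hρ1.le (hpow _ hσ) (hpow _ hκ₁)
    have hsmall := HashBag.three_mul_pow_mul_exp_le hα0 hα1 hn0 (Nat.cast_nonneg C.capacity)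
      hcapN hw.ge
    have hinstr : ((1 + (C.last + 1) * (C.kappa + C.size C.last + 5) : ℕ) : ℝ)
        ≤ 6 * ((n : ℝ) * n) ^ 2 / α ^ 2 :=
      (HashBag.instrs_bound_le hα0 hα1 hn0 hA'1 hlam0 hcapA hκN).trans (by gcongr)
    have hone : 1 ≤ 6 * ((n : ℝ) * n) ^ 2 / α ^ 2 :=
      le_trans (by exact_mod_cast Nat.le_add_right 1 _) hinstr
    have hq0 : 0 ≤ 3 * (C.capacity : ℝ) ^ 3 * Real.exp (-(w * Real.log n)) := by positivity
    refine ⟨?_, _, hbad.trans ((le_mul_of_one_le_right hq0 hone).trans hsmall),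
      fun ω hω => ?_⟩
    · refine (HashBag.lintegral_work_le hlam0 hα0 hβ0 hβ1 hSuit hs ?_ hsched).trans
        (ENNReal.ofReal_le_ofReal (mul_le_mul_of_nonneg_right ?_ (by linarith)))
      -- The probability of atypical choices times the worst-case cost of a call is at most `n ^
      -- (-c) ≤ 1`.
      · refine (mul_le_mul hbad hinstr (Nat.cast_nonneg _) hq0).trans (hsmall.trans ?_)
        exact Real.rpow_le_one_of_one_le_of_nonpos (by linarith) (by linarith)
      · rw [← hE]; linarith
    · have htyp := not_not.1 hω
      refine ⟨htyp.span_le hα0 hα1 hSuit (hsched ω) hlam0 hn hs hκA (by rw [← hS]; linarith), ?_⟩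
      refine (htyp.tail_le hα0 hα1 hSuit (hsched ω)).trans ?_
      exact mul_le_mul_of_nonneg_right (by linarith) (by linarith)
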